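/- Let $n\ge 1$. Let $(M,\langle\cdot,\cdot\rangle_M)$ be a complete $(n+1)$-dimensional Riemannian manifold with a complete Killing vector field $Y$, and let $(P,\langle\cdot,\cdot\rangle_P)$ be an $n$-dimensional Riemannian manifold embedded isometrically in $M$ as an integral leaf of the distribution orthogonal to $Y$, such that the flow $\vartheta:P\times\mathbb R\to M$ of $Y$ started from $P$ is a diffeomorphism. Put $\psi=-\log|Y|$; then $\psi$ is constant along the flow, and $M$ is identified with the warped product $P\times_{e^{-\psi}}\mathbb R$ with metric $\langle\cdot,\cdot\rangle_P+e^{-2\psi}\,ds\otimes ds$. Let $\Omega\subseteq P$ be open, let $u:\Omega\to\mathbb R$ be smooth, and let $\Sigma=\{\vartheta(x,u(x)):x\in\Omega\}\subset M$ be its Killing graph, with the induced metric, projection $\pi:\Sigma\to P$, $\pi(\vartheta(x,u(x)))=x$, and upward unit normal $$\mathcal N=\frac{e^{2\psi}Y-\vartheta_*\nabla^P u}{\sqrt{e^{2\psi}+|\nabla^P u|^2}} .$$ Let $H$ be the mean curvature of $\Sigma$ with respect to $\mathcal N$, i.e. $\frac1n$ times the trace of the second fundamental form $(V,W)\mapsto\langle\nabla^M_V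 W,\mathcal N\rangle_M$. For $D\in\mathbb R$ put $$H_{D\psi}=H+\tfrac1n\langle\nabla^M(D\psi),\mathcal N\rangle_M,$$ regarded as a function on $\Omega$. Denote by $B^\Sigma_R$ the balls of the intrinsic distance of $\Sigma$ (infimum of the lengths of $C^1$ curves in $\Sigma$), by $B^P_R$ the geodesic balls of $P$, and put $\Omega_R(x_0)=B^P_R(x_0)\cap\Omega$. Let $\mathrm{vol}_{D\psi}(B)=\int_B e^{-D\psi}$, the integral being taken with respect to the Riemannian volume of $\Sigma$ or of $P$. (1) For every $x_0\in\Omega$, $y_0=\vartheta(x_0,u(x_0))$ and $R>0$, $$\pi\big(B_R^\Sigma(y_0)\big)\subseteq\Omega_R(x_0).$$ (2) For every $A\ge 0$ there is a constant $C>0$, depending only on $n$ and $A$, with the following property. Let $D\in\mathbb R$, and assume that $u$ extends continuously to $\overline\Omega$ with $u=0$ on $\partial\Omega$ (that is, $\partial\Sigma\subset P\times\{0\}$) and that $$\sup_\Omega|u\,e^{-\psi}|+\sup_\Omega|H_{D\psi}|\le A .$$ Then for all $x_0\in\Omega$, $y_0=\vartheta(x_0,u(x_0))$ and all $\delta,R>0$,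 $$\mathrm{vol}_{D\psi}\big(B_R^\Sigma(y_0)\big)\le C\Big(1+\frac1{\delta R}\Big)\,\mathrm{vol}_{D\psi}\big(\Omega_{(1+\delta)R}(x_0)\big).$$ -/

import Mathlib

open Bundle Set Filter MeasureTheory Manifold
open scoped Manifold ContDiff Topology ENNReal NNReal

noncomputable section

namespace KillingGraph

section Volume

theorem exists_chart_cover {E : Type*} [TopologicalSpace E] {P : Type*} [TopologicalSpace P]
    [ChartedSpace E P] [SecondCountableTopology P] [Nonempty P] :
    ∃ c : ℕ → P, ⋃ k, (chartAt E (c k)).source = univ := by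
  obtain ⟨s, hs, hU⟩ := TopologicalSpace.countable_cover_nhds
    (fun x : P ↦ (chartAt E x).open_source.mem_nhds (mem_chart_source E x))
  have hne : s.Nonempty := by
    obtain ⟨x⟩ := ‹Nonempty P›
    have hx : x ∈ ⋃ y ∈ s, (chartAt E y).source := hU ▸ mem_univ x
    simp only [mem_iUnion] at hx
    obtain ⟨y, hy, -⟩ := hx
    exact ⟨y, hy⟩
  obtain ⟨c, rfl⟩ := hs.exists_eq_range hne
  exact ⟨c, by simpa using hU⟩

variable {E : Type*} [NormedAddCommGroup E] [InnerProductSpace ℝ E] [FiniteDimensional ℝ E]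
  {P : Type*} [TopologicalSpace P] [ChartedSpace E P]

/-- The Gram matrix `g(∂ᵢ, ∂ⱼ)`, at the coordinate `y` of the chart centred at `c`, of a field `g` of
bilinear forms on the tangent spaces. -/
def chartGram (g : ∀ x : P, TangentSpace 𝓘(ℝ, E) x → TangentSpace 𝓘(ℝ, E) x → ℝ)
    (c : P) (y : E) : Matrix (Fin (Module.finrank ℝ E)) (Fin (Module.finrank ℝ E)) ℝ :=
  Matrix.of fun i j ↦ g ((extChartAt 𝓘(ℝ, E) c).symm y)
    (mfderiv 𝓘(ℝ, E) 𝓘(ℝ, E) (extChartAt 𝓘(ℝ, E) c).symm y (stdOrthonormalBasis ℝ E i))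
    (mfderiv 𝓘(ℝ, E) 𝓘(ℝ, E) (extChartAt 𝓘(ℝ, E) c).symm y (stdOrthonormalBasis ℝ E j))

variable [MeasurableSpace E] [BorelSpace E] [MeasurableSpace P]

/-- The measure `√det(gᵢⱼ) dy` on the domain of the chart centred at `c`. -/
def chartVolume (g : ∀ x : P, TangentSpace 𝓘(ℝ, E) x → TangentSpace 𝓘(ℝ, E) x → ℝ)
    (c : P) : Measure P :=
  Measure.map (extChartAt 𝓘(ℝ, E) c).symm
    ((volume.restrict (extChartAt 𝓘(ℝ, E) c).target).withDensity
      fun y ↦ ENNReal.ofReal (√(chartGram g c y).det))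

open Classical in
/-- The Riemannian volume measure of `g`: on each chart domain it is `√det(gᵢⱼ) dy`, and these
measures are glued along a countable cover by chart domains, made disjoint. (Such a cover exists
whenever `P` is nonempty and second countable, see `exists_chart_cover`; the value does not depend
on the cover, by the change of variables formula.) -/
def riemannianVolume
    (g : ∀ x : P, TangentSpace 𝓘(ℝ, E) x → TangentSpace 𝓘(ℝ, E) x → ℝ) : Measure P :=
  if h : ∃ c : ℕ → P, ⋃ k, (chartAt E (c k)).source = univ then
    Measure.sum fun k ↦ (chartVolume g (h.choose k)).restrict
      (disjointed (fun k ↦ (chartAt E (h.choose k)).source) k)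
  else 0

end Volume

section Metric

variable {E : Type*} [NormedAddCommGroup E] [InnerProductSpace ℝ E]
  {P : Type*} [TopologicalSpace P] [ChartedSpace E P]
  [RiemannianBundle (fun x : P ↦ TangentSpace 𝓘(ℝ, E) x)]

/-- The Riemannian metric of `P`, as a field of bilinear forms. -/
def metric (x : P) (v w : TangentSpace 𝓘(ℝ, E) x) : ℝ := inner ℝ v w

/-- The gradient `∇u` of a function for the Riemannian metric. -/
def grad [FiniteDimensional ℝ E] (u : P → ℝ) (x : P) : TangentSpace 𝓘(ℝ, E) x :=
  haveI : FiniteDimensional ℝ (TangentSpace 𝓘(ℝ, E) x) :=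
    inferInstanceAs (FiniteDimensional ℝ E)
  haveI : CompleteSpace (TangentSpace 𝓘(ℝ, E) x) := FiniteDimensional.complete ℝ _
  (InnerProductSpace.toDual ℝ (TangentSpace 𝓘(ℝ, E) x)).symm
    (mfderiv 𝓘(ℝ, E) 𝓘(ℝ, ℝ) u x)

end Metric

section Hypersurface

variable {E : Type*} [NormedAddCommGroup E] [InnerProductSpace ℝ E]
  {F : Type*} [NormedAddCommGroup F] [InnerProductSpace ℝ F]
  {P : Type*} [TopologicalSpace P] [ChartedSpace E P]
  {M : Type*} [TopologicalSpace M] [ChartedSpace F M]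

/-- The local expression of `X : P → M` in the charts centred at `p` and `X p`. -/
def localRep (X : P → M) (p : P) : E → F :=
  extChartAt 𝓘(ℝ, F) (X p) ∘ X ∘ (extChartAt 𝓘(ℝ, E) p).symm

variable [RiemannianBundle (fun p : M ↦ TangentSpace 𝓘(ℝ, F) p)]

/-- The metric coefficient `g_y(a, b)` of `M` in the chart centred at `c`, at the coordinate `y`, for
constant coordinate vectors `a`, `b`. -/
def chartMetric (c : M) (y a b : F) : ℝ :=
  metric ((extChartAt 𝓘(ℝ, F) c).symm y)
    (mfderiv 𝓘(ℝ, F) 𝓘(ℝ, F) (extChartAt 𝓘(ℝ, F) c).symm y a)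
    (mfderiv 𝓘(ℝ, F) 𝓘(ℝ, F) (extChartAt 𝓘(ℝ, F) c).symm y b)

/-- The Christoffel symbol of the first kind `Γ(a, b; w) = ⟨∇_a b, w⟩` of the Levi-Civita connection,
i.e. `½ (∂_a g(b, w) + ∂_b g(a, w) - ∂_w g(a, b))`, for constant coordinate vectors. -/
def christoffel (c : M) (y a b w : F) : ℝ :=
  (fderiv ℝ (fun z ↦ chartMetric c z b w) y a + fderiv ℝ (fun z ↦ chartMetric c z a w) y b
    - fderiv ℝ (fun z ↦ chartMetric c z a b) y w) / 2

/-- The first fundamental form (induced metric) `⟨dX v, dX w⟩` of `X : P → M`. -/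
def inducedMetric (X : P → M) (p : P) (v w : TangentSpace 𝓘(ℝ, E) p) : ℝ :=
  metric (E := F) (X p) (mfderiv 𝓘(ℝ, E) 𝓘(ℝ, F) X p v)
    (mfderiv 𝓘(ℝ, E) 𝓘(ℝ, F) X p w)

/-- The second fundamental form `⟨∇_v dX(w), N⟩` of `X : P → M` with respect to the field `N` along
`X`, where `∇` is the Levi-Civita connection of `M`: with `Φ` the local expression of `X` and `ν`
that of `N`, it is `⟨D²Φ(v, w), ν⟩ + Γ(DΦ v, DΦ w; ν)`. -/
def secondFundamentalForm (X : P → M) (N : ∀ p : P, TangentSpace 𝓘(ℝ, F) (X p)) (p : P)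
    (v w : E) : ℝ :=
  let x : E := extChartAt 𝓘(ℝ, E) p p
  let y : F := extChartAt 𝓘(ℝ, F) (X p) (X p)
  let Φ : E → F := localRep X p
  let ν : F :=
    mfderiv 𝓘(ℝ, F) 𝓘(ℝ, F) (extChartAt 𝓘(ℝ, F) (X p)) (X p) (N p)
  chartMetric (X p) y (fderiv ℝ (fderiv ℝ Φ) x v w) ν
    + christoffel (X p) y (fderiv ℝ Φ x v) (fderiv ℝ Φ x w) ν

/-- The mean curvature `H = (1/n) tr(g⁻¹ II)` of the `n`-dimensional hypersurface `X : P → M` with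
respect to the unit normal field `N`. -/
def meanCurvature [FiniteDimensional ℝ E] (X : P → M) (N : ∀ p : P, TangentSpace 𝓘(ℝ, F) (X p)) (p : P) : ℝ :=
  ((chartGram (inducedMetric (E := E) (F := F) X) p (extChartAt 𝓘(ℝ, E) p p))⁻¹ *
    Matrix.of fun i j ↦
      secondFundamentalForm (E := E) (F := F) X N p (stdOrthonormalBasis ℝ E i)
        (stdOrthonormalBasis ℝ E j)).trace / Module.finrank ℝ E

/-- The `f`-weighted mean curvature `H_f = H + (1/n) ⟨∇f, N⟩`, for a weight `f` on `M`. -/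
def weightedMeanCurvature [FiniteDimensional ℝ E] [FiniteDimensional ℝ F] (f : M → ℝ) (X : P → M)
    (N : ∀ p : P, TangentSpace 𝓘(ℝ, F) (X p)) (p : P) : ℝ :=
  meanCurvature (E := E) (F := F) X N p +
    metric (E := F) (X p) (grad f (X p)) (N p) / Module.finrank ℝ E

/-- The intrinsic distance of a submanifold `S` of `M`: the infimum of the lengths of the `C¹` curves
of `M` that run in `S`. -/
def intrinsicEDist (S : Set M) (p q : M) : ℝ≥0∞ :=
  ⨅ (γ : ℝ → M) (_ : ContMDiffOn 𝓘(ℝ, ℝ) 𝓘(ℝ, F) 1 γ (Icc 0 1))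
    (_ : ∀ t ∈ Icc (0 : ℝ) 1, γ t ∈ S) (_ : γ 0 = p) (_ : γ 1 = q),
    pathELength 𝓘(ℝ, F) γ 0 1

/-- The open intrinsic ball `B_R^S(p)`. -/
def intrinsicBall (S : Set M) (p : M) (R : ℝ) : Set M :=
  {q ∈ S | intrinsicEDist (F := F) S p q < ENNReal.ofReal R}

/-- The weighted volume `∫_B e^{-f} dΣ` of a part `B` of the hypersurface `Σ = X(Ω)`, where `X` is
injective on `Ω` and `dΣ` is the Riemannian volume of the induced metric. -/
def hypersurfaceVolume [FiniteDimensional ℝ E] [MeasurableSpace E] [BorelSpace E]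
    [MeasurableSpace P] (f : M → ℝ) (X : P → M) (Ω : Set P) (B : Set M) : ℝ≥0∞ :=
  ∫⁻ x in Ω ∩ X ⁻¹' B, ENNReal.ofReal (Real.exp (-f (X x)))
    ∂riemannianVolume (inducedMetric (E := E) (F := F) X)

/-- The weighted volume `∫_B e^{-f} dM` of a subset of a Riemannian manifold. -/
def weightedVolume [FiniteDimensional ℝ F] [MeasurableSpace F] [BorelSpace F]
    [MeasurableSpace M] (f : M → ℝ) (B : Set M) : ℝ≥0∞ :=
  ∫⁻ x in B, ENNReal.ofReal (Real.exp (-f x)) ∂riemannianVolume (metric (E := F) (P := M))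

end Hypersurface

section Killing

variable {F : Type*} [NormedAddCommGroup F] [InnerProductSpace ℝ F]
  {M : Type*} [TopologicalSpace M] [ChartedSpace F M]
  [RiemannianBundle (fun p : M ↦ TangentSpace 𝓘(ℝ, F) p)]

/-- The potential `ψ = -log |Y|` on `M`. -/
def potential (Y : ∀ p : M, TangentSpace 𝓘(ℝ, F) p) (p : M) : ℝ := -Real.log ‖Y p‖

variable [IsManifold 𝓘(ℝ, F) 1 M]

/-- `Y` is a (smooth) Killing vector field: the Lie derivative of the metric along `Y` vanishes,
`Y⟨V, W⟩ = ⟨[Y, V], W⟩ + ⟨V, [Y, W]⟩`. -/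
structure IsKilling (Y : ∀ p : M, TangentSpace 𝓘(ℝ, F) p) : Prop where
  smooth : ContMDiff 𝓘(ℝ, F) 𝓘(ℝ, F).tangent ∞
    (fun p ↦ (⟨p, Y p⟩ : TangentBundle 𝓘(ℝ, F) M))
  lieDeriv_metric : ∀ (V W : ∀ p : M, TangentSpace 𝓘(ℝ, F) p) (p : M),
    MDifferentiableAt 𝓘(ℝ, F) 𝓘(ℝ, F).tangent
      (fun q ↦ (⟨q, V q⟩ : TangentBundle 𝓘(ℝ, F) M)) p →
    MDifferentiableAt 𝓘(ℝ, F) 𝓘(ℝ, F).tangent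
      (fun q ↦ (⟨q, W q⟩ : TangentBundle 𝓘(ℝ, F) M)) p →
    mfderiv 𝓘(ℝ, F) 𝓘(ℝ, ℝ) (fun q ↦ metric (E := F) q (V q) (W q)) p (Y p) =
      metric (E := F) p (VectorField.mlieBracket 𝓘(ℝ, F) Y V p) (W p)
        + metric (E := F) p (V p) (VectorField.mlieBracket 𝓘(ℝ, F) Y W p)

end Killing

section Graph

variable {E : Type*} [NormedAddCommGroup E] [InnerProductSpace ℝ E]
  {F : Type*} [NormedAddCommGroup F] [InnerProductSpace ℝ F]
  {P : Type*} [TopologicalSpace P] [ChartedSpace E P]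
  [RiemannianBundle (fun x : P ↦ TangentSpace 𝓘(ℝ, E) x)]
  {M : Type*} [TopologicalSpace M] [ChartedSpace F M]
  [RiemannianBundle (fun p : M ↦ TangentSpace 𝓘(ℝ, F) p)]

/-- The diffeomorphism `ϑ : P × ℝ → M` is the flow of `Y` started from a leaf of the distribution
orthogonal to `Y`: `s ↦ ϑ(x, s)` is an integral curve of `Y`, and `x ↦ ϑ(x, 0)` embeds `P`
isometrically and orthogonally to `Y`. (In particular `Y` is complete and nowhere zero, and the
slices `ϑ(P × {s})` are the leaves of its orthogonal distribution if `P` is connected.) -/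
structure IsFlowFromLeaf (Y : ∀ p : M, TangentSpace 𝓘(ℝ, F) p)
    (ϑ : Diffeomorph (𝓘(ℝ, E).prod 𝓘(ℝ, ℝ)) 𝓘(ℝ, F) (P × ℝ) M ∞) : Prop where
  flow : ∀ x : P, IsMIntegralCurve (fun s : ℝ ↦ ϑ (x, s)) Y
  isometric : ∀ (x : P) (v w : TangentSpace 𝓘(ℝ, E) x),
    inducedMetric (E := E) (F := F) (fun z ↦ ϑ (z, 0)) x v w = metric (E := E) x v w
  orthogonal : ∀ (x : P) (v : TangentSpace 𝓘(ℝ, E) x),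
    metric (E := F) (ϑ (x, 0))
      (mfderiv 𝓘(ℝ, E) 𝓘(ℝ, F) (fun z ↦ ϑ (z, 0)) x v) (Y (ϑ (x, 0))) = 0

/-- The parametrization `X(x) = ϑ(x, u(x))` of the Killing graph of `u`. -/
abbrev graphMap (ϑ : P × ℝ → M) (u : P → ℝ) (x : P) : M := ϑ (x, u x)

/-- The upward unit normal `N = (e^{2ψ} Y - ϑ_* ∇u) / W`, `W = √(e^{2ψ} + |∇u|²)`, of the Killing
graph of `u`, as a field along `graphMap ϑ u`. -/
def upwardNormal [FiniteDimensional ℝ E] (Y : ∀ p : M, TangentSpace 𝓘(ℝ, F) p) (ϑ : P × ℝ → M) (u : P → ℝ)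
    (x : P) : TangentSpace 𝓘(ℝ, F) (ϑ (x, u x)) :=
  (√(Real.exp (2 * potential Y (ϑ (x, 0))) + ‖grad (E := E) u x‖ ^ 2))⁻¹ •
    (Real.exp (2 * potential Y (ϑ (x, 0))) • Y (ϑ (x, u x)) -
      mfderiv 𝓘(ℝ, E) 𝓘(ℝ, F) (fun z ↦ ϑ (z, u x)) x (grad u x))

end Graph

end KillingGraph
end

/-!
In the coordinates `(x, s)` given by a chart of `P` and the flow `ϑ`, the Killing equation says
that the metric coefficients of `M` do not depend on `s` (`fderiv_pullbackForm_killing`), so the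
metric is the warped product `σ + e^{-2ψ} ds²` of the metric `σ` of `P`
(`pullbackForm_flowChart`).

Hence the projection `M → P` does not increase lengths (`norm_mfderiv_proj_le`). A curve in the
graph projects to a curve in `P` of at most the same length, and the inclusion of the projected
intrinsic ball in the ball of `P` follows (`image_intrinsicBall_subset`).

For the volume estimate, put `W = √(e^{2ψ} + |∇u|²)`. The weighted mean curvature of the graph is
a divergence on `P`:
`div (e^{-(D+1)ψ} ∇u / W) = n H_{Dψ} e^{-(D+1)ψ}` (`weightedMeanCurvature_eq_div`).
It is obtained in coordinates from an explicit second fundamental form (`sffForm_graphPair`) and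
an identity between traces of matrices (`trace_identity`, `sum_inner_fderiv_flux`). Testing it
against compactly supported Lipschitz functions gives its weak form (`integral_divIntegrand`).

The test function is `η G(u)`, where `η` is a distance cutoff between the balls of radii `R` and
`(1 + δ) R`, with gradient at most `1 / (δ R)`, and `G` is a truncation of the identity that
vanishes near zero. Its support is compact: `P` is complete along with `M` (`completeSpace_leaf`),
so closed balls of `P` are compact (`isCompact_closedEBall`), and `u` tends to zero at the
boundary of `Ω`, so `G(u)` vanishes near it. Since `|u| ≤ A e^ψ`, `|H_{Dψ}| ≤ A` and `|∇u| ≤ W`,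
removing the truncation gives
`∫_{B_R ∩ Ω} e^{-(D+1)ψ} |∇u|² / W ≤ A (n A + 1 / (δ R)) vol_{Dψ}(B_{(1+δ)R} ∩ Ω)`
(`setLIntegral_energyDensity_le`). The zero set of `u`, which no truncation sees, is harmless
because `∇u = 0` almost everywhere on it (`ae_grad_eq_zero_of_eq_zero`).

Finally, the volume element of the graph is `e^{-ψ} W` times that of `P`
(`riemannianVolume_graph`), and `W ≤ e^ψ + |∇u|² / W` splits the volume of the graph over
`B_R ∩ Ω` into the volume of the base and the energy just estimated. The constant is `C = 1 + n A² + A`.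
-/

noncomputable section
set_option synthInstance.maxHeartbeats 200000
set_option linter.unusedSectionVars false

namespace KillingGraph

/-! ### Pulling back the metric -/

section Pullback

variable {V : Type*} [NormedAddCommGroup V] [NormedSpace ℝ V]
  {F : Type*} [NormedAddCommGroup F] [InnerProductSpace ℝ F]
  {M : Type*} [TopologicalSpace M] [ChartedSpace F M]
  [RiemannianBundle (fun p : M ↦ TangentSpace 𝓘(ℝ, F) p)]

/-- The pullback of the Riemannian metric of `M` by a map `S` from a vector space, as a field of
continuous bilinear forms. For `S` an inverse chart its coefficients are the metric coefficients. -/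
def pullbackForm (S : V → M) (z : V) : V →L[ℝ] V →L[ℝ] ℝ :=
  (innerSL ℝ (E := TangentSpace 𝓘(ℝ, F) (S z))).bilinearComp
    (mfderiv 𝓘(ℝ, V) 𝓘(ℝ, F) S z) (mfderiv 𝓘(ℝ, V) 𝓘(ℝ, F) S z)

lemma pullbackForm_apply (S : V → M) (z a b : V) :
    pullbackForm (F := F) S z a b = metric (E := F) (S z)
      (mfderiv 𝓘(ℝ, V) 𝓘(ℝ, F) S z a) (mfderiv 𝓘(ℝ, V) 𝓘(ℝ, F) S z b) := rfl

lemma pullbackForm_comm (S : V → M) (z a b : V) :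
    pullbackForm (F := F) S z a b = pullbackForm (F := F) S z b a := by
  rw [pullbackForm_apply, pullbackForm_apply, metric, metric, real_inner_comm]

variable {V' : Type*} [NormedAddCommGroup V'] [NormedSpace ℝ V']

lemma pullbackForm_comp (S : V → M) (f : V' → V) (z a b : V')
    (hS : MDifferentiableAt 𝓘(ℝ, V) 𝓘(ℝ, F) S (f z)) (hf : DifferentiableAt ℝ f z) :
    pullbackForm (F := F) (S ∘ f) z a b =
      pullbackForm (F := F) S (f z) (fderiv ℝ f z a) (fderiv ℝ f z b) := by
  rw [pullbackForm_apply, pullbackForm_apply, mfderiv_comp z hS hf.mdifferentiableAt,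
    mfderiv_eq_fderiv]
  rfl

lemma pullbackForm_congr {S S' : V → M} {z : V} (h : S =ᶠ[𝓝 z] S') :
    pullbackForm (F := F) S z = pullbackForm (F := F) S' z := by
  have key : ∀ (A : V →L[ℝ] F) (p q : M), p = q → ∀ a b : V,
      metric (E := F) p (A a) (A b) = metric (E := F) q (A a) (A b) := by
    rintro A p _ rfl a b; rfl
  ext a b
  rw [pullbackForm_apply, pullbackForm_apply, h.mfderiv_eq]
  exact key _ _ _ h.eq_of_nhds a b

variable [IsManifold 𝓘(ℝ, F) ∞ M]
 [IsContMDiffRiemannianBundle 𝓘(ℝ, F) ∞ F (fun p : M ↦ TangentSpace 𝓘(ℝ, F) p)]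

lemma contDiffAt_pullbackForm_apply {S : V → M} {z : V} (hS : ContMDiffAt 𝓘(ℝ, V) 𝓘(ℝ, F) ∞ S z)
   (a b : V) : ContDiffAt ℝ ∞ (fun y ↦ pullbackForm (F := F) S y a b) z := by
  have key : ∀ a : V, ContMDiffAt 𝓘(ℝ, V) 𝓘(ℝ, F).tangent ∞
      (fun y ↦ (⟨S y, mfderiv 𝓘(ℝ, V) 𝓘(ℝ, F) S y a⟩ : TangentBundle 𝓘(ℝ, F) M)) z := by
    intro a
    have hb : ContMDiffAt 𝓘(ℝ, V) 𝓘(ℝ, V) ∞ (id : V → V) z := contMDiffAt_id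
    have hv : ContMDiffAt 𝓘(ℝ, V) 𝓘(ℝ, V).tangent ∞
        (fun y : V ↦ (⟨y, a⟩ : TangentBundle 𝓘(ℝ, V) V)) z :=
      contMDiffAt_vectorSpace_iff_contDiffAt.2 contDiffAt_const
    exact ContMDiffAt.clm_apply_of_inCoordinates (b₁ := id) (b₂ := S)
      (ϕ := fun y ↦ mfderiv 𝓘(ℝ, V) 𝓘(ℝ, F) S y) (v := fun _ ↦ a)
      (hS.mfderiv_const le_rfl) hv hS
  have h := ContMDiffAt.inner_bundle (IB := 𝓘(ℝ, F)) (IM := 𝓘(ℝ, V)) (n := ∞) (F := F)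
    (E := fun p : M ↦ TangentSpace 𝓘(ℝ, F) p) (b := S) (x := z)
    (v := fun y ↦ mfderiv 𝓘(ℝ, V) 𝓘(ℝ, F) S y a) (w := fun y ↦ mfderiv 𝓘(ℝ, V) 𝓘(ℝ, F) S y b)
    (key a) (key b)
  exact h.contDiffAt

end Pullback

/-! ### The second fundamental form in coordinates -/

section SecondFundamentalForm

variable {U V W : Type*} [NormedAddCommGroup U] [NormedSpace ℝ U]
  [NormedAddCommGroup V] [NormedSpace ℝ V] [NormedAddCommGroup W] [NormedSpace ℝ W]

/-- The Christoffel symbol of the first kind of a field `g` of bilinear forms on a vector space. -/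
def christoffelForm (g : V → V →L[ℝ] V →L[ℝ] ℝ) (y a b w : V) : ℝ :=
  (fderiv ℝ g y a b w + fderiv ℝ g y b a w - fderiv ℝ g y w a b) / 2

/-- The second fundamental form of a map `Φ` into a vector space with the metric `g`, with respect
to the vector `ν` at `Φ x`. -/
def sffForm (g : V → V →L[ℝ] V →L[ℝ] ℝ) (Φ : U → V) (ν : V) (x v w : U) : ℝ :=
  g (Φ x) (fderiv ℝ (fderiv ℝ Φ) x v w) ν
    + christoffelForm g (Φ x) (fderiv ℝ Φ x v) (fderiv ℝ Φ x w) ν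

lemma _root_.ContDiffAt.differentiableAt_fderiv {f : U → V} {x : U} (hf : ContDiffAt ℝ 2 f x) :
    DifferentiableAt ℝ (fderiv ℝ f) x :=
  (hf.fderiv_right (m := 1) (by norm_num)).differentiableAt (by norm_num)

lemma fderiv_fderiv_comp {f : W → V} {h : U → W} {x : U} (hf : ContDiffAt ℝ 2 f (h x))
    (hh : ContDiffAt ℝ 2 h x) (v w : U) :
    fderiv ℝ (fderiv ℝ (f ∘ h)) x v w =
      fderiv ℝ (fderiv ℝ f) (h x) (fderiv ℝ h x v) (fderiv ℝ h x w)
        + fderiv ℝ f (h x) (fderiv ℝ (fderiv ℝ h) x v w) := by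
  have h1 : fderiv ℝ (f ∘ h) =ᶠ[𝓝 x] fun y ↦ (fderiv ℝ f (h y)).comp (fderiv ℝ h y) := by
    have hf' : ∀ᶠ y in 𝓝 x, DifferentiableAt ℝ f (h y) :=
      hh.continuousAt.eventually ((hf.eventually (by simp)).mono
        fun y hy ↦ hy.differentiableAt (by norm_num))
    filter_upwards [hf', hh.eventually (by simp)] with y hy hy'
    exact fderiv_comp y hy (hy'.differentiableAt (by norm_num))
  have h2 := (hf.differentiableAt_fderiv.hasFDerivAt.comp x
    (hh.differentiableAt (by norm_num)).hasFDerivAt).clm_comp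
    hh.differentiableAt_fderiv.hasFDerivAt
  have h3 : fderiv ℝ (fderiv ℝ (f ∘ h)) x = _ := h1.fderiv_eq.trans (HasFDerivAt.fderiv h2)
  rw [h3]
  simp [add_comm]

/-- The transformation law of the Christoffel symbols of the first kind under a change of variables
`G`: besides the tensorial term there is the contribution of the second derivative of `G`. -/
lemma christoffelForm_comp {g : V → V →L[ℝ] V →L[ℝ] ℝ} {g' : W → W →L[ℝ] W →L[ℝ] ℝ} {G : W → V}
    {z : W} (hG : ContDiffAt ℝ 2 G z) (hg : DifferentiableAt ℝ g (G z))
    (hg' : DifferentiableAt ℝ g' z) (hsymm : ∀ y a b, g y a b = g y b a)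
    (hgg' : ∀ᶠ y in 𝓝 z, ∀ a b, g' y a b = g (G y) (fderiv ℝ G y a) (fderiv ℝ G y b))
    (a b c : W) :
    christoffelForm g' z a b c =
      christoffelForm g (G z) (fderiv ℝ G z a) (fderiv ℝ G z b) (fderiv ℝ G z c)
      + g (G z) (fderiv ℝ (fderiv ℝ G) z a b) (fderiv ℝ G z c) := by
  have key : ∀ a b c : W, fderiv ℝ g' z c a b =
      fderiv ℝ g (G z) (fderiv ℝ G z c) (fderiv ℝ G z a) (fderiv ℝ G z b)
        + g (G z) (fderiv ℝ (fderiv ℝ G) z c a) (fderiv ℝ G z b)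
        + g (G z) (fderiv ℝ (fderiv ℝ G) z c b) (fderiv ℝ G z a) := by
    intro a b c
    have h0 : HasFDerivAt (fun y ↦ g' y a b) (((fderiv ℝ g' z).flip a).flip b) z :=
      ((hg'.hasFDerivAt.clm_apply (hasFDerivAt_const a z)).clm_apply
        (hasFDerivAt_const b z)).congr_fderiv (by ext; simp)
    have hd := hG.differentiableAt_fderiv.hasFDerivAt
    have hGd := (hG.differentiableAt (by norm_num)).hasFDerivAt
    have hgG : HasFDerivAt (fun y ↦ g (G y)) ((fderiv ℝ g (G z)).comp (fderiv ℝ G z)) z :=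
      HasFDerivAt.comp (g := g) (f := G) z hg.hasFDerivAt hGd
    have ha : HasFDerivAt (fun y ↦ fderiv ℝ G y a) ((fderiv ℝ (fderiv ℝ G) z).flip a) z :=
      (hd.clm_apply (hasFDerivAt_const a z)).congr_fderiv (by ext; simp)
    have hb : HasFDerivAt (fun y ↦ fderiv ℝ G y b) ((fderiv ℝ (fderiv ℝ G) z).flip b) z :=
      (hd.clm_apply (hasFDerivAt_const b z)).congr_fderiv (by ext; simp)
    have h1' : HasFDerivAt (fun y ↦ g (G y) (fderiv ℝ G y a)) _ z := hgG.clm_apply ha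
    have h1 := h1'.clm_apply hb
    have h2 := h0.unique (h1.congr_of_eventuallyEq (hgg'.mono fun y hy ↦ hy a b))
    have h3 := congrArg (fun L ↦ L c) h2
    simp at h3
    rw [h3, hsymm _ (fderiv ℝ G z a)]
    ring
  have hs : ∀ a b, fderiv ℝ (fderiv ℝ G) z a b = fderiv ℝ (fderiv ℝ G) z b a := fun a b ↦
    (hG.isSymmSndFDerivAt (by simp)).eq a b
  simp only [christoffelForm, key]
  rw [hs b a, hs c a, hs c b]
  ring

/-- The second fundamental form does not depend on the coordinates of the ambient space. -/
lemma sffForm_comp_left {g : V → V →L[ℝ] V →L[ℝ] ℝ} {g' : W → W →L[ℝ] W →L[ℝ] ℝ} {G : W → V}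
    {Ψ : U → W} {x : U} (hG : ContDiffAt ℝ 2 G (Ψ x)) (hΨ : ContDiffAt ℝ 2 Ψ x)
    (hg : DifferentiableAt ℝ g (G (Ψ x)))
    (hg' : DifferentiableAt ℝ g' (Ψ x)) (hsymm : ∀ y a b, g y a b = g y b a)
    (hgg' : ∀ᶠ y in 𝓝 (Ψ x), ∀ a b, g' y a b = g (G y) (fderiv ℝ G y a) (fderiv ℝ G y b))
    (ν : W) (v w : U) :
    sffForm g (G ∘ Ψ) (fderiv ℝ G (Ψ x) ν) x v w = sffForm g' Ψ ν x v w := by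
  rw [sffForm, sffForm, fderiv_fderiv_comp hG hΨ, christoffelForm_comp hG hg hg' hsymm hgg',
    fderiv_comp x (hG.differentiableAt (by norm_num)) (hΨ.differentiableAt (by norm_num)),
    hgg'.self_of_nhds]
  simp
  ring

/-- The second fundamental form is tensorial under a change of parametrization. -/
lemma sffForm_comp_right {g : V → V →L[ℝ] V →L[ℝ] ℝ} {Φ : W → V} {τ : U → W} {x : U} {ν : V}
    (hΦ : ContDiffAt ℝ 2 Φ (τ x)) (hτ : ContDiffAt ℝ 2 τ x)
    (hν : ∀ a, g (Φ (τ x)) (fderiv ℝ Φ (τ x) a) ν = 0) (v w : U) :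
    sffForm g (Φ ∘ τ) ν x v w = sffForm g Φ ν (τ x) (fderiv ℝ τ x v) (fderiv ℝ τ x w) := by
  rw [sffForm, sffForm, fderiv_fderiv_comp hΦ hτ,
    fderiv_comp x (hΦ.differentiableAt (by norm_num)) (hτ.differentiableAt (by norm_num))]
  simp [hν]

lemma _root_.Filter.EventuallyEq.sffForm_eq {g : V → V →L[ℝ] V →L[ℝ] ℝ} {Φ Φ' : U → V} {x : U}
    (h : Φ =ᶠ[𝓝 x] Φ') (ν : V) : sffForm g Φ ν x = sffForm g Φ' ν x := by
  ext v w
  rw [sffForm, sffForm, h.fderiv_eq, h.fderiv.fderiv_eq, h.eq_of_nhds]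

end SecondFundamentalForm

/-! ### Rank-one perturbations -/

section RankOne
open Matrix

variable {ι : Type*} [Fintype ι] [DecidableEq ι]

/-- The Sherman–Morrison formula for `σ + l q qᵀ`, where `w = l⁻¹ + qᵀ σ⁻¹ q`. -/
lemma inv_add_smul_vecMulVec {σ : Matrix ι ι ℝ} (hσ : IsUnit σ.det) (hσs : σᵀ = σ) (q : ι → ℝ)
    {l w : ℝ} (hl : l ≠ 0) (hw : w ≠ 0) (hw2 : w = l⁻¹ + q ⬝ᵥ (σ⁻¹ *ᵥ q)) :
    (σ + l • vecMulVec q q)⁻¹ = σ⁻¹ - w⁻¹ • vecMulVec (σ⁻¹ *ᵥ q) (σ⁻¹ *ᵥ q) := by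
  have hs : (σ⁻¹)ᵀ = σ⁻¹ := by rw [transpose_nonsing_inv, hσs]
  set g := σ⁻¹ *ᵥ q with hg
  have h1 : q ᵥ* σ⁻¹ = g := by rw [hg, ← vecMul_transpose, hs]
  have h2 : σ *ᵥ g = q := by rw [hg, mulVec_mulVec, mul_nonsing_inv _ hσ, one_mulVec]
  have h4 : vecMulVec q q * vecMulVec g g = (q ⬝ᵥ g) • vecMulVec q g := by
    ext i j
    simp only [Matrix.mul_apply, vecMulVec_apply, Matrix.smul_apply, smul_eq_mul, dotProduct,
      Finset.sum_mul]
    exact Finset.sum_congr rfl fun k _ ↦ by ring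
  apply inv_eq_right_inv
  rw [Matrix.mul_sub, Matrix.add_mul, mul_nonsing_inv _ hσ, Matrix.mul_smul, Matrix.add_mul,
    mul_vecMulVec, h2, Matrix.smul_mul, Matrix.smul_mul, vecMulVec_mul, h1, h4]
  have h3 : l - w⁻¹ * (1 + l * (q ⬝ᵥ g)) = 0 := by
    have : 1 + l * (q ⬝ᵥ g) = l * w := by rw [hw2]; field_simp
    rw [this]; field_simp; ring
  rw [add_sub_assoc]
  have : l • vecMulVec q g - w⁻¹ • (vecMulVec q g + l • (q ⬝ᵥ g) • vecMulVec q g) =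
      (l - w⁻¹ * (1 + l * (q ⬝ᵥ g))) • vecMulVec q g := by
    simp only [smul_add, smul_smul, sub_smul, mul_add, mul_one, add_smul]
  rw [this, h3, zero_smul, add_zero]

/-- The matrix determinant lemma for `σ + l q qᵀ`. -/
lemma det_add_smul_vecMulVec {σ : Matrix ι ι ℝ} (hσ : IsUnit σ.det) (q : ι → ℝ) (l : ℝ) :
    (σ + l • vecMulVec q q).det = σ.det * (1 + l * (q ⬝ᵥ (σ⁻¹ *ᵥ q))) := by
  have : l • vecMulVec q q = replicateCol Unit (l • q) * replicateRow Unit q := by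
    ext i j; simp [vecMulVec_apply, Matrix.mul_apply]; ring
  rw [this, det_add_replicateCol_mul_replicateRow hσ, Matrix.mul_assoc, ← replicateCol_mulVec,
    mulVec_smul]
  simp [Matrix.mul_apply, dotProduct, det_unique, Finset.mul_sum]

/-- The algebra behind the mean curvature equation of a graph in a warped product. Here `σ` is the
metric matrix, `D k` its derivative in the direction `k`, `A` the matrix of second derivatives of
`u`, `q = du`, `p = dψ`, `g = ∇u`, `l = e^{-2ψ}`, and `B` contracts the derivatives of `σ` with `g`.
On the left is the trace of the second fundamental form with respect to the induced metric
`σ + l q qᵀ`, on the right the divergence of `e^{-(d+1)ψ} √det σ ∇u / W`, differentiated factor by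
factor and divided by the density `e^{-(d+1)ψ} √det σ`. -/
lemma trace_identity {σ A : Matrix ι ι ℝ} (D : ι → Matrix ι ι ℝ) (hσ : IsUnit σ.det)
    (hσs : σᵀ = σ) (p q g : ι → ℝ) (hg : g = σ⁻¹ *ᵥ q) {l W : ℝ} (hl : l ≠ 0) (hW : W ≠ 0)
    (hW2 : W ^ 2 = l⁻¹ + q ⬝ᵥ g) (d : ℝ) (B : Matrix ι ι ℝ) (hB : ∀ i j, B i j = (D i *ᵥ g) j) :
    ((σ + l • vecMulVec q q)⁻¹ * (W⁻¹ • (A - (2 : ℝ)⁻¹ • (B + Bᵀ - ∑ k, g k • D k)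
        - vecMulVec p q - vecMulVec q p - (l * (p ⬝ᵥ g)) • vecMulVec q q))).trace
      - d * (p ⬝ᵥ g) / W =
    ((∑ k, g k * (σ⁻¹ * D k).trace) / 2 - (d + 1) * (p ⬝ᵥ g)) / W
     - (2 * l⁻¹ * (p ⬝ᵥ g) + 2 * (g ⬝ᵥ A *ᵥ g) - ∑ k, g k * (g ⬝ᵥ D k *ᵥ g)) / (2 * W) / W ^ 2
     + ((σ⁻¹ * (A - B)).trace) / W := by
  have hs : (σ⁻¹)ᵀ = σ⁻¹ := by rw [transpose_nonsing_inv, hσs]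
  have hqg : g ⬝ᵥ q = q ⬝ᵥ g := dotProduct_comm _ _
  have hpg : g ⬝ᵥ p = p ⬝ᵥ g := dotProduct_comm _ _
  have hBt : (σ⁻¹ * Bᵀ).trace = (σ⁻¹ * B).trace := by
    rw [← trace_transpose, transpose_mul, transpose_transpose, hs, trace_mul_comm]
  have h1 : (σ⁻¹ *ᵥ p) ⬝ᵥ q = p ⬝ᵥ g := by
    rw [hg, dotProduct_mulVec, ← mulVec_transpose, hs]
  have hgBg : g ⬝ᵥ B *ᵥ g = ∑ k, g k * (g ⬝ᵥ D k *ᵥ g) := by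
    simp only [dotProduct, mulVec, hB]
    refine Finset.sum_congr rfl fun i _ ↦ ?_
    congr 1
    refine Finset.sum_congr rfl fun j _ ↦ ?_
    rw [mul_comm]
  have hgBg' : g ⬝ᵥ Bᵀ *ᵥ g = ∑ k, g k * (g ⬝ᵥ D k *ᵥ g) := by
    rw [← hgBg, dotProduct_mulVec, vecMul_transpose, dotProduct_comm]
  have hDk : g ⬝ᵥ (∑ k, g k • D k) *ᵥ g = ∑ k, g k * (g ⬝ᵥ D k *ᵥ g) := by
    rw [sum_mulVec, dotProduct_sum]
    simp [smul_mulVec]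
  have hDt : (σ⁻¹ * ∑ k, g k • D k).trace = ∑ k, g k * (σ⁻¹ * D k).trace := by
    simp [Matrix.mul_sum, trace_sum]
  have hv : ∀ x y : ι → ℝ, g ⬝ᵥ vecMulVec x y *ᵥ g = (g ⬝ᵥ x) * (y ⬝ᵥ g) := by
    intro x y
    rw [vecMulVec_mulVec]; simp; ring
  have hinv := inv_add_smul_vecMulVec hσ hσs q hl (pow_ne_zero 2 hW) (by rw [hW2, hg])
  rw [hinv, ← hg, Matrix.sub_mul, trace_sub, Matrix.mul_smul, trace_smul, Matrix.smul_mul,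
    trace_smul, Matrix.mul_smul, trace_smul, vecMulVec_mul, trace_vecMulVec, dotProduct_comm g,
    ← dotProduct_mulVec]
  simp only [Matrix.mul_sub, Matrix.mul_add, Matrix.mul_smul, trace_sub, trace_add, trace_smul, hBt,
    hDt, mul_vecMulVec, trace_vecMulVec, ← hg, h1, hqg, hpg, sub_mulVec, add_mulVec,
    smul_mulVec, dotProduct_sub, dotProduct_add, dotProduct_smul, hgBg, hgBg', hDk, hv, smul_eq_mul]
  have hq : q ⬝ᵥ g = W ^ 2 - l⁻¹ := by rw [hW2]; ring
  simp only [hq]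
  field_simp
  ring
end RankOne

/-! ### Gram matrices -/

section Det
open Matrix
variable {ι : Type*} [Fintype ι] [DecidableEq ι]

lemma differentiable_det : Differentiable ℝ fun A : ι → ι → ℝ ↦ (Matrix.of A).det := by
  simp only [det_apply, of_apply]
  fun_prop

/-- Jacobi's formula: `det (A + t B) = det A * det (1 + t A⁻¹ B)`, and the second factor is a
polynomial in `t` with linear coefficient `tr (A⁻¹ B)`. -/
lemma fderiv_det_apply {A : ι → ι → ℝ} (hA : IsUnit (Matrix.of A).det) (B : ι → ι → ℝ) :
    fderiv ℝ (fun A : ι → ι → ℝ ↦ (Matrix.of A).det) A B =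
      (Matrix.of A).det * ((Matrix.of A)⁻¹ * Matrix.of B).trace := by
  have h1 : HasDerivAt (fun t : ℝ ↦ (Matrix.of (A + t • B)).det)
      (fderiv ℝ (fun A : ι → ι → ℝ ↦ (Matrix.of A).det) A B) 0 := by
    have hc : HasDerivAt (fun t : ℝ ↦ A + t • B) B 0 := by
      simpa using ((hasDerivAt_id (0 : ℝ)).smul_const B).const_add A
    have := (differentiable_det (ι := ι) (A + (0 : ℝ) • B)).hasFDerivAt.comp_hasDerivAt 0 hc
    simpa [Function.comp_def] using this
  set M := (Matrix.of A)⁻¹ * Matrix.of B with hM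
  set P : Polynomial ℝ := det (1 + (Polynomial.X : Polynomial ℝ) • M.map Polynomial.C) with hP
  have h2 : (fun t : ℝ ↦ (Matrix.of (A + t • B)).det) = fun t ↦ (Matrix.of A).det * P.eval t := by
    ext t
    have e1 : Matrix.of (A + t • B) = Matrix.of A * (1 + t • M) := by
      rw [Matrix.mul_add, Matrix.mul_smul, hM, mul_nonsing_inv_cancel_left _ _ hA, Matrix.mul_one]
      rfl
    rw [e1, det_mul, hP, ← Polynomial.coe_evalRingHom, RingHom.map_det]
    congr 2
    ext i j
    simp only [RingHom.mapMatrix_apply, Matrix.map_apply, Matrix.add_apply, Matrix.smul_apply,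
      smul_eq_mul, Polynomial.coe_evalRingHom, Polynomial.eval_add, Polynomial.eval_mul,
      Polynomial.eval_X, Polynomial.eval_C, Matrix.one_apply]
    split_ifs <;> simp only [Polynomial.eval_one, Polynomial.eval_zero]
  rw [h2] at h1
  rw [h1.unique ((P.hasDerivAt 0).const_mul _), hP, derivative_det_one_add_X_smul]

variable {E : Type*} [NormedAddCommGroup E] [NormedSpace ℝ E]

/-- Jacobi's formula for the square root of a determinant. -/
lemma hasFDerivAt_sqrt_det {m : E → Matrix ι ι ℝ} {m' : ι → ι → E →L[ℝ] ℝ} {y : E}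
    (hm : ∀ i j, HasFDerivAt (fun z ↦ m z i j) (m' i j) y) (hpos : 0 < (m y).det) :
    ∃ L : E →L[ℝ] ℝ, HasFDerivAt (fun z ↦ √(m z).det) L y ∧
      ∀ v, L v = √(m y).det * (((m y)⁻¹ * Matrix.of fun i j ↦ m' i j v).trace / 2) := by
  have h1 : HasFDerivAt (fun z ↦ (fun i j ↦ m z i j : ι → ι → ℝ))
      (ContinuousLinearMap.pi fun i ↦ ContinuousLinearMap.pi fun j ↦ m' i j) y :=
    hasFDerivAt_pi.2 fun i ↦ hasFDerivAt_pi.2 fun j ↦ hm i j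
  have h2 := (differentiable_det (ι := ι) (fun i j ↦ m y i j)).hasFDerivAt.comp y h1
  have h3 : HasFDerivAt (fun z ↦ √(m z).det) _ y := h2.sqrt hpos.ne'
  refine ⟨_, h3, fun v ↦ ?_⟩
  have h4 := fderiv_det_apply (A := fun i j ↦ m y i j) hpos.ne'.isUnit (fun i j ↦ m' i j v)
  simp only [_root_.smul_apply, ContinuousLinearMap.comp_apply, smul_eq_mul]
  have h5 : (ContinuousLinearMap.pi fun i ↦ ContinuousLinearMap.pi fun j ↦ m' i j) v =
    fun i j ↦ m' i j v := rfl
  rw [h5, h4]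
  have h6 : (Matrix.of fun i j ↦ m y i j) = m y := rfl
  rw [h6]
  simp only [Function.comp, h6]
  have := Real.mul_self_sqrt hpos.le
  have h7 : √(m y).det ≠ 0 := (Real.sqrt_pos.2 hpos).ne'
  field_simp
  rw [sq, this]
end Det

section Gram
variable {E : Type*} [NormedAddCommGroup E] [InnerProductSpace ℝ E] [FiniteDimensional ℝ E]

/-- The Gram matrix of a bilinear form in the standard orthonormal basis. -/
def gramMatrix (s : E →L[ℝ] E →L[ℝ] ℝ) :
    Matrix (Fin (Module.finrank ℝ E)) (Fin (Module.finrank ℝ E)) ℝ :=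
  Matrix.of fun i j ↦ s (stdOrthonormalBasis ℝ E i) (stdOrthonormalBasis ℝ E j)

/-- The coordinates of a linear form in the dual of the standard orthonormal basis. -/
def coords (α : E →L[ℝ] ℝ) (i : Fin (Module.finrank ℝ E)) : ℝ := α (stdOrthonormalBasis ℝ E i)

/-- The coordinates of a vector in the standard orthonormal basis. -/
def vcoords (a : E) (i : Fin (Module.finrank ℝ E)) : ℝ := inner ℝ (stdOrthonormalBasis ℝ E i) a

open Matrix
lemma sum_vcoords (a : E) : ∑ i, vcoords a i • stdOrthonormalBasis ℝ E i = a :=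
  (stdOrthonormalBasis ℝ E).sum_repr' a

lemma clm_apply_eq (α : E →L[ℝ] ℝ) (a : E) : α a = coords α ⬝ᵥ vcoords a := by
  conv_lhs => rw [← sum_vcoords a]
  simp [dotProduct, coords, mul_comm]

lemma coords_bilin (s : E →L[ℝ] E →L[ℝ] ℝ) (hs : ∀ a b, s a b = s b a) (a : E) :
    coords (s a) = gramMatrix s *ᵥ vcoords a := by
  ext i
  rw [coords, hs, clm_apply_eq]
  rfl

lemma bilin_apply_eq (s : E →L[ℝ] E →L[ℝ] ℝ) (hs : ∀ a b, s a b = s b a) (a b : E) :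
    s a b = vcoords b ⬝ᵥ gramMatrix s *ᵥ vcoords a := by
  rw [clm_apply_eq, coords_bilin s hs, dotProduct_comm]

variable {s : E →L[ℝ] E →L[ℝ] ℝ}

lemma gramMatrix_transpose (hs : ∀ a b, s a b = s b a) : (gramMatrix s)ᵀ = gramMatrix s := by
  ext i j; exact hs _ _

lemma posDef_gramMatrix (hs : ∀ a b, s a b = s b a) (hpos : ∀ a, a ≠ 0 → 0 < s a a) :
    (gramMatrix s).PosDef := by
  refine Matrix.PosDef.of_dotProduct_mulVec_pos ?_ fun x hx ↦ ?_
  · rw [IsHermitian, conjTranspose_eq_transpose_of_trivial, gramMatrix_transpose hs]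
  · set a : E := ∑ i, x i • stdOrthonormalBasis ℝ E i with ha
    have hxa : vcoords a = x := by
      ext i
      simp [vcoords, ha, inner_sum, inner_smul_right, orthonormal_iff_ite.1
        (stdOrthonormalBasis ℝ E).orthonormal]
    have h0 : a ≠ 0 := by
      rintro h
      apply hx
      rw [← hxa, h]; ext i; simp [vcoords]
    have := hpos a h0
    rw [bilin_apply_eq s hs, hxa] at this
    simpa using this

lemma isInvertible_of_pos (hpos : ∀ a, a ≠ 0 → 0 < s a a) : s.IsInvertible := by
  have hinj : Function.Injective s := by
    rw [injective_iff_map_eq_zero]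
    intro a ha
    by_contra h
    have := hpos a h
    simp [ha] at this
  have hdim : Module.finrank ℝ E = Module.finrank ℝ (E →L[ℝ] ℝ) :=
    (InnerProductSpace.toDual ℝ E).toLinearEquiv.finrank_eq
  let e := (LinearEquiv.ofInjectiveOfFinrankEq (s : E →ₗ[ℝ] (E →L[ℝ] ℝ)) hinj hdim
    ).toContinuousLinearEquiv
  exact ⟨e, by ext; rfl⟩

lemma vcoords_inverse (hs : ∀ a b, s a b = s b a) (hpos : ∀ a, a ≠ 0 → 0 < s a a)
    (α : E →L[ℝ] ℝ) : vcoords (s.inverse α) = (gramMatrix s)⁻¹ *ᵥ coords α := by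
  have h1 : s (s.inverse α) = α := (isInvertible_of_pos hpos).self_apply_inverse α
  rw [← congrArg coords h1, coords_bilin s hs, mulVec_mulVec, nonsing_inv_mul, one_mulVec]
  exact (posDef_gramMatrix hs hpos).det_pos.ne'.isUnit

end Gram

/-! ### The divergence of the flux of a graph in a warped product -/

section Divergence
open Matrix
variable {E : Type*} [NormedAddCommGroup E] [InnerProductSpace ℝ E] [FiniteDimensional ℝ E]

/-- The gradient of `u` with respect to the metric `s` on a vector space. -/
def gradVec (s : E → E →L[ℝ] E →L[ℝ] ℝ) (u : E → ℝ) (z : E) : E :=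
  (s z).inverse (fderiv ℝ u z)

/-- `W = √(e^{2ψ} + |∇u|²)` on a vector space with the metric `s`. -/
def slope (s : E → E →L[ℝ] E →L[ℝ] ℝ) (ψ u : E → ℝ) (z : E) : ℝ :=
  √(Real.exp (2 * ψ z) + fderiv ℝ u z (gradVec s u z))

/-- The density `e^{-(d+1)ψ} √det s`. -/
def weightDensity (s : E → E →L[ℝ] E →L[ℝ] ℝ) (ψ : E → ℝ) (d : ℝ) (z : E) : ℝ :=
  √(gramMatrix (s z)).det * Real.exp (-((d + 1) * ψ z))

/-- The weighted flux `e^{-(d+1)ψ} √det s ∇u / W`. -/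
def flux (s : E → E →L[ℝ] E →L[ℝ] ℝ) (ψ u : E → ℝ) (d : ℝ) (z : E) : E :=
  (weightDensity s ψ d z / slope s ψ u z) • gradVec s u z

lemma fderiv_gradVec_nonneg {s : E → E →L[ℝ] E →L[ℝ] ℝ} {u : E → ℝ} {z : E}
    (hpos : ∀ a, a ≠ 0 → 0 < s z a a) : 0 ≤ fderiv ℝ u z (gradVec s u z) := by
  have h1 : s z (gradVec s u z) = fderiv ℝ u z :=
    (isInvertible_of_pos hpos).self_apply_inverse _
  rw [← h1]
  by_cases h : gradVec s u z = 0
  · simp [h]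
  · exact (hpos _ h).le

lemma slope_pos {s : E → E →L[ℝ] E →L[ℝ] ℝ} {ψ u : E → ℝ} {z : E}
    (hpos : ∀ a, a ≠ 0 → 0 < s z a a) : 0 < slope s ψ u z := by
  have := fderiv_gradVec_nonneg (u := u) hpos
  rw [slope]; positivity

variable {s : E → E →L[ℝ] E →L[ℝ] ℝ} {ψ u : E → ℝ} {y : E}

lemma contDiffAt_gradVec (hs : ContDiffAt ℝ 1 s y) (hu : ContDiffAt ℝ 2 u y)
    (hpos : ∀ a, a ≠ 0 → 0 < s y a a) : ContDiffAt ℝ 1 (gradVec s u) y := by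
  have h1 : ContDiffAt ℝ 1 (fun z ↦ (s z).inverse) y := by
    obtain ⟨e, he⟩ := isInvertible_of_pos hpos
    exact ContDiffAt.comp (g := ContinuousLinearMap.inverse) y
      (he ▸ contDiffAt_map_inverse e) hs
  exact h1.clm_apply (hu.fderiv_right (by norm_num))

lemma differentiableAt_gramMatrix (hs : DifferentiableAt ℝ s y) (i j) :
    HasFDerivAt (fun z ↦ gramMatrix (s z) i j)
      (((fderiv ℝ s y).flip (stdOrthonormalBasis ℝ E i)).flip (stdOrthonormalBasis ℝ E j)) y :=
  ((hs.hasFDerivAt.clm_apply (hasFDerivAt_const (stdOrthonormalBasis ℝ E i) y)).clm_apply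
    (hasFDerivAt_const (stdOrthonormalBasis ℝ E j) y)).congr_fderiv (by ext; simp)

lemma contDiffAt_flux {d : ℝ} (hs : ContDiffAt ℝ 1 s y) (hsymm : ∀ a b, s y a b = s y b a)
    (hpos : ∀ a, a ≠ 0 → 0 < s y a a) (hu : ContDiffAt ℝ 2 u y) (hψ : ContDiffAt ℝ 1 ψ y) :
    ContDiffAt ℝ 1 (flux s ψ u d) y := by
  have hg := contDiffAt_gradVec hs hu hpos
  have hdet : ContDiffAt ℝ 1 (fun z ↦ (gramMatrix (s z)).det) y := by
    simp only [det_apply, gramMatrix, of_apply]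
    fun_prop
  have h1 : ContDiffAt ℝ 1 (weightDensity s ψ d) y :=
    (hdet.sqrt (posDef_gramMatrix hsymm hpos).det_pos.ne').mul
      ((contDiffAt_const.mul hψ).neg.exp)
  have h2 : ContDiffAt ℝ 1 (slope s ψ u) y := by
    refine ContDiffAt.sqrt ((contDiffAt_const.mul hψ).exp.add
      ((hu.fderiv_right (by norm_num)).clm_apply hg)) ?_
    have := fderiv_gradVec_nonneg (u := u) hpos
    positivity
  exact (h1.div h2 (slope_pos hpos).ne').smul hg

/-- The divergence of the weighted flux, in terms of the trace which computes the mean curvature of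
a graph in a warped product. -/
lemma sum_inner_fderiv_flux {d : ℝ} (hs : ContDiffAt ℝ 1 s y) (hsymm : ∀ z a b, s z a b = s z b a)
    (hpos : ∀ᶠ z in 𝓝 y, ∀ a, a ≠ 0 → 0 < s z a a) (hu : ContDiffAt ℝ 2 u y)
    (hψ : ContDiffAt ℝ 1 ψ y) :
    let q := coords (fderiv ℝ u y)
    let p := coords (fderiv ℝ ψ y)
    let l := Real.exp (-(2 * ψ y))
    let g := gradVec s u y
    let W := slope s ψ u y
    ∑ i, inner ℝ (stdOrthonormalBasis ℝ E i)
        (fderiv ℝ (flux s ψ u d) y (stdOrthonormalBasis ℝ E i)) =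
      weightDensity s ψ d y *
        (((gramMatrix (s y) + l • vecMulVec q q)⁻¹ * Matrix.of fun i j ↦
            W⁻¹ * (fderiv ℝ (fderiv ℝ u) y (stdOrthonormalBasis ℝ E i) (stdOrthonormalBasis ℝ E j)
              - christoffelForm s y (stdOrthonormalBasis ℝ E i) (stdOrthonormalBasis ℝ E j) g
              - p i * q j - q i * p j - l * fderiv ℝ ψ y g * (q i * q j))).trace
          - d * fderiv ℝ ψ y g / W) := by
  intro q p l g W
  set e := stdOrthonormalBasis ℝ E with he
  have hposy := hpos.self_of_nhds
  have hWpos : 0 < W := slope_pos hposy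
  have hgd : DifferentiableAt ℝ (gradVec s u) y :=
    (contDiffAt_gradVec hs hu hposy).differentiableAt (by norm_num)
  have hsd : DifferentiableAt ℝ s y := hs.differentiableAt (by norm_num)
  have hψd : DifferentiableAt ℝ ψ y := hψ.differentiableAt (by norm_num)
  have hud := hu.differentiableAt_fderiv
  set L := fderiv ℝ (gradVec s u) y with hL
  set G := gramMatrix (s y) with hG
  have hGdet : 0 < G.det := (posDef_gramMatrix (hsymm y) hposy).det_pos
  have hGt : Gᵀ = G := gramMatrix_transpose (hsymm y)
  have hGit : (G⁻¹)ᵀ = G⁻¹ := by rw [transpose_nonsing_inv, hGt]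
  set D : Fin (Module.finrank ℝ E) → Matrix _ _ ℝ := fun k ↦ gramMatrix (fderiv ℝ s y (e k)) with hD
  set A : Matrix (Fin (Module.finrank ℝ E)) (Fin (Module.finrank ℝ E)) ℝ :=
    Matrix.of fun i j ↦ fderiv ℝ (fderiv ℝ u) y (e i) (e j) with hA
  set B : Matrix (Fin (Module.finrank ℝ E)) (Fin (Module.finrank ℝ E)) ℝ :=
    Matrix.of fun i j ↦ (D i *ᵥ vcoords g) j with hB
  have hDsymm : ∀ v a b, fderiv ℝ s y v a b = fderiv ℝ s y v b a := by
    intro v a b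
    have h1 : HasFDerivAt (fun z ↦ s z a b) (((fderiv ℝ s y).flip a).flip b) y :=
      ((hsd.hasFDerivAt.clm_apply (hasFDerivAt_const a y)).clm_apply
        (hasFDerivAt_const b y)).congr_fderiv (by ext; simp)
    have h2 : HasFDerivAt (fun z ↦ s z b a) (((fderiv ℝ s y).flip b).flip a) y :=
      ((hsd.hasFDerivAt.clm_apply (hasFDerivAt_const b y)).clm_apply
        (hasFDerivAt_const a y)).congr_fderiv (by ext; simp)
    have h3 : (fun z ↦ s z a b) = fun z ↦ s z b a := by ext z; exact hsymm z a b
    rw [h3] at h1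
    exact congrArg (fun T ↦ T v) (h1.unique h2)
  -- the derivative of the gradient, from `s ∇u = du`
  have hgeq : (fun z ↦ s z (gradVec s u z)) =ᶠ[𝓝 y] fderiv ℝ u := by
    filter_upwards [hpos] with z hz
    exact (isInvertible_of_pos hz).self_apply_inverse _
  have hLv : ∀ v, fderiv ℝ s y v g + s y (L v) = fderiv ℝ (fderiv ℝ u) y v := by
    intro v
    have h1 := (hsd.hasFDerivAt.clm_apply hgd.hasFDerivAt)
    have h2 := h1.unique (hud.hasFDerivAt.congr_of_eventuallyEq hgeq)
    rw [← h2]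
    simp [g, add_comm]
    rfl
  have hgc : vcoords g = G⁻¹ *ᵥ q := vcoords_inverse (hsymm y) hposy _
  have hLc : ∀ k, vcoords (L (e k)) = G⁻¹ *ᵥ (A k - B k) := by
    intro k
    have h1 : coords (s y (L (e k))) = A k - B k := by
      have : s y (L (e k)) = fderiv ℝ (fderiv ℝ u) y (e k) - fderiv ℝ s y (e k) g := by
        rw [← hLv (e k)]; abel
      rw [this]
      have h2 : B k = coords (fderiv ℝ s y (e k) g) := by
        rw [coords_bilin _ (hDsymm (e k))]; rfl
      rw [h2]; ext i; rfl
    rw [← h1, coords_bilin _ (hsymm y), mulVec_mulVec, nonsing_inv_mul _ hGdet.ne'.isUnit,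
      one_mulVec]
  have hp : fderiv ℝ ψ y g = p ⬝ᵥ vcoords g := clm_apply_eq _ _
  have hq : fderiv ℝ u y g = q ⬝ᵥ vcoords g := clm_apply_eq _ _
  have hWsq : W ^ 2 = l⁻¹ + q ⬝ᵥ vcoords g := by
    rw [← hq]
    have h0 := fderiv_gradVec_nonneg (u := u) hposy
    have : l⁻¹ = Real.exp (2 * ψ y) := by rw [← Real.exp_neg]; simp
    rw [this]
    exact Real.sq_sqrt (by positivity)
  -- the derivative of `|∇u|²`
  have hP : HasFDerivAt (fun z ↦ fderiv ℝ u z (gradVec s u z))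
      ((fderiv ℝ u y).comp L + (fderiv ℝ (fderiv ℝ u) y).flip g) y :=
    hud.hasFDerivAt.clm_apply hgd.hasFDerivAt
  have hPk : ∀ k, ((fderiv ℝ u y).comp L + (fderiv ℝ (fderiv ℝ u) y).flip g) (e k) =
      2 * (A k ⬝ᵥ vcoords g) - vcoords g ⬝ᵥ B k := by
    intro k
    have h1 : fderiv ℝ u y (L (e k)) = vcoords g ⬝ᵥ (A k - B k) := by
      rw [clm_apply_eq, hLc, dotProduct_mulVec, ← mulVec_transpose, hGit, hgc]
    have h2 : fderiv ℝ (fderiv ℝ u) y (e k) g = A k ⬝ᵥ vcoords g := clm_apply_eq _ _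
    simp only [_root_.add_apply, ContinuousLinearMap.comp_apply, ContinuousLinearMap.flip_apply, h1,
      h2, dotProduct_sub, dotProduct_comm (vcoords g) (A k)]
    ring
  have hW' : HasFDerivAt (slope s ψ u) ((1 / (2 * W)) • ((Real.exp (2 * ψ y)) •
      ((2 : ℝ) • fderiv ℝ ψ y) + ((fderiv ℝ u y).comp L +
        (fderiv ℝ (fderiv ℝ u) y).flip g))) y := by
    have h0 := fderiv_gradVec_nonneg (u := u) hposy
    exact ((hψd.hasFDerivAt.const_mul 2).exp.add hP).sqrt
      (add_pos_of_pos_of_nonneg (Real.exp_pos _) h0).ne'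
  obtain ⟨Ld, hLd, hLd'⟩ := hasFDerivAt_sqrt_det (m := fun z ↦ gramMatrix (s z))
    (differentiableAt_gramMatrix hsd) hGdet
  have hLdk : ∀ k, Ld (e k) = √G.det * ((G⁻¹ * D k).trace / 2) := fun k ↦ hLd' (e k)
  have hρ : HasFDerivAt (weightDensity s ψ d) (√G.det • (Real.exp (-((d + 1) * ψ y)) •
      (-((d + 1) • fderiv ℝ ψ y))) + Real.exp (-((d + 1) * ψ y)) • Ld) y :=
    hLd.mul (hψd.hasFDerivAt.const_mul (d + 1)).neg.exp
  have hWi : HasFDerivAt (fun z ↦ (slope s ψ u z)⁻¹) _ y :=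
    (hasDerivAt_inv hWpos.ne').comp_hasFDerivAt y hW'
  have hρW : HasFDerivAt (fun z ↦ weightDensity s ψ d z / slope s ψ u z) _ y := hρ.mul hWi
  have hflux' : HasFDerivAt (flux s ψ u d) _ y := hρW.smul hgd.hasFDerivAt
  rw [hflux'.fderiv]
  -- every term is now expressed by matrices, and the two sides are compared by `trace_identity`
  have hle : Real.exp (2 * ψ y) = l⁻¹ := by rw [← Real.exp_neg]; simp
  have hsum1 : ∑ i, inner ℝ (e i) (L (e i)) = (G⁻¹ * (A - B)).trace := by
    have : ∀ i, inner ℝ (e i) (L (e i)) = (G⁻¹ *ᵥ (A i - B i)) i := fun i ↦ congrFun (hLc i) i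
    simp only [this]
    rw [trace_mul_comm, ← trace_transpose, transpose_mul, hGit]
    simp [Matrix.trace, mulVec, Matrix.mul_apply, dotProduct]
  have hkey := trace_identity (A := A) D hGdet.ne'.isUnit hGt p q (vcoords g) hgc
    (Real.exp_ne_zero (-(2 * ψ y))) hWpos.ne' hWsq d B (fun i j ↦ rfl)
  have hmat : (Matrix.of fun i j ↦ W⁻¹ * (fderiv ℝ (fderiv ℝ u) y (e i) (e j)
      - christoffelForm s y (e i) (e j) g
      - p i * q j - q i * p j - l * fderiv ℝ ψ y g * (q i * q j))) =
      W⁻¹ • (A - (2 : ℝ)⁻¹ • (B + Bᵀ - ∑ k, vcoords g k • D k)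
        - vecMulVec p q - vecMulVec q p - (l * (p ⬝ᵥ vcoords g)) • vecMulVec q q) := by
    ext i j
    have h1 : fderiv ℝ s y (e i) (e j) g = B i j := by
      have := congrFun (coords_bilin _ (hDsymm (e i)) g) j
      rw [coords, hDsymm] at this
      exact this
    have h2 : fderiv ℝ s y (e j) (e i) g = B j i := by
      have := congrFun (coords_bilin _ (hDsymm (e j)) g) i
      rw [coords, hDsymm] at this
      exact this
    have h3 : fderiv ℝ s y g (e i) (e j) = ∑ k, vcoords g k * D k i j := by
      conv_lhs => rw [← sum_vcoords g]
      simp [map_sum, hD, gramMatrix, he]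
    simp only [christoffelForm, h1, h2, h3, hp, Matrix.smul_apply, Matrix.sub_apply,
      Matrix.add_apply, Matrix.transpose_apply, vecMulVec_apply, Matrix.sum_apply, smul_eq_mul,
      Matrix.of_apply, hA]
    ring
  rw [hmat, hp, hkey]
  -- the product rule for the flux, evaluated at one basis vector
  have hfin : ∀ i, inner ℝ (e i) ((((weightDensity s ψ d y / W) • L +
      (weightDensity s ψ d y • (-(W ^ 2)⁻¹) • ((1 / (2 * W)) • ((Real.exp (2 * ψ y)) •
      ((2 : ℝ) • fderiv ℝ ψ y) + ((fderiv ℝ u y).comp L +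
        (fderiv ℝ (fderiv ℝ u) y).flip g))) +
        W⁻¹ • (√G.det • (Real.exp (-((d + 1) * ψ y)) •
      (-((d + 1) • fderiv ℝ ψ y))) + Real.exp (-((d + 1) * ψ y)) • Ld)).smulRight g)) (e i)) =
      weightDensity s ψ d y * (inner ℝ (e i) (L (e i)) / W
        + ((vcoords g i * (G⁻¹ * D i).trace) / 2 - (d + 1) * (p i * vcoords g i)) / W
        - (2 * l⁻¹ * (p i * vcoords g i) + 2 * (vcoords g i * (A i ⬝ᵥ vcoords g))
          - vcoords g i * (vcoords g ⬝ᵥ B i)) / (2 * W) / W ^ 2) := by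
    intro i
    have h1 : inner ℝ (e i) g = vcoords g i := rfl
    have h2 : fderiv ℝ ψ y (e i) = p i := rfl
    have h3 := hPk i
    simp only [_root_.add_apply] at h3
    simp only [_root_.add_apply, _root_.smul_apply, _root_.neg_apply,
      ContinuousLinearMap.smulRight_apply, smul_eq_mul, inner_add_right, inner_smul_right, h1, h2,
      h3, hLdk, hle, weightDensity, ← hG]
    field_simp
    ring
  refine (Finset.sum_congr rfl fun i _ ↦ hfin i).trans ?_
  rw [← Finset.mul_sum, ← hsum1]
  congr 1
  simp only [Finset.sum_add_distrib, Finset.sum_sub_distrib, ← Finset.sum_div, dotProduct, mulVec,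
    ← Finset.mul_sum]
  have hBx : ∀ k i, B k i = ∑ j, D k i j * vcoords g j := fun _ _ ↦ rfl
  simp only [hBx, l]
  ring
end Divergence

/-! ### The second fundamental form of a graph in a warped product -/

lemma hasFDerivAt_apply_apply {X V : Type*} [NormedAddCommGroup X] [NormedSpace ℝ X]
    [NormedAddCommGroup V] [NormedSpace ℝ V] {g : X → V →L[ℝ] V →L[ℝ] ℝ} {z : X}
    (hg : DifferentiableAt ℝ g z) (a b : V) :
    ∃ L : X →L[ℝ] ℝ, HasFDerivAt (fun z ↦ g z a b) L z ∧ ∀ c, L c = fderiv ℝ g z c a b := by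
  have h1 := hg.hasFDerivAt.clm_apply (hasFDerivAt_const a z)
  have h2 := h1.clm_apply (hasFDerivAt_const b z)
  exact ⟨_, h2, fun c ↦ by simp⟩

section WarpedGraph
variable {E : Type*} [NormedAddCommGroup E] [InnerProductSpace ℝ E]
  {s : E → E →L[ℝ] E →L[ℝ] ℝ} {ψ u : E → ℝ} {y : E}
  {g' : E × ℝ → (E × ℝ) →L[ℝ] (E × ℝ) →L[ℝ] ℝ}

/-- The map `x ↦ (x, u x)`. -/
def graphPair (u : E → ℝ) (x : E) : E × ℝ := (x, u x)

lemma contDiffAt_graphPair {n : WithTop ℕ∞} (hu : ContDiffAt ℝ n u y) :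
    ContDiffAt ℝ n (graphPair u) y := contDiffAt_id.prodMk hu

lemma fderiv_graphPair (hu : DifferentiableAt ℝ u y) (v : E) :
    fderiv ℝ (graphPair u) y v = (v, fderiv ℝ u y v) := by
  have : HasFDerivAt (graphPair u) _ y := (hasFDerivAt_id y).prodMk hu.hasFDerivAt
  rw [this.fderiv]; rfl

lemma fderiv_fderiv_graphPair (hu : ContDiffAt ℝ 2 u y) (v w : E) :
    fderiv ℝ (fderiv ℝ (graphPair u)) y v w = (0, fderiv ℝ (fderiv ℝ u) y v w) := by
  have h1 : (fun z ↦ fderiv ℝ (graphPair u) z w) =ᶠ[𝓝 y] fun z ↦ (w, fderiv ℝ u z w) := by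
    filter_upwards [hu.eventually (by simp)] with z hz
    exact fderiv_graphPair (hz.differentiableAt (by norm_num)) w
  have h2 := (contDiffAt_graphPair hu).differentiableAt_fderiv.hasFDerivAt.clm_apply
    (hasFDerivAt_const w y)
  have h3 := hu.differentiableAt_fderiv.hasFDerivAt.clm_apply (hasFDerivAt_const w y)
  have h4 := h2.unique (((hasFDerivAt_const w y).prodMk h3).congr_of_eventuallyEq h1)
  simpa using congrArg (fun L ↦ L v) h4

variable [FiniteDimensional ℝ E]

/-- The upward unit normal of the graph of `u` in a warped product. -/
def warpedNormal (s : E → E →L[ℝ] E →L[ℝ] ℝ) (ψ u : E → ℝ) (y : E) : E × ℝ :=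
  ((slope s ψ u y)⁻¹ • -gradVec s u y, (slope s ψ u y)⁻¹ * Real.exp (2 * ψ y))

/-- Here `g' = s + e^{-2ψ} dt ⊗ dt` is the warped product metric at the point of the graph. -/
lemma warpedNormal_orthogonal (hsymm : ∀ a b, s y a b = s y b a)
    (hpos : ∀ a, a ≠ 0 → 0 < s y a a)
    (hg : ∀ a b, g' (graphPair u y) a b = s y a.1 b.1 + Real.exp (-(2 * ψ y)) * (a.2 * b.2))
    (hu : DifferentiableAt ℝ u y) (v : E) :
    g' (graphPair u y) (fderiv ℝ (graphPair u) y v) (warpedNormal s ψ u y) = 0 := by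
  have h1 : s y (gradVec s u y) = fderiv ℝ u y := (isInvertible_of_pos hpos).self_apply_inverse _
  have h2 : Real.exp (-(2 * ψ y)) * Real.exp (2 * ψ y) = 1 := by rw [← Real.exp_add]; simp
  rw [hg, fderiv_graphPair hu, warpedNormal]
  simp only [map_smul, map_neg, smul_eq_mul, hsymm v, h1, _root_.smul_apply, _root_.neg_apply]
  linear_combination ((slope s ψ u y)⁻¹ * fderiv ℝ u y v) * h2

/-- The second fundamental form of the graph of `u` for the warped product metric
`g' = s + e^{-2ψ} dt ⊗ dt` and the normal `(e^{2ψ} ∂_t - ∇u) / W`. -/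
lemma sffForm_graphPair (hs : DifferentiableAt ℝ s y) (hsymm : ∀ a b, s y a b = s y b a)
    (hpos : ∀ a, a ≠ 0 → 0 < s y a a)
    (hu : ContDiffAt ℝ 2 u y) (hψ : DifferentiableAt ℝ ψ y)
    (hg'd : DifferentiableAt ℝ g' (graphPair u y))
    (hg : ∀ᶠ z in 𝓝 (graphPair u y), ∀ a b,
      g' z a b = s z.1 a.1 b.1 + Real.exp (-(2 * ψ z.1)) * (a.2 * b.2)) (v w : E) :
    sffForm g' (graphPair u) (warpedNormal s ψ u y) y v w = (slope s ψ u y)⁻¹ *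
      (fderiv ℝ (fderiv ℝ u) y v w - christoffelForm s y v w (gradVec s u y)
        - fderiv ℝ ψ y v * fderiv ℝ u y w - fderiv ℝ u y v * fderiv ℝ ψ y w
        - Real.exp (-(2 * ψ y)) * fderiv ℝ ψ y (gradVec s u y)
          * (fderiv ℝ u y v * fderiv ℝ u y w)) := by
  -- the derivatives of the metric coefficients, which do not depend on `t`
  have key : ∀ c a b : E × ℝ, fderiv ℝ g' (graphPair u y) c a b =
      fderiv ℝ s y c.1 a.1 b.1 - 2 * Real.exp (-(2 * ψ y)) * fderiv ℝ ψ y c.1 * (a.2 * b.2) := by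
    intro c a b
    obtain ⟨L0, h0, hL0⟩ := hasFDerivAt_apply_apply hg'd a b
    have hfst : HasFDerivAt (fun z : E × ℝ ↦ z.1) (ContinuousLinearMap.fst ℝ E ℝ)
      (graphPair u y) := hasFDerivAt_fst
    obtain ⟨L1, hs1, hL1⟩ := hasFDerivAt_apply_apply hs a.1 b.1
    have hs2 : HasFDerivAt (fun z : E × ℝ ↦ s z.1 a.1 b.1) _ (graphPair u y) :=
      HasFDerivAt.comp (g := fun z : E ↦ s z a.1 b.1) (graphPair u y) hs1 hfst
    have he : HasFDerivAt (fun z : E ↦ Real.exp (-(2 * ψ z)))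
        (Real.exp (-(2 * ψ y)) • -((2 : ℝ) • fderiv ℝ ψ y)) y :=
      (hψ.hasFDerivAt.const_mul 2).neg.exp
    have he2 : HasFDerivAt (fun z : E × ℝ ↦ Real.exp (-(2 * ψ z.1))) _ (graphPair u y) :=
      HasFDerivAt.comp (g := fun z : E ↦ Real.exp (-(2 * ψ z))) (graphPair u y) he hfst
    have h1 := hs2.add (he2.mul_const (a.2 * b.2))
    have h2 := h0.unique (h1.congr_of_eventuallyEq (hg.mono fun z hz ↦ hz a b))
    have h3 := congrArg (fun L ↦ L c) h2
    simp only [hL0, hL1, _root_.add_apply, _root_.smul_apply,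
      ContinuousLinearMap.comp_apply, ContinuousLinearMap.coe_fst', _root_.neg_apply,
      smul_eq_mul] at h3
    rw [h3]; ring
  have h1 : s y (gradVec s u y) = fderiv ℝ u y := (isInvertible_of_pos hpos).self_apply_inverse _
  have h2 : Real.exp (-(2 * ψ y)) * Real.exp (2 * ψ y) = 1 := by rw [← Real.exp_add]; simp
  rw [sffForm, fderiv_fderiv_graphPair hu, hg.self_of_nhds, christoffelForm, christoffelForm]
  have h3 : ∀ a : E, s y a (gradVec s u y) = fderiv ℝ u y a := fun a ↦ by rw [hsymm, h1]
  simp only [key, fderiv_graphPair (hu.differentiableAt (by norm_num)), warpedNormal]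
  simp only [graphPair, map_smul, map_neg, smul_eq_mul, map_zero, _root_.zero_apply,
    _root_.smul_apply, _root_.neg_apply]
  linear_combination ((slope s ψ u y)⁻¹ * (fderiv ℝ (fderiv ℝ u) y v w
    - fderiv ℝ ψ y v * fderiv ℝ u y w - fderiv ℝ u y v * fderiv ℝ ψ y w)) * h2
end WarpedGraph

/-! ### Killing fields -/

section Killing

variable {V : Type*} [NormedAddCommGroup V] [NormedSpace ℝ V]
  {F : Type*} [NormedAddCommGroup F] [InnerProductSpace ℝ F]
  {M : Type*} [TopologicalSpace M] [ChartedSpace F M]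

/-- The differential of a local inverse is the inverse of the differential. -/
lemma mfderiv_inverse_of_local_inverse {S : V → M} {φ : M → V} {z₀ : V}
    (hS : ContMDiffAt 𝓘(ℝ, V) 𝓘(ℝ, F) ∞ S z₀) (hφ : ContMDiffAt 𝓘(ℝ, F) 𝓘(ℝ, V) ∞ φ (S z₀))
    (hφS : ∀ᶠ z in 𝓝 z₀, φ (S z) = z) (hSφ : ∀ᶠ q in 𝓝 (S z₀), S (φ q) = q) :
    (mfderiv 𝓘(ℝ, F) 𝓘(ℝ, V) φ (S z₀)).IsInvertible ∧
    (mfderiv 𝓘(ℝ, F) 𝓘(ℝ, V) φ (S z₀)).inverse = mfderiv 𝓘(ℝ, V) 𝓘(ℝ, F) S z₀ := by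
  have hSd := hS.mdifferentiableAt (by simp)
  have hφd := hφ.mdifferentiableAt (by simp)
  have hz : φ (S z₀) = z₀ := hφS.self_of_nhds
  have h1 : (mfderiv 𝓘(ℝ, F) 𝓘(ℝ, V) φ (S z₀)).comp (mfderiv 𝓘(ℝ, V) 𝓘(ℝ, F) S z₀) =
      ContinuousLinearMap.id ℝ V := by
    have e1 : φ ∘ S =ᶠ[𝓝 z₀] id := hφS
    have := e1.mfderiv_eq (I := 𝓘(ℝ, V)) (I' := 𝓘(ℝ, V))
    rw [mfderiv_comp z₀ hφd hSd, mfderiv_id] at this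
    exact this
  have h2 : (mfderiv 𝓘(ℝ, V) 𝓘(ℝ, F) S z₀).comp (mfderiv 𝓘(ℝ, F) 𝓘(ℝ, V) φ (S z₀)) =
      ContinuousLinearMap.id ℝ F := by
    have e1 : S ∘ φ =ᶠ[𝓝 (S z₀)] id := hSφ
    have := e1.mfderiv_eq (I := 𝓘(ℝ, F)) (I' := 𝓘(ℝ, F))
    rw [mfderiv_comp (S z₀) (by rw [hz]; exact hSd) hφd, mfderiv_id] at this
    have key : ∀ w, w = z₀ → (mfderiv 𝓘(ℝ, V) 𝓘(ℝ, F) S w : V →L[ℝ] F) =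
      (mfderiv 𝓘(ℝ, V) 𝓘(ℝ, F) S z₀ : V →L[ℝ] F) := by rintro w rfl; rfl
    have h3 := key _ hz
    rw [← h3]
    exact this
  exact ⟨ContinuousLinearMap.IsInvertible.of_inverse h1 h2, ContinuousLinearMap.inverse_eq h1 h2⟩

variable [FiniteDimensional ℝ V] [FiniteDimensional ℝ F] [IsManifold 𝓘(ℝ, F) ∞ M]
  [RiemannianBundle (fun p : M ↦ TangentSpace 𝓘(ℝ, F) p)]
  [IsContMDiffRiemannianBundle 𝓘(ℝ, F) ∞ F (fun p : M ↦ TangentSpace 𝓘(ℝ, F) p)]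

/-- In coordinates in which a Killing field is a constant vector field, the metric coefficients are
constant in its direction. -/
lemma fderiv_pullbackForm_killing {Y : ∀ p : M, TangentSpace 𝓘(ℝ, F) p} (hY : IsKilling Y)
    {S : V → M} {φ : M → V} {z₀ e : V}
    (hSev : ∀ᶠ z in 𝓝 z₀, ContMDiffAt 𝓘(ℝ, V) 𝓘(ℝ, F) ∞ S z)
    (hφev : ∀ᶠ q in 𝓝 (S z₀), ContMDiffAt 𝓘(ℝ, F) 𝓘(ℝ, V) ∞ φ q)
    (hφS : ∀ᶠ z in 𝓝 z₀, φ (S z) = z) (hSφ : ∀ᶠ q in 𝓝 (S z₀), S (φ q) = q)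
    (hYS : ∀ᶠ z in 𝓝 z₀, mfderiv 𝓘(ℝ, V) 𝓘(ℝ, F) S z e = Y (S z)) (a b : V) :
    fderiv ℝ (fun z ↦ pullbackForm (F := F) S z a b) z₀ e = 0 := by
  -- the coordinate fields `X a`; since `Y = X e` commutes with them, the Lie derivative of the
  -- metric in the direction `Y` reduces to the derivative of the coefficients
  let X (a : V) : ∀ q : M, TangentSpace 𝓘(ℝ, F) q :=
    VectorField.mpullback 𝓘(ℝ, F) 𝓘(ℝ, V) φ (fun _ ↦ a)
  have : IsManifold 𝓘(ℝ, F) (minSmoothness ℝ 2) M := by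
    rw [minSmoothness_of_isRCLikeNormedField]; infer_instance
  have hS := hSev.self_of_nhds
  have hφ := hφev.self_of_nhds
  have hz : φ (S z₀) = z₀ := hφS.self_of_nhds
  have hXS : ∀ a, ∀ᶠ z in 𝓝 z₀, X a (S z) = mfderiv 𝓘(ℝ, V) 𝓘(ℝ, F) S z a := by
    intro a
    filter_upwards [hSev, hS.continuousAt.eventually hφev, hφS.eventually_nhds,
      hS.continuousAt.eventually hSφ.eventually_nhds] with z h1 h2 h3 h4
    have := (mfderiv_inverse_of_local_inverse h1 h2 h3 h4).2
    exact congrArg (fun T ↦ T a) this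
  have hinv := (mfderiv_inverse_of_local_inverse hS hφ hφS hSφ).1
  have hconst : ∀ (a w : V), MDifferentiableAt 𝓘(ℝ, V) 𝓘(ℝ, V).tangent
      (fun y : V ↦ (⟨y, a⟩ : TangentBundle 𝓘(ℝ, V) V)) w := fun a w ↦
    (contMDiffAt_vectorSpace_iff_contDiffAt.2
      (contDiffAt_const (n := 1))).mdifferentiableAt (by simp)
  have hXd : ∀ a, MDifferentiableAt 𝓘(ℝ, F) 𝓘(ℝ, F).tangent
      (fun q ↦ (⟨q, X a q⟩ : TangentBundle 𝓘(ℝ, F) M)) (S z₀) := fun a ↦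
    MDifferentiableAt.mpullback_vectorField (n := ∞) (hconst a _) hφ hinv (by norm_cast)
  have hYX : Y =ᶠ[𝓝 (S z₀)] X e := by
    have h1 : ∀ᶠ z in 𝓝 z₀, Y (S z) = X e (S z) := by
      filter_upwards [hYS, hXS e] with z h1 h2
      rw [h2, h1]
    have h2 : Tendsto φ (𝓝 (S z₀)) (𝓝 z₀) := by
      have := hφ.continuousAt.tendsto
      rwa [hz] at this
    filter_upwards [h2.eventually h1, hSφ] with q hq hq'
    rw [hq'] at hq
    exact hq
  have hbr : ∀ a, VectorField.mlieBracket 𝓘(ℝ, F) Y (X a) (S z₀) = 0 := by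
    intro a
    refine (hYX.mlieBracket_vectorField_eq (I := 𝓘(ℝ, F)) (W := X a) EventuallyEq.rfl).trans ?_
    have h1 := VectorField.mpullback_mlieBracket (I := 𝓘(ℝ, F)) (I' := 𝓘(ℝ, V)) (n := ∞)
      (hconst e (φ (S z₀))) (hconst a (φ (S z₀))) hφ (by simp; norm_cast)
    have h2 : ∀ w : V, VectorField.mlieBracket 𝓘(ℝ, V) (fun _ : V ↦ e) (fun _ ↦ a) w = 0 := by
      intro w
      refine (congrFun VectorField.mlieBracketWithin_univ.symm w).trans
        ((congrFun VectorField.mlieBracketWithin_eq_lieBracketWithin w).trans ?_)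
      simp [VectorField.lieBracketWithin]
      rfl
    refine h1.symm.trans ?_
    rw [VectorField.mpullback_apply]
    exact (congrArg _ (h2 _)).trans (map_zero _)
  have hkey := hY.lieDeriv_metric (X a) (X b) (S z₀) (hXd a) (hXd b)
  rw [hbr a, hbr b] at hkey
  have hmet : MDifferentiableAt 𝓘(ℝ, F) 𝓘(ℝ, ℝ)
      (fun q ↦ metric (E := F) q (X a q) (X b q)) (S z₀) :=
    MDifferentiableAt.inner_bundle (b := fun q : M ↦ q)
      (E := fun p : M ↦ TangentSpace 𝓘(ℝ, F) p) (v := X a) (w := X b) (hXd a) (hXd b)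
  have hcomp : (fun q ↦ metric (E := F) q (X a q) (X b q)) ∘ S =ᶠ[𝓝 z₀]
      fun z ↦ pullbackForm (F := F) S z a b := by
    filter_upwards [hXS a, hXS b] with z h1 h2
    simp only [Function.comp, h1, h2]
    rfl
  have h1 := hcomp.mfderiv_eq (I := 𝓘(ℝ, V)) (I' := 𝓘(ℝ, ℝ))
  rw [mfderiv_comp z₀ hmet (hS.mdifferentiableAt (by simp)), mfderiv_eq_fderiv] at h1
  have h2 := congrArg (fun T ↦ T e) h1
  refine h2.symm.trans ?_
  have h3 : mfderiv 𝓘(ℝ, V) 𝓘(ℝ, F) S z₀ e = Y (S z₀) := hYS.self_of_nhds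
  change mfderiv 𝓘(ℝ, F) 𝓘(ℝ, ℝ) (fun q ↦ metric (E := F) q (X a q) (X b q)) (S z₀)
    (mfderiv 𝓘(ℝ, V) 𝓘(ℝ, F) S z₀ e) = 0
  rw [h3, hkey]
  simp only [metric, inner_zero_left, inner_zero_right, add_zero]
  rfl
end Killing

/-! ### The warped product structure -/

section Warped

variable {E : Type*} [NormedAddCommGroup E] [InnerProductSpace ℝ E]
  {F : Type*} [NormedAddCommGroup F] [InnerProductSpace ℝ F]
  {P : Type*} [TopologicalSpace P] [ChartedSpace E P]
  {M : Type*} [TopologicalSpace M] [ChartedSpace F M]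

/-- The local parametrization `(y, s) ↦ ϑ(κ(y), s)` of `M`, where `κ` is the inverse of the chart of
`P` centred at `c`. -/
def flowChart (ϑ : P × ℝ → M) (c : P) (z : E × ℝ) : M :=
  ϑ ((extChartAt 𝓘(ℝ, E) c).symm z.1, z.2)

/-- The local inverse of `flowChart`. -/
def flowCoord (ϑinv : M → P × ℝ) (c : P) (q : M) : E × ℝ :=
  (extChartAt 𝓘(ℝ, E) c (ϑinv q).1, (ϑinv q).2)

variable [IsManifold 𝓘(ℝ, E) ∞ P]

lemma contMDiffAt_chart_symm {c : P} {y : E} (hy : y ∈ (extChartAt 𝓘(ℝ, E) c).target) :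
    ContMDiffAt 𝓘(ℝ, E) 𝓘(ℝ, E) ∞ (extChartAt 𝓘(ℝ, E) c).symm y :=
  (contMDiffOn_extChartAt_symm c).contMDiffAt (extChartAt_target_mem_nhds' hy)

lemma contMDiffAt_chart {c x : P} (hx : x ∈ (extChartAt 𝓘(ℝ, E) c).source) :
    ContMDiffAt 𝓘(ℝ, E) 𝓘(ℝ, E) ∞ (extChartAt 𝓘(ℝ, E) c) x :=
  contMDiffAt_extChartAt' (by rwa [extChartAt_source] at hx)

variable (ϑ : Diffeomorph (𝓘(ℝ, E).prod 𝓘(ℝ, ℝ)) 𝓘(ℝ, F) (P × ℝ) M ∞)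

lemma contMDiffAt_flowChart {c : P} {z : E × ℝ} (hz : z.1 ∈ (extChartAt 𝓘(ℝ, E) c).target) :
    ContMDiffAt 𝓘(ℝ, E × ℝ) 𝓘(ℝ, F) ∞ (flowChart ϑ c) z := by
  have h1 : ContMDiffAt 𝓘(ℝ, E × ℝ) 𝓘(ℝ, E) ∞
      (fun z : E × ℝ ↦ (extChartAt 𝓘(ℝ, E) c).symm z.1) z :=
    (contMDiffAt_chart_symm hz).comp z contDiff_fst.contMDiff.contMDiffAt
  exact ϑ.contMDiff.contMDiffAt.comp z (h1.prodMk contDiff_snd.contMDiff.contMDiffAt)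

lemma contMDiffAt_flowCoord {c : P} {q : M}
    (hq : (ϑ.symm q).1 ∈ (extChartAt 𝓘(ℝ, E) c).source) :
    ContMDiffAt 𝓘(ℝ, F) 𝓘(ℝ, E × ℝ) ∞ (flowCoord (E := E) ϑ.symm c) q := by
  have h := ϑ.symm.contMDiff.contMDiffAt (x := q)
  have h1 := (contMDiffAt_chart hq).comp q (contMDiffAt_fst.comp q h)
  have h2 := contMDiffAt_snd.comp q h
  exact h1.prodMk_space h2

lemma flowCoord_flowChart {c : P} {z : E × ℝ} (hz : z.1 ∈ (extChartAt 𝓘(ℝ, E) c).target) :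
    flowCoord (E := E) ϑ.symm c (flowChart ϑ c z) = z := by
  refine Prod.ext ?_ (congrArg (fun p : P × ℝ ↦ p.2) (ϑ.symm_apply_apply _))
  refine (congrArg (fun p : P × ℝ ↦ extChartAt 𝓘(ℝ, E) c p.1) (ϑ.symm_apply_apply _)).trans ?_
  exact (extChartAt 𝓘(ℝ, E) c).right_inv hz

lemma flowChart_flowCoord {c : P} {q : M} (hq : (ϑ.symm q).1 ∈ (extChartAt 𝓘(ℝ, E) c).source) :
    flowChart ϑ c (flowCoord (E := E) ϑ.symm c q) = q := by
  simp only [flowCoord, flowChart, (extChartAt 𝓘(ℝ, E) c).left_inv hq]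
  exact ϑ.apply_symm_apply q

lemma eventually_flowChart {c : P} {z : E × ℝ} (hz : z.1 ∈ (extChartAt 𝓘(ℝ, E) c).target) :
    ∀ᶠ w in 𝓝 z, w.1 ∈ (extChartAt 𝓘(ℝ, E) c).target :=
  continuous_fst.continuousAt.eventually ((isOpen_extChartAt_target c).eventually_mem hz)

lemma eventually_flowCoord {c : P} {q : M} (hq : (ϑ.symm q).1 ∈ (extChartAt 𝓘(ℝ, E) c).source) :
    ∀ᶠ w in 𝓝 q, (ϑ.symm w).1 ∈ (extChartAt 𝓘(ℝ, E) c).source :=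
  (continuous_fst.comp ϑ.symm.continuous).continuousAt.eventually
    ((isOpen_extChartAt_source c).eventually_mem hq)

lemma flowChart_mem_source {c : P} {z : E × ℝ} (hz : z.1 ∈ (extChartAt 𝓘(ℝ, E) c).target) :
    (ϑ.symm (flowChart ϑ c z)).1 ∈ (extChartAt 𝓘(ℝ, E) c).source := by
  simpa [flowChart] using (extChartAt 𝓘(ℝ, E) c).map_target hz

lemma flowChart_inverse {c : P} {z : E × ℝ} (hz : z.1 ∈ (extChartAt 𝓘(ℝ, E) c).target) :
    (mfderiv 𝓘(ℝ, F) 𝓘(ℝ, E × ℝ) (flowCoord (E := E) ϑ.symm c) (flowChart ϑ c z)).IsInvertible ∧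
    (mfderiv 𝓘(ℝ, F) 𝓘(ℝ, E × ℝ) (flowCoord (E := E) ϑ.symm c) (flowChart ϑ c z)).inverse =
      mfderiv 𝓘(ℝ, E × ℝ) 𝓘(ℝ, F) (flowChart ϑ c) z :=
  mfderiv_inverse_of_local_inverse (contMDiffAt_flowChart ϑ hz)
    (contMDiffAt_flowCoord ϑ (flowChart_mem_source ϑ hz))
    ((eventually_flowChart hz).mono fun _ h ↦ flowCoord_flowChart ϑ h)
    ((eventually_flowCoord ϑ (flowChart_mem_source ϑ hz)).mono fun _ h ↦ flowChart_flowCoord ϑ h)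

lemma mfderiv_flowChart_bijective {c : P} {z : E × ℝ}
    (hz : z.1 ∈ (extChartAt 𝓘(ℝ, E) c).target) :
    Function.Bijective (mfderiv 𝓘(ℝ, E × ℝ) 𝓘(ℝ, F) (flowChart ϑ c) z) := by
  obtain ⟨⟨e, he⟩, h2⟩ := flowChart_inverse ϑ hz
  rw [← h2, ← he, ContinuousLinearMap.inverse_equiv]
  exact e.symm.bijective

lemma mfderiv_flowChart_horizontal {c : P} {y : E} (s : ℝ)
    (hy : y ∈ (extChartAt 𝓘(ℝ, E) c).target) (a : E) :
    mfderiv 𝓘(ℝ, E × ℝ) 𝓘(ℝ, F) (flowChart ϑ c) (y, s) (a, (0 : ℝ)) =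
      mfderiv 𝓘(ℝ, E) 𝓘(ℝ, F) (fun x ↦ ϑ (x, s)) ((extChartAt 𝓘(ℝ, E) c).symm y)
        (mfderiv 𝓘(ℝ, E) 𝓘(ℝ, E) (extChartAt 𝓘(ℝ, E) c).symm y a) := by
  have h1 : HasFDerivAt (fun y : E ↦ (y, s)) (ContinuousLinearMap.inl ℝ E ℝ) y :=
    (hasFDerivAt_id y).prodMk (hasFDerivAt_const s y)
  have hS : MDifferentiableAt 𝓘(ℝ, E × ℝ) 𝓘(ℝ, F) (flowChart ϑ c) (y, s) :=
    (contMDiffAt_flowChart ϑ (z := (y, s)) hy).mdifferentiableAt (by simp)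
  have h2 := HasMFDerivAt.comp (I := 𝓘(ℝ, E)) y hS.hasMFDerivAt h1.hasMFDerivAt
  have h3 : MDifferentiableAt 𝓘(ℝ, E) 𝓘(ℝ, F) (fun x ↦ ϑ (x, s))
      ((extChartAt 𝓘(ℝ, E) c).symm y) := by
    have : ContMDiffAt 𝓘(ℝ, E) 𝓘(ℝ, F) ∞ (fun x ↦ ϑ (x, s)) ((extChartAt 𝓘(ℝ, E) c).symm y) :=
      ϑ.contMDiff.contMDiffAt.comp _ (contMDiffAt_id.prodMk contMDiffAt_const)
    exact this.mdifferentiableAt (by simp)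
  have h4 := HasMFDerivAt.comp (I := 𝓘(ℝ, E)) y h3.hasMFDerivAt
    ((contMDiffAt_chart_symm hy).mdifferentiableAt (by simp)).hasMFDerivAt
  exact congrArg (fun T ↦ T a) (hasMFDerivAt_unique h2 h4)

variable [RiemannianBundle (fun p : M ↦ TangentSpace 𝓘(ℝ, F) p)]
  [RiemannianBundle (fun x : P ↦ TangentSpace 𝓘(ℝ, E) x)]
  {Y : ∀ p : M, TangentSpace 𝓘(ℝ, F) p} {ϑ}

lemma mfderiv_flowChart_vertical (h : IsFlowFromLeaf Y ϑ) {c : P} {z : E × ℝ}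
    (hz : z.1 ∈ (extChartAt 𝓘(ℝ, E) c).target) :
    mfderiv 𝓘(ℝ, E × ℝ) 𝓘(ℝ, F) (flowChart ϑ c) z ((0 : E), (1 : ℝ)) = Y (flowChart ϑ c z) := by
  have h1 : HasFDerivAt (fun s : ℝ ↦ (z.1, s)) (ContinuousLinearMap.inr ℝ E ℝ) z.2 :=
    (hasFDerivAt_const z.1 z.2).prodMk (hasFDerivAt_id z.2)
  have hS : MDifferentiableAt 𝓘(ℝ, E × ℝ) 𝓘(ℝ, F) (flowChart ϑ c) (z.1, z.2) :=
    (contMDiffAt_flowChart ϑ hz).mdifferentiableAt (by simp)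
  have h2 := HasMFDerivAt.comp (I := 𝓘(ℝ, ℝ)) z.2 hS.hasMFDerivAt h1.hasMFDerivAt
  have h3 := h.flow ((extChartAt 𝓘(ℝ, E) c).symm z.1) z.2
  have := congrArg (fun T ↦ T (1 : ℝ)) (hasMFDerivAt_unique h2 h3)
  refine Eq.trans this ?_
  exact one_smul ℝ _

/-- The Killing field has no zeros, since the flow is a diffeomorphism; so `log ‖Y‖` is not a junk
value. -/
lemma killing_ne_zero (h : IsFlowFromLeaf Y ϑ) (x : P) (s : ℝ) : Y (ϑ (x, s)) ≠ 0 := by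
  intro h0
  have hx := mem_extChartAt_target (I := 𝓘(ℝ, E)) x
  have h1 := mfderiv_flowChart_vertical h (c := x) (z := (extChartAt 𝓘(ℝ, E) x x, s)) hx
  have h2 : Y (flowChart ϑ x (extChartAt 𝓘(ℝ, E) x x, s)) = 0 := by
    rw [flowChart, extChartAt_to_inv]; exact h0
  have h3 := (mfderiv_flowChart_bijective ϑ (z := (extChartAt 𝓘(ℝ, E) x x, s)) hx).1
    (a₁ := ((0 : E), (1 : ℝ))) (a₂ := 0) ((h1.trans h2).trans (map_zero _).symm)
  exact one_ne_zero (congrArg Prod.snd h3 : (1 : ℝ) = 0)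

variable [FiniteDimensional ℝ F] [IsManifold 𝓘(ℝ, F) ∞ M]
  [IsContMDiffRiemannianBundle 𝓘(ℝ, F) ∞ F (fun p : M ↦ TangentSpace 𝓘(ℝ, F) p)]

/-- The metric coefficients in the parametrization `flowChart` do not depend on the flow
parameter. -/
lemma pullbackForm_flowChart_const [FiniteDimensional ℝ E] (hY : IsKilling Y)
    (h : IsFlowFromLeaf Y ϑ) {c : P} {y : E}
    (hy : y ∈ (extChartAt 𝓘(ℝ, E) c).target) (s : ℝ) (a b : E × ℝ) :
    pullbackForm (F := F) (flowChart ϑ c) (y, s) a b =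
      pullbackForm (F := F) (flowChart ϑ c) (y, 0) a b := by
  have key : ∀ s : ℝ, HasDerivAt
      (fun s : ℝ ↦ pullbackForm (F := F) (flowChart ϑ c) (y, s) a b) 0 s := by
    intro s
    have hz : ((y, s) : E × ℝ).1 ∈ (extChartAt 𝓘(ℝ, E) c).target := hy
    have h0 := fderiv_pullbackForm_killing hY (S := flowChart ϑ c)
      (φ := flowCoord (E := E) ϑ.symm c)
      (z₀ := (y, s)) (e := ((0 : E), (1 : ℝ)))
      ((eventually_flowChart hz).mono fun _ h ↦ contMDiffAt_flowChart ϑ h)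
      ((eventually_flowCoord ϑ (flowChart_mem_source ϑ hz)).mono
        fun _ h ↦ contMDiffAt_flowCoord ϑ h)
      ((eventually_flowChart hz).mono fun _ h ↦ flowCoord_flowChart ϑ h)
      ((eventually_flowCoord ϑ (flowChart_mem_source ϑ hz)).mono
        fun _ h ↦ flowChart_flowCoord ϑ h)
      ((eventually_flowChart hz).mono fun _ hw ↦ mfderiv_flowChart_vertical h hw) a b
    have h1 := ((contDiffAt_pullbackForm_apply (F := F) (contMDiffAt_flowChart ϑ hz) a
      b).differentiableAt (by simp)).hasFDerivAt
    have h2 : HasDerivAt (fun s : ℝ ↦ (y, s)) ((0 : E), (1 : ℝ)) s :=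
      (hasDerivAt_const s y).prodMk (hasDerivAt_id s)
    have h3 := h1.comp_hasDerivAt s h2
    rw [h0] at h3
    exact h3
  exact is_const_of_deriv_eq_zero (fun s ↦ (key s).differentiableAt) (fun s ↦ (key s).deriv) s 0

/-- The potential `ψ = -log ‖Y‖` is constant along the flow. -/
lemma potential_flow [FiniteDimensional ℝ E] (hY : IsKilling Y)
    (h : IsFlowFromLeaf Y ϑ) (x : P) (s : ℝ) :
    potential Y (ϑ (x, s)) = potential Y (ϑ (x, 0)) := by
  have hx := mem_extChartAt_target (I := 𝓘(ℝ, E)) x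
  have h1 := pullbackForm_flowChart_const hY h hx s ((0 : E), (1 : ℝ)) ((0 : E), (1 : ℝ))
  have key : ∀ s, pullbackForm (F := F) (flowChart ϑ x) (extChartAt 𝓘(ℝ, E) x x, s)
      ((0 : E), (1 : ℝ)) ((0 : E), (1 : ℝ)) = ‖Y (ϑ (x, s))‖ ^ 2 := by
    intro s
    have h3 := mfderiv_flowChart_vertical h (c := x) (z := (extChartAt 𝓘(ℝ, E) x x, s)) hx
    rw [pullbackForm_apply, h3, metric, real_inner_self_eq_norm_sq, flowChart, extChartAt_to_inv]
  rw [key, key] at h1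
  have h2 := (sq_eq_sq₀ (norm_nonneg _) (norm_nonneg _)).1 h1
  simp only [potential, h2]

/-- In the parametrization `flowChart`, the metric of `M` is the warped product
`σ + e^{-2ψ} ds ⊗ ds`. -/
lemma pullbackForm_flowChart [FiniteDimensional ℝ E] (hY : IsKilling Y)
    (h : IsFlowFromLeaf Y ϑ) {c : P} {z : E × ℝ}
    (hz : z.1 ∈ (extChartAt 𝓘(ℝ, E) c).target) (a b : E × ℝ) :
    pullbackForm (F := F) (flowChart ϑ c) z a b =
      pullbackForm (F := E) (extChartAt 𝓘(ℝ, E) c).symm z.1 a.1 b.1 +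
        Real.exp (-(2 * potential Y (ϑ ((extChartAt 𝓘(ℝ, E) c).symm z.1, 0)))) *
          (a.2 * b.2) := by
  obtain ⟨y, s⟩ := z
  obtain ⟨a, t⟩ := a
  obtain ⟨b, r⟩ := b
  change y ∈ _ at hz
  rw [pullbackForm_flowChart_const hY h hz]
  have hs : ∀ (a : E) (t : ℝ), (a, t) = (a, (0 : ℝ)) + t • ((0 : E), (1 : ℝ)) := by simp
  rw [hs a t, hs b r]
  have h1 : ∀ a b : E, pullbackForm (F := F) (flowChart ϑ c) (y, 0) (a, (0 : ℝ)) (b, (0 : ℝ)) =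
      pullbackForm (F := E) (extChartAt 𝓘(ℝ, E) c).symm y a b := by
    intro a b
    refine Eq.trans ?_ (h.isometric ((extChartAt 𝓘(ℝ, E) c).symm y) _ _)
    rw [pullbackForm_apply]
    exact congrArg₂ (fun v w ↦ metric (E := F) (ϑ ((extChartAt 𝓘(ℝ, E) c).symm y, 0)) v w)
      (mfderiv_flowChart_horizontal ϑ 0 hz a) (mfderiv_flowChart_horizontal ϑ 0 hz b)
  have h2 : ∀ a : E, pullbackForm (F := F) (flowChart ϑ c) (y, 0) (a, (0 : ℝ))
      ((0 : E), (1 : ℝ)) = 0 := by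
    intro a
    refine Eq.trans ?_ (h.orthogonal ((extChartAt 𝓘(ℝ, E) c).symm y)
      (mfderiv 𝓘(ℝ, E) 𝓘(ℝ, E) (extChartAt 𝓘(ℝ, E) c).symm y a))
    rw [pullbackForm_apply]
    exact congrArg₂ (fun v w ↦ metric (E := F) (ϑ ((extChartAt 𝓘(ℝ, E) c).symm y, 0)) v w)
      (mfderiv_flowChart_horizontal ϑ 0 hz a) (mfderiv_flowChart_vertical h (z := (y, 0)) hz)
  have h3 : pullbackForm (F := F) (flowChart ϑ c) (y, 0) ((0 : E), (1 : ℝ)) ((0 : E), (1 : ℝ)) =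
      Real.exp (-(2 * potential Y (ϑ ((extChartAt 𝓘(ℝ, E) c).symm y, 0)))) := by
    rw [pullbackForm_apply, mfderiv_flowChart_vertical h (z := (y, 0)) hz, metric,
      real_inner_self_eq_norm_sq, potential]
    have := norm_pos_iff.2 (killing_ne_zero h ((extChartAt 𝓘(ℝ, E) c).symm y) 0)
    rw [mul_neg, neg_neg, two_mul, Real.exp_add, Real.exp_log this, sq]
    rfl
  have h2' : ∀ a : E, pullbackForm (F := F) (flowChart ϑ c) (y, 0) ((0 : E), (1 : ℝ))
      (a, (0 : ℝ)) = 0 := fun a ↦ by rw [pullbackForm_comm, h2]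
  simp only [map_add, map_smul, _root_.add_apply, _root_.smul_apply, h1, h2, h2', h3, smul_eq_mul,
    Prod.fst_add, Prod.snd_add, Prod.smul_fst, Prod.smul_snd, smul_zero, add_zero, mul_one,
    zero_add, mul_zero]
  ring

end Warped

/-! ### The projection onto the leaf -/

section Contraction

variable {E : Type*} [NormedAddCommGroup E] [InnerProductSpace ℝ E]
  {F : Type*} [NormedAddCommGroup F] [InnerProductSpace ℝ F]
  {P : Type*}
  {M : Type*}

/-- A map whose differentials do not increase norms does not increase the lengths of curves. -/
lemma pathELength_comp_le [TopologicalSpace P] [TopologicalSpace M] [ChartedSpace E P]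
    [ChartedSpace F M] [RiemannianBundle (fun p : M ↦ TangentSpace 𝓘(ℝ, F) p)]
    [RiemannianBundle (fun x : P ↦ TangentSpace 𝓘(ℝ, E) x)] {f : M → P}
    (hf : MDifferentiable 𝓘(ℝ, F) 𝓘(ℝ, E) f)
    (hle : ∀ q (v : TangentSpace 𝓘(ℝ, F) q), ‖mfderiv 𝓘(ℝ, F) 𝓘(ℝ, E) f q v‖ ≤ ‖v‖) {γ : ℝ → M}
    {a b : ℝ} (hγ : ContMDiffOn 𝓘(ℝ, ℝ) 𝓘(ℝ, F) 1 γ (Icc a b)) :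
    pathELength 𝓘(ℝ, E) (f ∘ γ) a b ≤ pathELength 𝓘(ℝ, F) γ a b := by
  rw [pathELength_eq_lintegral_mfderiv_Ioo, pathELength_eq_lintegral_mfderiv_Ioo]
  refine setLIntegral_mono_ae' measurableSet_Ioo (Eventually.of_forall fun t ht ↦ ?_)
  have hγt : MDifferentiableAt 𝓘(ℝ, ℝ) 𝓘(ℝ, F) γ t :=
    (hγ.contMDiffAt (Icc_mem_nhds ht.1 ht.2)).mdifferentiableAt one_ne_zero
  rw [mfderiv_comp t (hf _) hγt]
  have := hle (γ t) (mfderiv 𝓘(ℝ, ℝ) 𝓘(ℝ, F) γ t 1)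
  rw [← enorm_le_iff_norm_le] at this
  exact this

lemma edist_le_of_norm_mfderiv_le [EMetricSpace P] [EMetricSpace M] [ChartedSpace E P]
    [ChartedSpace F M] [RiemannianBundle (fun p : M ↦ TangentSpace 𝓘(ℝ, F) p)]
    [RiemannianBundle (fun x : P ↦ TangentSpace 𝓘(ℝ, E) x)]
    [IsRiemannianManifold 𝓘(ℝ, F) M] [IsRiemannianManifold 𝓘(ℝ, E) P] {f : M → P}
    (hf : ContMDiff 𝓘(ℝ, F) 𝓘(ℝ, E) 1 f)
    (hle : ∀ q (v : TangentSpace 𝓘(ℝ, F) q), ‖mfderiv 𝓘(ℝ, F) 𝓘(ℝ, E) f q v‖ ≤ ‖v‖) (p q : M) :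
    edist (f p) (f q) ≤ edist p q := by
  rw [IsRiemannianManifold.out (I := 𝓘(ℝ, E)) (f p) (f q),
    IsRiemannianManifold.out (I := 𝓘(ℝ, F)) p q]
  refine le_of_forall_gt fun r hr ↦ ?_
  obtain ⟨γ, h0, h1, hγ, hlen⟩ := exists_lt_of_riemannianEDist_lt hr
  refine lt_of_le_of_lt ?_ hlen
  refine le_trans ?_ (pathELength_comp_le (hf.mdifferentiable one_ne_zero) hle hγ)
  exact riemannianEDist_le_pathELength (hf.comp_contMDiffOn hγ) (by simp [h0]) (by simp [h1])
    zero_le_one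

end Contraction

section Base

variable {V : Type*} [NormedAddCommGroup V] [NormedSpace ℝ V] [FiniteDimensional ℝ V]
  {E : Type*} [NormedAddCommGroup E] [InnerProductSpace ℝ E] [FiniteDimensional ℝ E]
  {P : Type*} [TopologicalSpace P] [ChartedSpace E P] [IsManifold 𝓘(ℝ, E) ∞ P]
  [RiemannianBundle (fun x : P ↦ TangentSpace 𝓘(ℝ, E) x)]
  [IsContMDiffRiemannianBundle 𝓘(ℝ, E) ∞ E (fun x : P ↦ TangentSpace 𝓘(ℝ, E) x)]

lemma contDiffAt_pullbackForm {S : V → P} {s : Set V} (hs : IsOpen s)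
    (hS : ∀ z ∈ s, ContMDiffAt 𝓘(ℝ, V) 𝓘(ℝ, E) ∞ S z) {z : V} (hz : z ∈ s) :
    ContDiffAt ℝ ∞ (pullbackForm (F := E) S) z := by
  have : ContDiffOn ℝ ∞ (pullbackForm (F := E) S) s := by
    rw [contDiffOn_clm_apply]
    intro a
    rw [contDiffOn_clm_apply]
    intro b w hw
    exact (contDiffAt_pullbackForm_apply (hS w hw) a b).contDiffWithinAt
  exact this.contDiffAt (hs.mem_nhds hz)

/-- The metric of `P` in the chart centred at `c`. -/
abbrev chartForm (c : P) : E → E →L[ℝ] E →L[ℝ] ℝ :=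
  pullbackForm (F := E) (extChartAt 𝓘(ℝ, E) c).symm

lemma contDiffAt_chartForm {c : P} {y : E} (hy : y ∈ (extChartAt 𝓘(ℝ, E) c).target) :
    ContDiffAt ℝ ∞ (chartForm c) y :=
  contDiffAt_pullbackForm (isOpen_extChartAt_target c) (fun _ h ↦ contMDiffAt_chart_symm h) hy

lemma chart_inverse {c : P} {y : E} (hy : y ∈ (extChartAt 𝓘(ℝ, E) c).target) :
    (mfderiv 𝓘(ℝ, E) 𝓘(ℝ, E) (extChartAt 𝓘(ℝ, E) c)
      ((extChartAt 𝓘(ℝ, E) c).symm y)).IsInvertible ∧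
    (mfderiv 𝓘(ℝ, E) 𝓘(ℝ, E) (extChartAt 𝓘(ℝ, E) c)
      ((extChartAt 𝓘(ℝ, E) c).symm y)).inverse =
      mfderiv 𝓘(ℝ, E) 𝓘(ℝ, E) (extChartAt 𝓘(ℝ, E) c).symm y := by
  have hm := (extChartAt 𝓘(ℝ, E) c).map_target hy
  refine mfderiv_inverse_of_local_inverse (contMDiffAt_chart_symm hy)
    (contMDiffAt_chart hm) ?_ ?_
  · exact ((isOpen_extChartAt_target c).eventually_mem hy).mono
      fun _ h ↦ (extChartAt 𝓘(ℝ, E) c).right_inv h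
  · exact ((isOpen_extChartAt_source c).eventually_mem hm).mono
      fun _ h ↦ (extChartAt 𝓘(ℝ, E) c).left_inv h

lemma mfderiv_chart_symm_bijective {c : P} {y : E} (hy : y ∈ (extChartAt 𝓘(ℝ, E) c).target) :
    Function.Bijective (mfderiv 𝓘(ℝ, E) 𝓘(ℝ, E) (extChartAt 𝓘(ℝ, E) c).symm y) := by
  obtain ⟨⟨e, he⟩, h2⟩ := chart_inverse hy
  rw [← h2, ← he, ContinuousLinearMap.inverse_equiv]
  exact e.symm.bijective

lemma chartForm_self (c : P) (y a : E) : chartForm c y a a =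
    ‖mfderiv 𝓘(ℝ, E) 𝓘(ℝ, E) (extChartAt 𝓘(ℝ, E) c).symm y a‖ ^ 2 := by
  rw [pullbackForm_apply, metric, real_inner_self_eq_norm_sq]

lemma chartForm_nonneg (c : P) (y a : E) : 0 ≤ chartForm c y a a := by
  rw [chartForm_self]; positivity

lemma chartForm_pos {c : P} {y : E} (hy : y ∈ (extChartAt 𝓘(ℝ, E) c).target) (a : E)
    (ha : a ≠ 0) : 0 < chartForm c y a a := by
  rw [chartForm_self]
  have : mfderiv 𝓘(ℝ, E) 𝓘(ℝ, E) (extChartAt 𝓘(ℝ, E) c).symm y a ≠ 0 := fun h ↦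
    ha ((mfderiv_chart_symm_bijective hy).1 (h.trans (map_zero _).symm))
  have := norm_pos_iff.2 this
  positivity

end Base

section Flow

variable {E : Type*} [NormedAddCommGroup E] [InnerProductSpace ℝ E] [FiniteDimensional ℝ E]
  {F : Type*} [NormedAddCommGroup F] [InnerProductSpace ℝ F] [FiniteDimensional ℝ F]
  {P : Type*} [TopologicalSpace P] [ChartedSpace E P] [IsManifold 𝓘(ℝ, E) ∞ P]
  {M : Type*} [TopologicalSpace M] [ChartedSpace F M] [IsManifold 𝓘(ℝ, F) ∞ M]
  [RiemannianBundle (fun p : M ↦ TangentSpace 𝓘(ℝ, F) p)]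
  [RiemannianBundle (fun x : P ↦ TangentSpace 𝓘(ℝ, E) x)]
  [IsContMDiffRiemannianBundle 𝓘(ℝ, F) ∞ F (fun p : M ↦ TangentSpace 𝓘(ℝ, F) p)]
  {Y : ∀ p : M, TangentSpace 𝓘(ℝ, F) p}
  {ϑ : Diffeomorph (𝓘(ℝ, E).prod 𝓘(ℝ, ℝ)) 𝓘(ℝ, F) (P × ℝ) M ∞}

/-- The potential `ψ` in the chart of `P` centred at `c`. -/
abbrev chartPotential (Y : ∀ p : M, TangentSpace 𝓘(ℝ, F) p) (ϑ : P × ℝ → M) (c : P) (y : E) : ℝ :=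
  potential Y (ϑ ((extChartAt 𝓘(ℝ, E) c).symm y, 0))

lemma exp_neg_two_potential (h : IsFlowFromLeaf Y ϑ) {c : P} {y : E}
    (hy : y ∈ (extChartAt 𝓘(ℝ, E) c).target) :
    Real.exp (-(2 * chartPotential Y ϑ c y)) = pullbackForm (F := F) (flowChart ϑ c) (y, 0)
      ((0 : E), (1 : ℝ)) ((0 : E), (1 : ℝ)) := by
  rw [pullbackForm_apply, mfderiv_flowChart_vertical h (z := (y, 0)) hy, metric,
    real_inner_self_eq_norm_sq, chartPotential, potential]
  have := norm_pos_iff.2 (killing_ne_zero h ((extChartAt 𝓘(ℝ, E) c).symm y) 0)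
  rw [mul_neg, neg_neg, two_mul, Real.exp_add, Real.exp_log this, sq]
  rfl

lemma contDiffAt_chartPotential (h : IsFlowFromLeaf Y ϑ) {c : P} {y : E}
    (hy : y ∈ (extChartAt 𝓘(ℝ, E) c).target) : ContDiffAt ℝ ∞ (chartPotential Y ϑ c) y := by
  have h1 : ContDiffAt ℝ ∞ (fun y : E ↦ pullbackForm (F := F) (flowChart ϑ c) (y, 0)
      ((0 : E), (1 : ℝ)) ((0 : E), (1 : ℝ))) y :=
    (contDiffAt_pullbackForm_apply (contMDiffAt_flowChart ϑ (z := (y, 0)) hy) _ _).comp y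
      (contDiffAt_id.prodMk contDiffAt_const)
  have h2 : (fun y : E ↦ pullbackForm (F := F) (flowChart ϑ c) (y, 0)
      ((0 : E), (1 : ℝ)) ((0 : E), (1 : ℝ))) =ᶠ[𝓝 y]
      fun y ↦ Real.exp (-(2 * chartPotential Y ϑ c y)) := by
    filter_upwards [(isOpen_extChartAt_target c).eventually_mem hy] with z hz
    exact (exp_neg_two_potential h hz).symm
  have h3 := ((h1.congr_of_eventuallyEq h2.symm).log (Real.exp_pos _).ne').neg.div_const 2
  refine h3.congr_of_eventuallyEq (Eventually.of_forall fun z ↦ ?_)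
  simp

lemma contMDiff_proj : ContMDiff 𝓘(ℝ, F) 𝓘(ℝ, E) ∞ (fun q ↦ (ϑ.symm q).1) :=
  contMDiff_fst.comp ϑ.symm.contMDiff

/-- The projection of the warped product onto its base does not increase the lengths of tangent
vectors. -/
lemma norm_mfderiv_proj_le (hY : IsKilling Y) (h : IsFlowFromLeaf Y ϑ) (q : M)
    (v : TangentSpace 𝓘(ℝ, F) q) :
    ‖mfderiv 𝓘(ℝ, F) 𝓘(ℝ, E) (fun q ↦ (ϑ.symm q).1) q v‖ ≤ ‖v‖ := by
  obtain ⟨z, c, hz, rfl⟩ : ∃ (z : E × ℝ) (c : P), z.1 ∈ (extChartAt 𝓘(ℝ, E) c).target ∧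
      flowChart ϑ c z = q :=
    ⟨flowCoord (E := E) ϑ.symm (ϑ.symm q).1 q, (ϑ.symm q).1, mem_extChartAt_target _,
      flowChart_flowCoord ϑ (mem_extChartAt_source _)⟩
  obtain ⟨w, rfl⟩ : ∃ w : E × ℝ, mfderiv 𝓘(ℝ, E × ℝ) 𝓘(ℝ, F) (flowChart ϑ c) z w = v :=
    (mfderiv_flowChart_bijective ϑ hz).2 v
  have hS : MDifferentiableAt 𝓘(ℝ, E × ℝ) 𝓘(ℝ, F) (flowChart ϑ c) z :=
    (contMDiffAt_flowChart ϑ hz).mdifferentiableAt (by simp)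
  have hπ : MDifferentiableAt 𝓘(ℝ, F) 𝓘(ℝ, E) (fun q ↦ (ϑ.symm q).1) (flowChart ϑ c z) :=
    (contMDiff_proj (ϑ := ϑ)).contMDiffAt.mdifferentiableAt (by simp)
  have hcomp : (fun q ↦ (ϑ.symm q).1) ∘ flowChart (E := E) ϑ c =
      (extChartAt 𝓘(ℝ, E) c).symm ∘ Prod.fst := by
    funext w
    exact congrArg (fun p : P × ℝ ↦ p.1) (ϑ.symm_apply_apply _)
  have h1 := HasMFDerivAt.comp (I := 𝓘(ℝ, E × ℝ)) z hπ.hasMFDerivAt hS.hasMFDerivAt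
  have h2 := HasMFDerivAt.comp (I := 𝓘(ℝ, E × ℝ)) z
    ((contMDiffAt_chart_symm hz).mdifferentiableAt (by simp)).hasMFDerivAt
    (hasFDerivAt_fst (𝕜 := ℝ) (p := z)).hasMFDerivAt
  rw [hcomp] at h1
  have h3 := congrArg (fun T ↦ T w) (hasMFDerivAt_unique h1 h2)
  have key : ∀ (p p' : P) (A A' : E), p = p' → A = A' →
      metric (E := E) p A A = metric (E := E) p' A' A' := by rintro p _ A _ rfl rfl; rfl
  have h4 := key _ _ _ _ (congrFun hcomp z) h3
  have h5 := pullbackForm_flowChart hY h hz w w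
  have h6 : ‖mfderiv 𝓘(ℝ, E × ℝ) 𝓘(ℝ, F) (flowChart ϑ c) z w‖ ^ 2 =
      pullbackForm (F := F) (flowChart ϑ c) z w w :=
    (real_inner_self_eq_norm_sq _).symm
  refine (sq_le_sq₀ (norm_nonneg _) (norm_nonneg _)).1 ?_
  rw [← real_inner_self_eq_norm_sq]
  refine (le_of_eq (b := pullbackForm (F := E) (extChartAt 𝓘(ℝ, E) c).symm z.1 w.1 w.1) h4).trans ?_
  rw [h6, h5]
  have := mul_self_nonneg w.2
  have := (Real.exp_pos (-(2 * potential Y (ϑ ((extChartAt 𝓘(ℝ, E) c).symm z.1, 0))))).le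
  nlinarith [mul_nonneg this (mul_self_nonneg w.2)]
end Flow

section Projection
variable {E : Type*} [NormedAddCommGroup E] [InnerProductSpace ℝ E] [FiniteDimensional ℝ E]
  {F : Type*} [NormedAddCommGroup F] [InnerProductSpace ℝ F] [FiniteDimensional ℝ F]
  {P : Type*} [EMetricSpace P] [ChartedSpace E P] [IsManifold 𝓘(ℝ, E) ∞ P]
  {M : Type*} [EMetricSpace M] [ChartedSpace F M] [IsManifold 𝓘(ℝ, F) ∞ M]
  [RiemannianBundle (fun p : M ↦ TangentSpace 𝓘(ℝ, F) p)]
  [RiemannianBundle (fun x : P ↦ TangentSpace 𝓘(ℝ, E) x)]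
  [IsContMDiffRiemannianBundle 𝓘(ℝ, F) ∞ F (fun p : M ↦ TangentSpace 𝓘(ℝ, F) p)]
  [IsRiemannianManifold 𝓘(ℝ, F) M] [IsRiemannianManifold 𝓘(ℝ, E) P]
  {Y : ∀ p : M, TangentSpace 𝓘(ℝ, F) p}
  {ϑ : Diffeomorph (𝓘(ℝ, E).prod 𝓘(ℝ, ℝ)) 𝓘(ℝ, F) (P × ℝ) M ∞}

/-- Projecting a curve in the graph to `P` does not increase its length. -/
theorem image_intrinsicBall_subset (hY : IsKilling Y) (h : IsFlowFromLeaf Y ϑ) (Ω : Set P)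
    (u : P → ℝ) (x₀ : P) (R : ℝ) :
    (fun y : M ↦ (ϑ.symm y).1) '' intrinsicBall (F := F) (graphMap ϑ u '' Ω) (graphMap ϑ u x₀) R
      ⊆ Metric.eball x₀ (ENNReal.ofReal R) ∩ Ω := by
  rintro _ ⟨q, ⟨⟨x, hx, rfl⟩, hq⟩, rfl⟩
  have hπ : ∀ x, (ϑ.symm (graphMap ϑ u x)).1 = x := fun x ↦
    congrArg (fun p : P × ℝ ↦ p.1) (ϑ.symm_apply_apply (x, u x))
  simp only [hπ]
  refine ⟨?_, hx⟩
  rw [Metric.mem_eball, edist_comm, IsRiemannianManifold.out (I := 𝓘(ℝ, E)) x₀ x]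
  simp only [intrinsicEDist, iInf_lt_iff] at hq
  obtain ⟨γ, hγ, -, h0, h1, hlen⟩ := hq
  refine lt_of_le_of_lt ?_ hlen
  refine le_trans ?_ (pathELength_comp_le
    ((contMDiff_proj (ϑ := ϑ)).mdifferentiable (by simp)) (norm_mfderiv_proj_le hY h) hγ)
  exact riemannianEDist_le_pathELength
    (((contMDiff_proj (ϑ := ϑ)).of_le (by simp)).comp_contMDiffOn hγ)
    (by simp [h0]) (by simp [h1]) zero_le_one

lemma edist_flow_zero_le (h : IsFlowFromLeaf Y ϑ) (x x' : P) :
    edist (ϑ (x, 0)) (ϑ (x', 0)) ≤ edist x x' := by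
  refine edist_le_of_norm_mfderiv_le (f := fun x ↦ ϑ (x, 0))
    ((ϑ.contMDiff.comp (contMDiff_id.prodMk contMDiff_const)).of_le (by simp)) (fun x v ↦ ?_) x x'
  refine (sq_le_sq₀ (norm_nonneg _) (norm_nonneg _)).1 (le_of_eq ?_)
  rw [← real_inner_self_eq_norm_sq, ← real_inner_self_eq_norm_sq]
  exact h.isometric x v v

/-- The leaf `P` is complete: the embedding `x ↦ ϑ (x, 0)` is `1`-Lipschitz, so it maps a Cauchy
sequence of `P` to one of `M`, and the projection maps its limit back to `P`. -/
lemma completeSpace_leaf [CompleteSpace M] (h : IsFlowFromLeaf Y ϑ) : CompleteSpace P := by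
  refine UniformSpace.complete_of_cauchySeq_tendsto fun a ha ↦ ?_
  have hl : LipschitzWith 1 (fun x : P ↦ ϑ (x, 0)) := fun x x' ↦ by
    simpa using edist_flow_zero_le h x x'
  obtain ⟨q, hq⟩ := cauchySeq_tendsto_of_complete (hl.uniformContinuous.comp_cauchySeq ha)
  refine ⟨(ϑ.symm q).1, ?_⟩
  have := ((contMDiff_proj (ϑ := ϑ)).continuous.tendsto q).comp hq
  refine this.congr fun n ↦ ?_
  exact congrArg (fun p : P × ℝ ↦ p.1) (ϑ.symm_apply_apply (a n, 0))
end Projection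

/-! ### Gradients and the normal in a chart -/

section Gradient

variable {E : Type*} [NormedAddCommGroup E] [InnerProductSpace ℝ E] [FiniteDimensional ℝ E]
  {P : Type*} [TopologicalSpace P] [ChartedSpace E P]
  [RiemannianBundle (fun x : P ↦ TangentSpace 𝓘(ℝ, E) x)]

lemma inner_grad (u : P → ℝ) (x : P) (v : TangentSpace 𝓘(ℝ, E) x) :
    inner ℝ (grad u x) v = mfderiv 𝓘(ℝ, E) 𝓘(ℝ, ℝ) u x v := by
  have : FiniteDimensional ℝ (TangentSpace 𝓘(ℝ, E) x) :=
    inferInstanceAs (FiniteDimensional ℝ E)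
  have : CompleteSpace (TangentSpace 𝓘(ℝ, E) x) := FiniteDimensional.complete ℝ _
  exact InnerProductSpace.toDual_symm_apply (𝕜 := ℝ) (E := TangentSpace 𝓘(ℝ, E) x)

variable [IsManifold 𝓘(ℝ, E) ∞ P]
  [IsContMDiffRiemannianBundle 𝓘(ℝ, E) ∞ E (fun x : P ↦ TangentSpace 𝓘(ℝ, E) x)]
  {c : P} {y : E} {u : P → ℝ}

/-- A function on `P` in the chart centred at `c`. -/
abbrev inChart (c : P) (u : P → ℝ) (y : E) : ℝ := u ((extChartAt 𝓘(ℝ, E) c).symm y)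

lemma fderiv_inChart (hy : y ∈ (extChartAt 𝓘(ℝ, E) c).target)
    (hu : MDifferentiableAt 𝓘(ℝ, E) 𝓘(ℝ, ℝ) u ((extChartAt 𝓘(ℝ, E) c).symm y)) (a : E) :
    fderiv ℝ (inChart c u) y a = mfderiv 𝓘(ℝ, E) 𝓘(ℝ, ℝ) u ((extChartAt 𝓘(ℝ, E) c).symm y)
      (mfderiv 𝓘(ℝ, E) 𝓘(ℝ, E) (extChartAt 𝓘(ℝ, E) c).symm y a) := by
  have h1 := HasMFDerivAt.comp (I := 𝓘(ℝ, E)) y hu.hasMFDerivAt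
    ((contMDiffAt_chart_symm hy).mdifferentiableAt (by simp)).hasMFDerivAt
  have h2 : fderiv ℝ (inChart c u) y =
      (mfderiv 𝓘(ℝ, E) 𝓘(ℝ, ℝ) u ((extChartAt 𝓘(ℝ, E) c).symm y) : E →L[ℝ] ℝ).comp
        (mfderiv 𝓘(ℝ, E) 𝓘(ℝ, E) (extChartAt 𝓘(ℝ, E) c).symm y : E →L[ℝ] E) :=
    HasFDerivAt.fderiv h1.hasFDerivAt
  exact congrArg (fun T : E →L[ℝ] ℝ ↦ T a) h2

lemma grad_eq_gradVec (hy : y ∈ (extChartAt 𝓘(ℝ, E) c).target)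
    (hu : MDifferentiableAt 𝓘(ℝ, E) 𝓘(ℝ, ℝ) u ((extChartAt 𝓘(ℝ, E) c).symm y)) :
    grad u ((extChartAt 𝓘(ℝ, E) c).symm y) =
      mfderiv 𝓘(ℝ, E) 𝓘(ℝ, E) (extChartAt 𝓘(ℝ, E) c).symm y
        (gradVec (E := E) (chartForm c) (inChart c u) y) := by
  refine ext_inner_right ℝ fun w ↦ ?_
  obtain ⟨b, rfl⟩ : ∃ b : E, mfderiv 𝓘(ℝ, E) 𝓘(ℝ, E) (extChartAt 𝓘(ℝ, E) c).symm y b = w :=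
    (mfderiv_chart_symm_bijective hy).2 w
  have h1 : chartForm c y (gradVec (E := E) (chartForm c) (inChart c u) y) =
      fderiv ℝ (inChart c u) y :=
    (isInvertible_of_pos (chartForm_pos hy)).self_apply_inverse _
  refine (inner_grad u _ _).trans ((fderiv_inChart hy hu b).symm.trans ?_)
  exact (congrArg (fun T : E →L[ℝ] ℝ ↦ T b) h1).symm

lemma norm_grad_sq (hy : y ∈ (extChartAt 𝓘(ℝ, E) c).target)
    (hu : MDifferentiableAt 𝓘(ℝ, E) 𝓘(ℝ, ℝ) u ((extChartAt 𝓘(ℝ, E) c).symm y)) :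
    ‖grad (E := E) u ((extChartAt 𝓘(ℝ, E) c).symm y)‖ ^ 2 =
      fderiv ℝ (inChart c u) y (gradVec (E := E) (chartForm c) (inChart c u) y) := by
  rw [← real_inner_self_eq_norm_sq]
  refine (inner_grad u _ _).trans ?_
  rw [fderiv_inChart hy hu, grad_eq_gradVec hy hu]

lemma contDiffAt_inChart {n : WithTop ℕ∞} (hn : n ≤ ((⊤ : ℕ∞) : WithTop ℕ∞))
    (hy : y ∈ (extChartAt 𝓘(ℝ, E) c).target)
    (hu : ContMDiffAt 𝓘(ℝ, E) 𝓘(ℝ, ℝ) n u ((extChartAt 𝓘(ℝ, E) c).symm y)) :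
    ContDiffAt ℝ n (inChart c u) y :=
  (hu.comp y ((contMDiffAt_chart_symm hy).of_le hn)).contDiffAt

end Gradient

section Normal

variable {E : Type*} [NormedAddCommGroup E] [InnerProductSpace ℝ E] [FiniteDimensional ℝ E]
  {F : Type*} [NormedAddCommGroup F] [InnerProductSpace ℝ F] [FiniteDimensional ℝ F]
  {P : Type*} [TopologicalSpace P] [ChartedSpace E P] [IsManifold 𝓘(ℝ, E) ∞ P]
  {M : Type*} [TopologicalSpace M] [ChartedSpace F M] [IsManifold 𝓘(ℝ, F) ∞ M]
  [RiemannianBundle (fun p : M ↦ TangentSpace 𝓘(ℝ, F) p)]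
  [RiemannianBundle (fun x : P ↦ TangentSpace 𝓘(ℝ, E) x)]
  [IsContMDiffRiemannianBundle 𝓘(ℝ, F) ∞ F (fun p : M ↦ TangentSpace 𝓘(ℝ, F) p)]
  [IsContMDiffRiemannianBundle 𝓘(ℝ, E) ∞ E (fun x : P ↦ TangentSpace 𝓘(ℝ, E) x)]
  {Y : ∀ p : M, TangentSpace 𝓘(ℝ, F) p}
  {ϑ : Diffeomorph (𝓘(ℝ, E).prod 𝓘(ℝ, ℝ)) 𝓘(ℝ, F) (P × ℝ) M ∞}
  {c : P} {y : E} {u : P → ℝ}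

lemma slope_inChart (hy : y ∈ (extChartAt 𝓘(ℝ, E) c).target)
    (hu : MDifferentiableAt 𝓘(ℝ, E) 𝓘(ℝ, ℝ) u ((extChartAt 𝓘(ℝ, E) c).symm y)) :
    √(Real.exp (2 * potential Y (ϑ ((extChartAt 𝓘(ℝ, E) c).symm y, 0))) +
      ‖grad (E := E) u ((extChartAt 𝓘(ℝ, E) c).symm y)‖ ^ 2) =
      slope (chartForm c) (chartPotential Y ϑ c) (inChart c u) y := by
  rw [norm_grad_sq hy hu, slope]

/-- The upward unit normal in the parametrization `flowChart`. -/
lemma upwardNormal_eq (h : IsFlowFromLeaf Y ϑ) (hy : y ∈ (extChartAt 𝓘(ℝ, E) c).target)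
    (hu : MDifferentiableAt 𝓘(ℝ, E) 𝓘(ℝ, ℝ) u ((extChartAt 𝓘(ℝ, E) c).symm y)) :
    upwardNormal (E := E) Y ϑ u ((extChartAt 𝓘(ℝ, E) c).symm y) =
      mfderiv 𝓘(ℝ, E × ℝ) 𝓘(ℝ, F) (flowChart ϑ c) (graphPair (inChart c u) y)
        (warpedNormal (chartForm c) (chartPotential Y ϑ c) (inChart c u) y) := by
  set g := gradVec (chartForm c) (inChart c u) y with hg
  set W := slope (chartForm c) (chartPotential Y ϑ c) (inChart c u) y with hW
  set A : E × ℝ →L[ℝ] F := mfderiv 𝓘(ℝ, E × ℝ) 𝓘(ℝ, F) (flowChart ϑ c)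
    (graphPair (inChart c u) y) with hA
  have h1 : A (g, (0 : ℝ)) = _ := mfderiv_flowChart_horizontal ϑ (inChart c u y) hy g
  have h2 : A ((0 : E), (1 : ℝ)) = _ :=
    mfderiv_flowChart_vertical h (z := graphPair (inChart c u) y) hy
  have h3 : warpedNormal (chartForm c) (chartPotential Y ϑ c) (inChart c u) y =
      W⁻¹ • (Real.exp (2 * chartPotential Y ϑ c y) • ((0 : E), (1 : ℝ)) - (g, (0 : ℝ))) := by
    simp [warpedNormal, hg, hW]
  have h4 : A (warpedNormal (chartForm c) (chartPotential Y ϑ c) (inChart c u) y) =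
      W⁻¹ • (Real.exp (2 * chartPotential Y ϑ c y) • A ((0 : E), (1 : ℝ)) - A (g, (0 : ℝ))) := by
    rw [h3, map_smul, map_sub, map_smul]
  rw [h1, h2] at h4
  rw [upwardNormal, slope_inChart hy hu, grad_eq_gradVec hy hu]
  exact h4.symm

lemma potential_eq_comp (hY : IsKilling Y) (h : IsFlowFromLeaf Y ϑ) (q : M) :
    potential Y q = potential Y (ϑ ((ϑ.symm q).1, 0)) := by
  rw [← potential_flow hY h (ϑ.symm q).1 (ϑ.symm q).2]
  exact congrArg _ (ϑ.apply_symm_apply q).symm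

lemma mdifferentiableAt_potential (hY : IsKilling Y) (h : IsFlowFromLeaf Y ϑ) (q : M) :
    MDifferentiableAt 𝓘(ℝ, F) 𝓘(ℝ, ℝ) (potential Y) q := by
  have h1 : ContMDiffAt 𝓘(ℝ, F) 𝓘(ℝ, E × ℝ) ∞ (flowCoord (E := E) ϑ.symm (ϑ.symm q).1) q :=
    contMDiffAt_flowCoord ϑ (mem_extChartAt_source _)
  have h2 : ContDiffAt ℝ ∞ (fun z : E × ℝ ↦ chartPotential Y ϑ (ϑ.symm q).1 z.1)
      (flowCoord (E := E) ϑ.symm (ϑ.symm q).1 q) :=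
    (contDiffAt_chartPotential h (y := (flowCoord (E := E) ϑ.symm (ϑ.symm q).1 q).1)
      (mem_extChartAt_target _)).comp _ contDiffAt_fst
  have h3 := (h2.contMDiffAt.comp q h1).mdifferentiableAt (by simp)
  refine h3.congr_of_eventuallyEq ?_
  filter_upwards [eventually_flowCoord ϑ (q := q) (mem_extChartAt_source (I := 𝓘(ℝ, E)) _)]
    with w hw
  rw [potential_eq_comp hY h]
  simp only [Function.comp, chartPotential, flowCoord]
  rw [(extChartAt 𝓘(ℝ, E) (ϑ.symm q).1).left_inv hw]

/-- The weight term of the weighted mean curvature. As `ψ` does not depend on the flow parameter,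
only the horizontal part `-∇u / W` of the normal contributes. -/
lemma metric_grad_potential (hY : IsKilling Y) (h : IsFlowFromLeaf Y ϑ) (D : ℝ)
    (hy : y ∈ (extChartAt 𝓘(ℝ, E) c).target)
    (hu : MDifferentiableAt 𝓘(ℝ, E) 𝓘(ℝ, ℝ) u ((extChartAt 𝓘(ℝ, E) c).symm y)) :
    metric (E := F) (graphMap ϑ u ((extChartAt 𝓘(ℝ, E) c).symm y))
      (grad (fun p ↦ D * potential Y p) (graphMap ϑ u ((extChartAt 𝓘(ℝ, E) c).symm y)))
      (upwardNormal (E := E) Y ϑ u ((extChartAt 𝓘(ℝ, E) c).symm y)) =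
    -(D * fderiv ℝ (chartPotential Y ϑ c) y (gradVec (E := E) (chartForm c) (inChart c u) y) /
      slope (chartForm c) (chartPotential Y ϑ c) (inChart c u) y) := by
  have hz : (graphPair (inChart c u) y).1 ∈ (extChartAt 𝓘(ℝ, E) c).target := hy
  refine (inner_grad _ _ _).trans ?_
  rw [upwardNormal_eq h hy hu]
  set ν := warpedNormal (chartForm c) (chartPotential Y ϑ c) (inChart c u) y with hν
  have hψ := (mdifferentiableAt_potential hY h (flowChart ϑ c (graphPair (inChart c u) y)))
  have hψ' : MDifferentiableAt 𝓘(ℝ, F) 𝓘(ℝ, ℝ) (fun p ↦ D * potential Y p)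
      (flowChart ϑ c (graphPair (inChart c u) y)) := (mdifferentiableAt_const (c := D)).mul hψ
  have hS : MDifferentiableAt 𝓘(ℝ, E × ℝ) 𝓘(ℝ, F) (flowChart ϑ c) (graphPair (inChart c u) y) :=
    (contMDiffAt_flowChart ϑ hz).mdifferentiableAt (by simp)
  obtain ⟨T, h1, hT⟩ : ∃ T : E × ℝ →L[ℝ] ℝ,
      HasFDerivAt ((fun p ↦ D * potential Y p) ∘ flowChart (E := E) ϑ c) T
        (graphPair (inChart c u) y) ∧
      T ν = mfderiv 𝓘(ℝ, F) 𝓘(ℝ, ℝ) (fun p ↦ D * potential Y p)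
        (flowChart ϑ c (graphPair (inChart c u) y))
        (mfderiv 𝓘(ℝ, E × ℝ) 𝓘(ℝ, F) (flowChart ϑ c) (graphPair (inChart c u) y) ν) :=
    ⟨_, (HasMFDerivAt.comp (I := 𝓘(ℝ, E × ℝ)) _ hψ'.hasMFDerivAt hS.hasMFDerivAt).hasFDerivAt,
      rfl⟩
  have h2 : (fun p ↦ D * potential Y p) ∘ flowChart (E := E) ϑ c =
      fun z ↦ D * chartPotential Y ϑ c z.1 := by
    funext z
    simp only [Function.comp, flowChart, potential_flow hY h]
  rw [h2] at h1
  have h3 : HasFDerivAt (fun z : E × ℝ ↦ D * chartPotential Y ϑ c z.1)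
      (D • (fderiv ℝ (chartPotential Y ϑ c) y).comp (ContinuousLinearMap.fst ℝ E ℝ))
      (graphPair (inChart c u) y) := by
    have h4 : HasFDerivAt (chartPotential Y ϑ c) (fderiv ℝ (chartPotential Y ϑ c) y)
      (graphPair (inChart c u) y).1 := ((contDiffAt_chartPotential h hy).differentiableAt
        (by simp)).hasFDerivAt
    have h5 : HasFDerivAt (fun z : E × ℝ ↦ z.1) (ContinuousLinearMap.fst ℝ E ℝ)
      (graphPair (inChart c u) y) := hasFDerivAt_fst
    exact (HasFDerivAt.comp (g := chartPotential Y ϑ c) (graphPair (inChart c u) y) h4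
      h5).const_mul D
  have h5 := congrArg (fun T : E × ℝ →L[ℝ] ℝ ↦ T ν) (h1.unique h3)
  refine hT.symm.trans (Eq.trans h5 ?_)
  simp [hν, warpedNormal]
  ring
end Normal

/-! ### Gram matrices in charts -/

section Gram
open Matrix

variable {E : Type*} [NormedAddCommGroup E] [InnerProductSpace ℝ E] [FiniteDimensional ℝ E]

/-- The matrix of an endomorphism in the standard orthonormal basis. -/
def stdMatrix (J : E →L[ℝ] E) :
    Matrix (Fin (Module.finrank ℝ E)) (Fin (Module.finrank ℝ E)) ℝ :=
  LinearMap.toMatrix (stdOrthonormalBasis ℝ E).toBasis (stdOrthonormalBasis ℝ E).toBasis J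

lemma det_stdMatrix (J : E →L[ℝ] E) : (stdMatrix J).det = J.det :=
  LinearMap.det_toMatrix _ _

lemma of_bilin_comp (B : E →ₗ[ℝ] E →ₗ[ℝ] ℝ) (J : E →L[ℝ] E) :
    (Matrix.of fun i j ↦ B (J (stdOrthonormalBasis ℝ E i)) (J (stdOrthonormalBasis ℝ E j))) =
      (stdMatrix J)ᵀ * (Matrix.of fun i j ↦
        B (stdOrthonormalBasis ℝ E i) (stdOrthonormalBasis ℝ E j)) * stdMatrix J := by
  have h := LinearMap.BilinForm.toMatrix_comp (stdOrthonormalBasis ℝ E).toBasis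
    (stdOrthonormalBasis ℝ E).toBasis B (J : E →ₗ[ℝ] E) (J : E →ₗ[ℝ] E)
  have h2 : ∀ B : E →ₗ[ℝ] E →ₗ[ℝ] ℝ,
      LinearMap.BilinForm.toMatrix (stdOrthonormalBasis ℝ E).toBasis B = Matrix.of fun i j ↦
        B (stdOrthonormalBasis ℝ E i) (stdOrthonormalBasis ℝ E j) := by
    intro B
    ext i j
    rw [LinearMap.BilinForm.toMatrix_apply]
    simp
  rw [h2, h2] at h
  exact h

/-- A continuous bilinear form, as an algebraic one. -/
def toBilin (s : E →L[ℝ] E →L[ℝ] ℝ) : E →ₗ[ℝ] E →ₗ[ℝ] ℝ :=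
  LinearMap.mk₂ ℝ (fun a b ↦ s a b) (by simp) (by simp) (by simp) (by simp)

lemma gramMatrix_bilinearComp (s : E →L[ℝ] E →L[ℝ] ℝ) (J : E →L[ℝ] E) :
    gramMatrix (s.bilinearComp J J) = (stdMatrix J)ᵀ * gramMatrix s * stdMatrix J :=
  of_bilin_comp (toBilin s) J

/-- The trace of a bilinear form with respect to a metric does not depend on the basis. -/
lemma trace_inv_conj {ι : Type*} [Fintype ι] [DecidableEq ι] (G B J : Matrix ι ι ℝ)
    (hJ : IsUnit J.det) :
    ((Jᵀ * G * J)⁻¹ * (Jᵀ * B * J)).trace = (G⁻¹ * B).trace := by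
  have hJt : IsUnit Jᵀ.det := by rwa [det_transpose]
  rw [Matrix.mul_inv_rev, Matrix.mul_inv_rev]
  have : J⁻¹ * (G⁻¹ * Jᵀ⁻¹) * (Jᵀ * B * J) = J⁻¹ * (G⁻¹ * B * J) := by
    simp only [Matrix.mul_assoc]
    rw [nonsing_inv_mul_cancel_left _ _ hJt]
  rw [this, trace_mul_comm, Matrix.mul_assoc, mul_nonsing_inv _ hJ, Matrix.mul_one]

end Gram

section ChartGram

variable {E : Type*} [NormedAddCommGroup E] [InnerProductSpace ℝ E] [FiniteDimensional ℝ E]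
  {F : Type*} [NormedAddCommGroup F] [InnerProductSpace ℝ F] [FiniteDimensional ℝ F]
  {P : Type*} [TopologicalSpace P] [ChartedSpace E P] [IsManifold 𝓘(ℝ, E) ∞ P]
  {M : Type*} [TopologicalSpace M] [ChartedSpace F M]
  [RiemannianBundle (fun p : M ↦ TangentSpace 𝓘(ℝ, F) p)]

lemma chartGram_inducedMetric {X : P → M} {c : P} {y : E}
    (hy : y ∈ (extChartAt 𝓘(ℝ, E) c).target)
    (hX : MDifferentiableAt 𝓘(ℝ, E) 𝓘(ℝ, F) X ((extChartAt 𝓘(ℝ, E) c).symm y)) :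
    chartGram (inducedMetric (E := E) (F := F) X) c y =
      gramMatrix (pullbackForm (F := F) (X ∘ (extChartAt 𝓘(ℝ, E) c).symm) y) := by
  have h1 := mfderiv_comp y hX ((contMDiffAt_chart_symm hy).mdifferentiableAt (by simp))
  ext i j
  simp only [chartGram, gramMatrix, Matrix.of_apply, inducedMetric]
  rw [pullbackForm_apply, h1]
  rfl

lemma gramMatrix_comp {S : E → M} {τ : E → E} {y : E}
    (hS : MDifferentiableAt 𝓘(ℝ, E) 𝓘(ℝ, F) S (τ y)) (hτ : DifferentiableAt ℝ τ y) :
    gramMatrix (pullbackForm (F := F) (S ∘ τ) y) = (stdMatrix (fderiv ℝ τ y)).transpose *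
      gramMatrix (pullbackForm (F := F) S (τ y)) * stdMatrix (fderiv ℝ τ y) := by
  rw [← gramMatrix_bilinearComp]
  congr 1
  ext a b
  rw [ContinuousLinearMap.bilinearComp_apply]
  exact pullbackForm_comp S τ y a b hS hτ

/-- The transition map from the chart centred at `c` to the chart centred at `c'`. -/
def transition (c c' : P) : E → E := extChartAt 𝓘(ℝ, E) c' ∘ (extChartAt 𝓘(ℝ, E) c).symm

lemma contDiffAt_transition {c c' : P} {y : E} (hy : y ∈ (extChartAt 𝓘(ℝ, E) c).target)
    (hy' : (extChartAt 𝓘(ℝ, E) c).symm y ∈ (extChartAt 𝓘(ℝ, E) c').source) :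
    ContDiffAt ℝ ∞ (transition c c') y :=
  ((contMDiffAt_chart hy').comp y (contMDiffAt_chart_symm hy)).contDiffAt

lemma eventually_chart_symm_transition {c c' : P} {y : E}
    (hy : y ∈ (extChartAt 𝓘(ℝ, E) c).target)
    (hy' : (extChartAt 𝓘(ℝ, E) c).symm y ∈ (extChartAt 𝓘(ℝ, E) c').source) :
    ∀ᶠ z in 𝓝 y, (extChartAt 𝓘(ℝ, E) c').symm (transition c c' z) =
      (extChartAt 𝓘(ℝ, E) c).symm z := by
  filter_upwards [(contMDiffAt_chart_symm hy).continuousAt.eventually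
    ((isOpen_extChartAt_source c').eventually_mem hy')] with z hz
  exact (extChartAt 𝓘(ℝ, E) c').left_inv hz

/-- The Gram matrices of the same metric in two charts are congruent by the Jacobian matrix of the
transition map. -/
lemma gramMatrix_transition {X : P → M} {c c' : P} {y : E}
    (hy : y ∈ (extChartAt 𝓘(ℝ, E) c).target)
    (hy' : (extChartAt 𝓘(ℝ, E) c).symm y ∈ (extChartAt 𝓘(ℝ, E) c').source)
    (hX : MDifferentiableAt 𝓘(ℝ, E) 𝓘(ℝ, F) X ((extChartAt 𝓘(ℝ, E) c).symm y)) :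
    gramMatrix (pullbackForm (F := F) (X ∘ (extChartAt 𝓘(ℝ, E) c).symm) y) =
      (stdMatrix (fderiv ℝ (transition c c') y)).transpose *
        gramMatrix (pullbackForm (F := F) (X ∘ (extChartAt 𝓘(ℝ, E) c').symm)
          (transition c c' y)) * stdMatrix (fderiv ℝ (transition c c') y) := by
  have hev := eventually_chart_symm_transition hy hy'
  have hm := (extChartAt 𝓘(ℝ, E) c').map_source hy'
  have h1 : X ∘ (extChartAt 𝓘(ℝ, E) c).symm =ᶠ[𝓝 y]
      (X ∘ (extChartAt 𝓘(ℝ, E) c').symm) ∘ transition c c' := by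
    filter_upwards [hev] with z hz
    simp only [Function.comp, hz]
  have hX' : MDifferentiableAt 𝓘(ℝ, E) 𝓘(ℝ, F) X
      ((extChartAt 𝓘(ℝ, E) c').symm (transition c c' y)) := by
    rw [hev.self_of_nhds]; exact hX
  have hd : MDifferentiableAt 𝓘(ℝ, E) 𝓘(ℝ, F) (X ∘ (extChartAt 𝓘(ℝ, E) c').symm)
      (transition c c' y) :=
    hX'.comp _ ((contMDiffAt_chart_symm hm).mdifferentiableAt (by simp))
  exact (congrArg gramMatrix (pullbackForm_congr h1)).trans
    (gramMatrix_comp hd ((contDiffAt_transition hy hy').differentiableAt (by simp)))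

end ChartGram

section InducedGram

variable {E : Type*} [NormedAddCommGroup E] [InnerProductSpace ℝ E] [FiniteDimensional ℝ E]
  {F : Type*} [NormedAddCommGroup F] [InnerProductSpace ℝ F] [FiniteDimensional ℝ F]
  {P : Type*} [TopologicalSpace P] [ChartedSpace E P] [IsManifold 𝓘(ℝ, E) ∞ P]
  {M : Type*} [TopologicalSpace M] [ChartedSpace F M] [IsManifold 𝓘(ℝ, F) ∞ M]
  [RiemannianBundle (fun p : M ↦ TangentSpace 𝓘(ℝ, F) p)]
  [RiemannianBundle (fun x : P ↦ TangentSpace 𝓘(ℝ, E) x)]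
  [IsContMDiffRiemannianBundle 𝓘(ℝ, F) ∞ F (fun p : M ↦ TangentSpace 𝓘(ℝ, F) p)]
  [IsContMDiffRiemannianBundle 𝓘(ℝ, E) ∞ E (fun x : P ↦ TangentSpace 𝓘(ℝ, E) x)]
  {Y : ∀ p : M, TangentSpace 𝓘(ℝ, F) p}
  {ϑ : Diffeomorph (𝓘(ℝ, E).prod 𝓘(ℝ, ℝ)) 𝓘(ℝ, F) (P × ℝ) M ∞}
  {c c' : P} {y : E} {u : P → ℝ}

lemma det_fderiv_transition_ne_zero (hy : y ∈ (extChartAt 𝓘(ℝ, E) c).target)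
    (hy' : (extChartAt 𝓘(ℝ, E) c).symm y ∈ (extChartAt 𝓘(ℝ, E) c').source) :
    (stdMatrix (fderiv ℝ (transition c c') y)).det ≠ 0 := by
  have h := gramMatrix_transition (X := (id : P → P)) hy hy' mdifferentiableAt_id
  have hp := (posDef_gramMatrix (fun a b ↦ pullbackForm_comm _ _ a b)
    (chartForm_pos hy)).det_pos
  intro h0
  have h2 := congrArg Matrix.det h
  rw [Matrix.det_mul, h0, mul_zero] at h2
  exact hp.ne' h2

lemma mdifferentiableAt_graphMap {x : P} (hu : MDifferentiableAt 𝓘(ℝ, E) 𝓘(ℝ, ℝ) u x) :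
    MDifferentiableAt 𝓘(ℝ, E) 𝓘(ℝ, F) (graphMap ϑ u) x :=
  MDifferentiableAt.comp (g := ϑ) x (ϑ.contMDiff.contMDiffAt.mdifferentiableAt (by simp))
    (mdifferentiableAt_id.prodMk hu)

lemma graphMap_comp_chart (c : P) : graphMap ϑ u ∘ (extChartAt 𝓘(ℝ, E) c).symm =
    flowChart ϑ c ∘ graphPair (inChart c u) := rfl

open Matrix in
/-- The induced metric of the graph of `u` in coordinates: `σ + e^{-2ψ} du ⊗ du`. -/
lemma gramMatrix_graph (hY : IsKilling Y) (h : IsFlowFromLeaf Y ϑ)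
    (hy : y ∈ (extChartAt 𝓘(ℝ, E) c).target)
    (hu : DifferentiableAt ℝ (inChart c u) y) :
    gramMatrix (pullbackForm (F := F) (graphMap ϑ u ∘ (extChartAt 𝓘(ℝ, E) c).symm) y) =
      gramMatrix (chartForm c y) + Real.exp (-(2 * chartPotential Y ϑ c y)) •
        vecMulVec (coords (fderiv ℝ (inChart c u) y)) (coords (fderiv ℝ (inChart c u) y)) := by
  have hz : (graphPair (inChart c u) y).1 ∈ (extChartAt 𝓘(ℝ, E) c).target := hy
  rw [graphMap_comp_chart]
  ext i j
  simp only [gramMatrix, of_apply, Matrix.add_apply, Matrix.smul_apply, vecMulVec_apply, coords,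
    smul_eq_mul]
  rw [pullbackForm_comp _ _ _ _ _ ((contMDiffAt_flowChart ϑ hz).mdifferentiableAt (by simp))
    (differentiableAt_id.prodMk hu), pullbackForm_flowChart hY h hz,
    fderiv_graphPair hu, fderiv_graphPair hu]
  rfl
end InducedGram

/-! ### The mean curvature as a divergence -/

section Sff

variable {E : Type*} [NormedAddCommGroup E] [InnerProductSpace ℝ E] [FiniteDimensional ℝ E]
  {F : Type*} [NormedAddCommGroup F] [InnerProductSpace ℝ F] [FiniteDimensional ℝ F]
  {P : Type*} [TopologicalSpace P] [ChartedSpace E P] [IsManifold 𝓘(ℝ, E) ∞ P]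
  {M : Type*} [TopologicalSpace M] [ChartedSpace F M] [IsManifold 𝓘(ℝ, F) ∞ M]
  [RiemannianBundle (fun p : M ↦ TangentSpace 𝓘(ℝ, F) p)]
  [IsContMDiffRiemannianBundle 𝓘(ℝ, F) ∞ F (fun p : M ↦ TangentSpace 𝓘(ℝ, F) p)]

lemma christoffel_eq {c : M} {y : F} (hy : y ∈ (extChartAt 𝓘(ℝ, F) c).target) (a b w : F) :
    christoffel c y a b w = christoffelForm (chartForm c) y a b w := by
  have hd : DifferentiableAt ℝ (chartForm c) y :=
    (contDiffAt_chartForm hy).differentiableAt (by simp)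
  have key : ∀ a b v : F, fderiv ℝ (fun z ↦ chartMetric c z a b) y v =
      fderiv ℝ (chartForm c) y v a b := by
    intro a b v
    obtain ⟨L, hL, hL2⟩ := hasFDerivAt_apply_apply hd a b
    rw [← hL2]
    exact congrArg (fun T : F →L[ℝ] ℝ ↦ T v) hL.fderiv
  simp only [christoffel, christoffelForm, key]

lemma secondFundamentalForm_eq (X : P → M) (N : ∀ p : P, TangentSpace 𝓘(ℝ, F) (X p)) (p : P)
    (v w : E) : secondFundamentalForm X N p v w =
      sffForm (chartForm (X p)) (localRep (E := E) (F := F) X p)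
        (mfderiv 𝓘(ℝ, F) 𝓘(ℝ, F) (extChartAt 𝓘(ℝ, F) (X p)) (X p) (N p) : F)
        (extChartAt 𝓘(ℝ, E) p p) v w := by
  have h1 : localRep (E := E) (F := F) X p (extChartAt 𝓘(ℝ, E) p p) =
      extChartAt 𝓘(ℝ, F) (X p) (X p) := by
    simp only [localRep, Function.comp, extChartAt_to_inv]
  simp only [sffForm]
  rw [h1]
  exact congrArg (_ + ·) (christoffel_eq (mem_extChartAt_target (X p)) _ _ _)

end Sff

section Graph

variable {E : Type*} [NormedAddCommGroup E] [InnerProductSpace ℝ E] [FiniteDimensional ℝ E]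
  {F : Type*} [NormedAddCommGroup F] [InnerProductSpace ℝ F] [FiniteDimensional ℝ F]
  {P : Type*} [TopologicalSpace P] [ChartedSpace E P] [IsManifold 𝓘(ℝ, E) ∞ P]
  {M : Type*} [TopologicalSpace M] [ChartedSpace F M] [IsManifold 𝓘(ℝ, F) ∞ M]
  [RiemannianBundle (fun p : M ↦ TangentSpace 𝓘(ℝ, F) p)]
  [RiemannianBundle (fun x : P ↦ TangentSpace 𝓘(ℝ, E) x)]
  [IsContMDiffRiemannianBundle 𝓘(ℝ, F) ∞ F (fun p : M ↦ TangentSpace 𝓘(ℝ, F) p)]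
  [IsContMDiffRiemannianBundle 𝓘(ℝ, E) ∞ E (fun x : P ↦ TangentSpace 𝓘(ℝ, E) x)]
  {Y : ∀ p : M, TangentSpace 𝓘(ℝ, F) p}
  {ϑ : Diffeomorph (𝓘(ℝ, E).prod 𝓘(ℝ, ℝ)) 𝓘(ℝ, F) (P × ℝ) M ∞}
  {c : P} {y : E} {u : P → ℝ}

lemma transition_self (hy : y ∈ (extChartAt 𝓘(ℝ, E) c).target) :
    transition ((extChartAt 𝓘(ℝ, E) c).symm y) c (extChartAt 𝓘(ℝ, E)
      ((extChartAt 𝓘(ℝ, E) c).symm y) ((extChartAt 𝓘(ℝ, E) c).symm y)) = y := by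
  rw [transition, Function.comp, extChartAt_to_inv, (extChartAt 𝓘(ℝ, E) c).right_inv hy]

/-- The second fundamental form of the graph at the point `p`, defined through the charts of `P` and
`M` centred at `p` and at its image, computed instead in the parametrization `flowChart` over an
arbitrary chart of `P`. The two parametrizations of `M` differ by `G`, those of `P` by `τ`. -/
lemma secondFundamentalForm_graph (hY : IsKilling Y) (h : IsFlowFromLeaf Y ϑ)
    (hy : y ∈ (extChartAt 𝓘(ℝ, E) c).target)
    (hu : ContMDiffAt 𝓘(ℝ, E) 𝓘(ℝ, ℝ) ∞ u ((extChartAt 𝓘(ℝ, E) c).symm y)) (v w : E) :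
    let p := (extChartAt 𝓘(ℝ, E) c).symm y
    let J := fderiv ℝ (transition p c) (extChartAt 𝓘(ℝ, E) p p)
    secondFundamentalForm (graphMap ϑ u) (upwardNormal (E := E) Y ϑ u) p v w =
      sffForm (pullbackForm (F := F) (flowChart ϑ c)) (graphPair (inChart c u))
        (warpedNormal (chartForm c) (chartPotential Y ϑ c) (inChart c u) y) y (J v) (J w) := by
  intro p J
  set X := graphMap ϑ u with hX
  set uh : E → ℝ := inChart c u with huh
  set ν := warpedNormal (chartForm c) (chartPotential Y ϑ c) uh y with hν
  set x := extChartAt 𝓘(ℝ, E) p p with hx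
  set τ : E → E := transition p c with hτ
  set G : E × ℝ → F := fun z ↦ extChartAt 𝓘(ℝ, F) (X p) (flowChart (E := E) ϑ c z) with hG
  have hτx : τ x = y := transition_self hy
  have hps : p ∈ (extChartAt 𝓘(ℝ, E) c).source := (extChartAt 𝓘(ℝ, E) c).map_target hy
  have hxt : x ∈ (extChartAt 𝓘(ℝ, E) p).target := mem_extChartAt_target _
  have hxp : (extChartAt 𝓘(ℝ, E) p).symm x = p := extChartAt_to_inv _
  have hτd : ContDiffAt ℝ ∞ τ x := contDiffAt_transition hxt (by rw [hxp]; exact hps)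
  have hud : ContDiffAt ℝ ∞ uh y := contDiffAt_inChart le_rfl hy hu
  have hum : MDifferentiableAt 𝓘(ℝ, E) 𝓘(ℝ, ℝ) u p := hu.mdifferentiableAt (by simp)
  have hgd : ContDiffAt ℝ ∞ (graphPair uh) y := contDiffAt_graphPair hud
  have hz : (graphPair uh y).1 ∈ (extChartAt 𝓘(ℝ, E) c).target := hy
  have hGd : ∀ z : E × ℝ, z.1 ∈ (extChartAt 𝓘(ℝ, E) c).target →
      flowChart ϑ c z ∈ (extChartAt 𝓘(ℝ, F) (X p)).source → ContDiffAt ℝ ∞ G z := fun z h1 h2 ↦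
    ((contMDiffAt_chart h2).comp z (contMDiffAt_flowChart ϑ h1)).contDiffAt
  have hXs : flowChart ϑ c (graphPair uh y) ∈ (extChartAt 𝓘(ℝ, F) (X p)).source :=
    mem_extChartAt_source (I := 𝓘(ℝ, F)) (X p)
  have hGz := hGd _ hz hXs
  have hsrc : ∀ᶠ z in 𝓝 (graphPair uh y), z.1 ∈ (extChartAt 𝓘(ℝ, E) c).target ∧
      flowChart ϑ c z ∈ (extChartAt 𝓘(ℝ, F) (X p)).source :=
    (eventually_flowChart hz).and ((contMDiffAt_flowChart ϑ hz).continuousAt.eventually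
      ((isOpen_extChartAt_source (X p)).eventually_mem hXs))
  have hpull : ∀ᶠ z in 𝓝 (graphPair uh y), ∀ a b, pullbackForm (F := F) (flowChart ϑ c) z a b =
      chartForm (X p) (G z) (fderiv ℝ G z a) (fderiv ℝ G z b) := by
    filter_upwards [hsrc.eventually_nhds] with z hz a b
    have h1 : flowChart ϑ c =ᶠ[𝓝 z] (extChartAt 𝓘(ℝ, F) (X p)).symm ∘ G := by
      filter_upwards [hz] with w hw
      exact ((extChartAt 𝓘(ℝ, F) (X p)).left_inv hw.2).symm
    obtain ⟨hz1, hz2⟩ := hz.self_of_nhds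
    rw [pullbackForm_congr h1]
    exact pullbackForm_comp _ _ _ a b ((contMDiffAt_chart_symm
      ((extChartAt 𝓘(ℝ, F) (X p)).map_source hz2)).mdifferentiableAt (by simp))
      ((hGd z hz1 hz2).differentiableAt (by simp))
  have hloc : localRep (E := E) (F := F) X p =ᶠ[𝓝 x] G ∘ (graphPair uh ∘ τ) := by
    filter_upwards [eventually_chart_symm_transition (c := p) (c' := c) hxt
      (by rw [hxp]; exact hps)] with w hw
    have hw' : (extChartAt 𝓘(ℝ, E) c).symm (τ w) = (extChartAt 𝓘(ℝ, E) p).symm w := hw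
    simp only [localRep, Function.comp, hG, graphPair, huh, inChart, flowChart, hw', hX, graphMap]
  have hνG : (mfderiv 𝓘(ℝ, F) 𝓘(ℝ, F) (extChartAt 𝓘(ℝ, F) (X p)) (X p)
      (upwardNormal (E := E) Y ϑ u p) : F) = fderiv ℝ G (graphPair uh y) ν := by
    have h1 := congrArg (fun t ↦ (mfderiv 𝓘(ℝ, F) 𝓘(ℝ, F) (extChartAt 𝓘(ℝ, F) (X p)) (X p) t : F))
      (upwardNormal_eq h hy hum)
    refine h1.trans ?_
    have h2 := HasMFDerivAt.comp (I := 𝓘(ℝ, E × ℝ)) (graphPair uh y)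
      ((contMDiffAt_chart hXs).mdifferentiableAt (by simp)).hasMFDerivAt
      ((contMDiffAt_flowChart ϑ hz).mdifferentiableAt (by simp)).hasMFDerivAt
    have h3 : mfderiv 𝓘(ℝ, E × ℝ) 𝓘(ℝ, F) G (graphPair uh y) = _ := h2.mfderiv
    rw [mfderiv_eq_fderiv] at h3
    exact (congrArg (fun T : E × ℝ →L[ℝ] F ↦ T ν) h3).symm
  have hg'd : ContDiffAt ℝ ∞ (pullbackForm (F := F) (flowChart (E := E) ϑ c)) (graphPair uh y) :=
    contDiffAt_pullbackForm (s := {z : E × ℝ | z.1 ∈ (extChartAt 𝓘(ℝ, E) c).target})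
      ((isOpen_extChartAt_target c).preimage continuous_fst)
      (fun _ h ↦ contMDiffAt_flowChart ϑ h) hz
  have hGy : G (graphPair uh y) ∈ (extChartAt 𝓘(ℝ, F) (X p)).target :=
    (extChartAt 𝓘(ℝ, F) (X p)).map_source hXs
  have hgF : DifferentiableAt ℝ (chartForm (X p)) (G (graphPair uh y)) :=
    (contDiffAt_chartForm hGy).differentiableAt (by simp)
  rw [secondFundamentalForm_eq, hνG, hloc.sffForm_eq]
  have hτ2 : ContDiffAt ℝ 2 τ x := hτd.of_le (by norm_cast)
  have hgd2 : ContDiffAt ℝ 2 (graphPair uh) (τ x) := by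
    rw [hτx]; exact hgd.of_le (by norm_cast)
  have hG2 : ContDiffAt ℝ 2 G ((graphPair uh ∘ τ) x) := by
    rw [Function.comp, hτx]; exact hGz.of_le (by norm_cast)
  have e1 := sffForm_comp_left (g := chartForm (X p)) (g' := pullbackForm (F := F) (flowChart ϑ c))
    (Ψ := graphPair uh ∘ τ) (x := x) hG2 (hgd2.comp x hτ2)
    (by rw [Function.comp, hτx]; exact hgF)
    (by rw [Function.comp, hτx]; exact hg'd.differentiableAt (by simp))
    (fun y a b ↦ pullbackForm_comm _ _ _ _)
    (by rw [Function.comp, hτx]; exact hpull) ν v w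
  rw [Function.comp_apply, hτx] at e1
  rw [e1]
  have e2 := sffForm_comp_right (g := pullbackForm (F := F) (flowChart ϑ c)) (Φ := graphPair uh)
    (τ := τ) (x := x) (ν := ν) hgd2 hτ2 (by
      rw [hτx]
      exact warpedNormal_orthogonal (fun a b ↦ pullbackForm_comm _ _ _ _) (chartForm_pos hy)
        (fun a b ↦ pullbackForm_flowChart hY h hz a b) (hud.differentiableAt (by simp))) v w
  rw [hτx] at e2
  exact e2

/-- The coordinate expression of the second fundamental form of a graph is bilinear. -/
lemma exists_bilin_sffForm (g : E → E →L[ℝ] E →L[ℝ] ℝ) (uh ψ : E → ℝ) (y a : E) (r l m : ℝ) :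
    ∃ B : E →ₗ[ℝ] E →ₗ[ℝ] ℝ, ∀ v w, B v w = r * (fderiv ℝ (fderiv ℝ uh) y v w
      - christoffelForm g y v w a - fderiv ℝ ψ y v * fderiv ℝ uh y w
      - fderiv ℝ uh y v * fderiv ℝ ψ y w - l * m * (fderiv ℝ uh y v * fderiv ℝ uh y w)) := by
  simp only [christoffelForm]
  generalize fderiv ℝ (fderiv ℝ uh) y = A
  generalize fderiv ℝ g y = T
  generalize fderiv ℝ uh y = α
  generalize fderiv ℝ ψ y = β
  have hA1 : ∀ v v' w, A (v + v') w = A v w + A v' w := fun v v' w ↦ by rw [map_add]; rfl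
  have hA2 : ∀ (k : ℝ) v w, A (k • v) w = k * A v w := fun k v w ↦ by rw [map_smul]; rfl
  have hA3 : ∀ v w w', A v (w + w') = A v w + A v w' := fun v w w' ↦ map_add _ _ _
  have hA4 : ∀ (k : ℝ) v w, A v (k • w) = k * A v w := fun k v w ↦ map_smul _ _ _
  have hT1 : ∀ v v' w b, T (v + v') w b = T v w b + T v' w b := fun v v' w b ↦ by
    rw [map_add]; rfl
  have hT2 : ∀ (k : ℝ) v w b, T (k • v) w b = k * T v w b := fun k v w b ↦ by rw [map_smul]; rfl
  have hT3 : ∀ v w w' b, T v (w + w') b = T v w b + T v w' b := fun v w w' b ↦ by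
    rw [map_add]; rfl
  have hT4 : ∀ (k : ℝ) v w b, T v (k • w) b = k * T v w b := fun k v w b ↦ by rw [map_smul]; rfl
  have hT5 : ∀ v w b b', T v w (b + b') = T v w b + T v w b' := fun v w b b' ↦ map_add _ _ _
  have hT6 : ∀ (k : ℝ) v w b, T v w (k • b) = k * T v w b := fun k v w b ↦ map_smul _ _ _
  have hl : ∀ (α : E →L[ℝ] ℝ) v w, α (v + w) = α v + α w := fun α ↦ map_add α
  have hl' : ∀ (α : E →L[ℝ] ℝ) (k : ℝ) v, α (k • v) = k * α v := fun α ↦ map_smul α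
  refine ⟨LinearMap.mk₂ ℝ (fun v w ↦ r * (A v w - (T v w a + T w v a - T a v w) / 2
    - β v * α w - α v * β w - l * m * (α v * α w))) (fun v v' w ↦ ?_) (fun k v w ↦ ?_)
    (fun v w w' ↦ ?_) (fun k v w ↦ ?_), fun v w ↦ rfl⟩
  all_goals
    simp only [hA1, hA2, hA3, hA4, hT1, hT2, hT3, hT4, hT5, hT6, hl, hl']
    ring

/-- The weighted mean curvature of the graph is the divergence of the weighted flux. -/
lemma weightedMeanCurvature_eq_div (hY : IsKilling Y) (h : IsFlowFromLeaf Y ϑ) (D : ℝ)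
    (hn : Module.finrank ℝ E ≠ 0) (hy : y ∈ (extChartAt 𝓘(ℝ, E) c).target)
    (hu : ContMDiffAt 𝓘(ℝ, E) 𝓘(ℝ, ℝ) ∞ u ((extChartAt 𝓘(ℝ, E) c).symm y)) :
    ∑ i, inner ℝ (stdOrthonormalBasis ℝ E i) (fderiv ℝ (flux (chartForm c)
      (chartPotential Y ϑ c) (inChart c u) D) y (stdOrthonormalBasis ℝ E i)) =
      weightDensity (chartForm c) (chartPotential Y ϑ c) D y *
        (Module.finrank ℝ E * weightedMeanCurvature (E := E) (F := F)
          (fun p ↦ D * potential Y p) (graphMap ϑ u) (upwardNormal (E := E) Y ϑ u)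
          ((extChartAt 𝓘(ℝ, E) c).symm y)) := by
  set p := (extChartAt 𝓘(ℝ, E) c).symm y with hp
  set x := extChartAt 𝓘(ℝ, E) p p with hx
  have hτx : transition p c x = y := transition_self hy
  have hps : p ∈ (extChartAt 𝓘(ℝ, E) c).source := (extChartAt 𝓘(ℝ, E) c).map_target hy
  have hxt : x ∈ (extChartAt 𝓘(ℝ, E) p).target := mem_extChartAt_target _
  have hxp : (extChartAt 𝓘(ℝ, E) p).symm x = p := extChartAt_to_inv _
  have hud : ContDiffAt ℝ ∞ (inChart c u) y := contDiffAt_inChart le_rfl hy hu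
  have hum : MDifferentiableAt 𝓘(ℝ, E) 𝓘(ℝ, ℝ) u p := hu.mdifferentiableAt (by simp)
  have hXm : MDifferentiableAt 𝓘(ℝ, E) 𝓘(ℝ, F) (graphMap ϑ u) ((extChartAt 𝓘(ℝ, E) p).symm x) := by
    rw [hxp]; exact mdifferentiableAt_graphMap hum
  have hJ := (det_fderiv_transition_ne_zero hxt (c' := c) (by rw [hxp]; exact hps)).isUnit
  have hz : (graphPair (inChart c u) y).1 ∈ (extChartAt 𝓘(ℝ, E) c).target := hy
  have hψd : ContDiffAt ℝ ∞ (chartPotential Y ϑ c) y := contDiffAt_chartPotential h hy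
  have hsd : ContDiffAt ℝ ∞ (chartForm c) y := contDiffAt_chartForm hy
  have hg'd : ContDiffAt ℝ ∞ (pullbackForm (F := F) (flowChart (E := E) ϑ c))
      (graphPair (inChart c u) y) :=
    contDiffAt_pullbackForm (s := {z : E × ℝ | z.1 ∈ (extChartAt 𝓘(ℝ, E) c).target})
      ((isOpen_extChartAt_target c).preimage continuous_fst)
      (fun _ h ↦ contMDiffAt_flowChart ϑ h) hz
  obtain ⟨B, hB⟩ := exists_bilin_sffForm (chartForm c) (inChart c u) (chartPotential Y ϑ c) y
    (gradVec (chartForm c) (inChart c u) y)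
    (slope (chartForm c) (chartPotential Y ϑ c) (inChart c u) y)⁻¹
    (Real.exp (-(2 * chartPotential Y ϑ c y)))
    (fderiv ℝ (chartPotential Y ϑ c) y (gradVec (chartForm c) (inChart c u) y))
  have hII : (Matrix.of fun i j ↦ secondFundamentalForm (E := E) (F := F) (graphMap ϑ u)
      (upwardNormal (E := E) Y ϑ u) p (stdOrthonormalBasis ℝ E i) (stdOrthonormalBasis ℝ E j)) =
      Matrix.of fun i j ↦ B (fderiv ℝ (transition p c) x (stdOrthonormalBasis ℝ E i))
        (fderiv ℝ (transition p c) x (stdOrthonormalBasis ℝ E j)) := by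
    ext i j
    simp only [Matrix.of_apply]
    rw [secondFundamentalForm_graph hY h hy hu, hB,
      sffForm_graphPair (hsd.differentiableAt (by simp)) (fun a b ↦ pullbackForm_comm _ _ _ _)
        (chartForm_pos hy) (hud.of_le (by norm_cast)) (hψd.differentiableAt (by simp))
        (hg'd.differentiableAt (by simp))
        ((eventually_flowChart hz).mono fun z hz a b ↦ pullbackForm_flowChart hY h hz a b)]
  have hG : chartGram (inducedMetric (E := E) (F := F) (graphMap ϑ u)) p x =
      (stdMatrix (fderiv ℝ (transition p c) x)).transpose *
        (gramMatrix (chartForm c y) + Real.exp (-(2 * chartPotential Y ϑ c y)) •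
          Matrix.vecMulVec (coords (fderiv ℝ (inChart c u) y))
            (coords (fderiv ℝ (inChart c u) y))) *
        stdMatrix (fderiv ℝ (transition p c) x) := by
    rw [chartGram_inducedMetric hxt hXm, gramMatrix_transition hxt (c' := c)
      (by rw [hxp]; exact hps) hXm, hτx, gramMatrix_graph hY h hy (hud.differentiableAt (by simp))]
  rw [sum_inner_fderiv_flux (hsd.of_le (by norm_cast)) (fun z a b ↦ pullbackForm_comm _ _ _ _)
    (((isOpen_extChartAt_target c).eventually_mem hy).mono fun z hz ↦ chartForm_pos hz)
    (hud.of_le (by norm_cast)) (hψd.of_le (by norm_cast))]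
  congr 1
  rw [weightedMeanCurvature, meanCurvature, metric_grad_potential hY h D hy hum, hII,
    of_bilin_comp, hG, trace_inv_conj _ _ _ hJ]
  have hn' : (Module.finrank ℝ E : ℝ) ≠ 0 := by exact_mod_cast hn
  have e : ∀ a b : ℝ, (Module.finrank ℝ E : ℝ) *
      (a / Module.finrank ℝ E + -b / Module.finrank ℝ E) = a - b := by
    intro a b
    field_simp
    ring
  rw [e]
  simp only [hB]
  rfl

end Graph

/-! ### Riemannian volume in charts -/

section ChartVolume

variable {E : Type*} [NormedAddCommGroup E] [InnerProductSpace ℝ E] [FiniteDimensional ℝ E]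
  [MeasurableSpace E] [BorelSpace E]
  {P : Type*} [TopologicalSpace P] [ChartedSpace E P] [MeasurableSpace P] [BorelSpace P]
  {g g' : ∀ x : P, TangentSpace 𝓘(ℝ, E) x → TangentSpace 𝓘(ℝ, E) x → ℝ} {c c' : P}

lemma aemeasurable_chart_symm (c : P) : AEMeasurable (extChartAt 𝓘(ℝ, E) c).symm
    (volume.restrict (extChartAt 𝓘(ℝ, E) c).target) :=
  (continuousOn_extChartAt_symm c).aemeasurable (isOpen_extChartAt_target c).measurableSet

lemma measurableSet_target_inter_preimage (c : P) {A : Set P} (hA : MeasurableSet A) :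
    MeasurableSet ((extChartAt 𝓘(ℝ, E) c).target ∩ (extChartAt 𝓘(ℝ, E) c).symm ⁻¹' A) := by
  have hT : MeasurableSet (extChartAt 𝓘(ℝ, E) c).target :=
    (isOpen_extChartAt_target c).measurableSet
  have h1 : Measurable ((extChartAt 𝓘(ℝ, E) c).target.domRestrict (extChartAt 𝓘(ℝ, E) c).symm) :=
    (continuousOn_extChartAt_symm c).domRestrict.measurable
  have h2 := hT.subtype_image (h1 hA)
  convert h2 using 1
  ext y
  exact ⟨fun h ↦ ⟨⟨y, h.1⟩, h.2, rfl⟩, fun ⟨x, hx, hxy⟩ ↦ hxy ▸ ⟨x.2, hx⟩⟩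

/-- The coordinate density `√det g` of a metric. -/
def chartDensity (g : ∀ x : P, TangentSpace 𝓘(ℝ, E) x → TangentSpace 𝓘(ℝ, E) x → ℝ) (c : P)
    (y : E) : ℝ≥0∞ := ENNReal.ofReal (√(chartGram g c y).det)

lemma chartVolume_restrict {A : Set P} (hA : MeasurableSet A) :
    (chartVolume g c).restrict A = Measure.map (extChartAt 𝓘(ℝ, E) c).symm
      ((volume.restrict ((extChartAt 𝓘(ℝ, E) c).target ∩
        (extChartAt 𝓘(ℝ, E) c).symm ⁻¹' A)).withDensity (chartDensity g c)) := by
  have h0 := aemeasurable_chart_symm (E := E) c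
  rw [chartVolume, Measure.restrict_map_of_aemeasurable
    (h0.mono_ac (withDensity_absolutelyContinuous _ _)) hA, restrict_withDensity',
    Measure.restrict_restrict₀ (h0.nullMeasurable hA), inter_comm]
  rfl

lemma chartVolume_apply {A : Set P} (hA : MeasurableSet A) :
    chartVolume g c A = ∫⁻ y in (extChartAt 𝓘(ℝ, E) c).target ∩
        (extChartAt 𝓘(ℝ, E) c).symm ⁻¹' A, chartDensity g c y := by
  have h0 := (aemeasurable_chart_symm (E := E) c).mono_measure
    (Measure.restrict_mono (inter_subset_left
      (t := (extChartAt 𝓘(ℝ, E) c).symm ⁻¹' A)) le_rfl)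
  rw [← Measure.restrict_apply_self, chartVolume_restrict hA, Measure.map_apply_of_aemeasurable
    (h0.mono_ac (withDensity_absolutelyContinuous _ _)) hA, withDensity_apply',
    Measure.restrict_restrict₀ (h0.nullMeasurable hA)]
  congr 2
  ext y
  simp

lemma setLIntegral_chartVolume {A : Set P} (hA : MeasurableSet A) {f : P → ℝ≥0∞}
    (hd : AEMeasurable (chartDensity g c) (volume.restrict ((extChartAt 𝓘(ℝ, E) c).target ∩
        (extChartAt 𝓘(ℝ, E) c).symm ⁻¹' A)))
    (hf : AEMeasurable f ((chartVolume g c).restrict A)) :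
    ∫⁻ x in A, f x ∂chartVolume g c = ∫⁻ y in (extChartAt 𝓘(ℝ, E) c).target ∩
        (extChartAt 𝓘(ℝ, E) c).symm ⁻¹' A,
        chartDensity g c y * f ((extChartAt 𝓘(ℝ, E) c).symm y) := by
  have h0 := (aemeasurable_chart_symm (E := E) c).mono_measure
    (Measure.restrict_mono (inter_subset_left
      (t := (extChartAt 𝓘(ℝ, E) c).symm ⁻¹' A)) le_rfl)
  have h0' := h0.mono_ac (withDensity_absolutelyContinuous _ (chartDensity g c))
  rw [chartVolume_restrict hA] at hf ⊢
  rw [lintegral_map' hf h0']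
  exact lintegral_withDensity_eq_lintegral_mul₀' hd (hf.comp_aemeasurable h0')

lemma target_inter_preimage_source (c : P) : (extChartAt 𝓘(ℝ, E) c).target ∩
    (extChartAt 𝓘(ℝ, E) c).symm ⁻¹' (chartAt E c).source = (extChartAt 𝓘(ℝ, E) c).target := by
  rw [← extChartAt_source 𝓘(ℝ, E)]
  exact inter_eq_left.2 fun y hy ↦ (extChartAt 𝓘(ℝ, E) c).map_target hy

lemma chartVolume_restrict_source (c : P) :
    (chartVolume g c).restrict (chartAt E c).source = chartVolume g c := by
  rw [chartVolume_restrict (chartAt E c).open_source.measurableSet, target_inter_preimage_source]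
  rfl

variable [SecondCountableTopology P] [Nonempty P]

/-- The Riemannian volume measures of all metrics are glued along one and the same countable
partition subordinate to charts. -/
lemma exists_riemannianVolume_eq (E P) [NormedAddCommGroup E] [InnerProductSpace ℝ E]
    [FiniteDimensional ℝ E] [MeasurableSpace E] [BorelSpace E]
    [TopologicalSpace P] [ChartedSpace E P] [MeasurableSpace P] [BorelSpace P]
    [SecondCountableTopology P] [Nonempty P] :
    ∃ (a : ℕ → P) (D : ℕ → Set P), (∀ k, MeasurableSet (D k)) ∧
      (∀ k, D k ⊆ (chartAt E (a k)).source) ∧ ⋃ k, D k = univ ∧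
      Pairwise (Function.onFun Disjoint D) ∧
      ∀ g : ∀ x : P, TangentSpace 𝓘(ℝ, E) x → TangentSpace 𝓘(ℝ, E) x → ℝ, riemannianVolume g =
        Measure.sum fun k ↦ (chartVolume g (a k)).restrict (D k) := by
  have h := exists_chart_cover (E := E) (P := P)
  refine ⟨h.choose, disjointed fun k ↦ (chartAt E (h.choose k)).source, fun k ↦ ?_,
    fun k ↦ disjointed_subset _ _, ?_, disjoint_disjointed _,
    fun g ↦ dif_pos h⟩
  · exact MeasurableSet.disjointed
      (fun k ↦ (chartAt E (h.choose k)).open_source.measurableSet) k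
  · rw [iUnion_disjointed]
    exact h.choose_spec

/-- A pointwise relation between the coordinate densities of two metrics is a relation between
their volume measures. -/
lemma riemannianVolume_restrict_withDensity {Ω : Set P} (hΩ : MeasurableSet Ω) {ρ : P → ℝ≥0∞}
    (hρ : Measurable (Ω.indicator ρ))
    (hd : ∀ c : P, AEMeasurable (chartDensity g c) (volume.restrict (extChartAt 𝓘(ℝ, E) c).target))
    (h : ∀ c : P, ∀ y ∈ (extChartAt 𝓘(ℝ, E) c).target, (extChartAt 𝓘(ℝ, E) c).symm y ∈ Ω →
      chartDensity g' c y = chartDensity g c y * ρ ((extChartAt 𝓘(ℝ, E) c).symm y)) :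
    (riemannianVolume g').restrict Ω = (riemannianVolume g).withDensity (Ω.indicator ρ) := by
  obtain ⟨a, D, hDm, -, -, -, hD⟩ := exists_riemannianVolume_eq E P
  rw [hD g, hD g', Measure.restrict_sum _ hΩ, withDensity_sum]
  congr 1
  funext k
  rw [Measure.restrict_restrict hΩ]
  ext B hB
  rw [Measure.restrict_apply hB, chartVolume_apply (hB.inter (hΩ.inter (hDm k))),
    withDensity_apply _ hB, Measure.restrict_restrict hB, ← lintegral_indicator (hB.inter (hDm k))]
  have e1 : (B ∩ D k).indicator (Ω.indicator ρ) = fun x ↦ (B ∩ (Ω ∩ D k)).indicator ρ x := by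
    funext x
    by_cases h1 : x ∈ Ω <;> by_cases h2 : x ∈ B <;> by_cases h3 : x ∈ D k <;>
      simp [h1, h2, h3]
  rw [e1, lintegral_indicator (hB.inter (hΩ.inter (hDm k))), setLIntegral_chartVolume
    (hB.inter (hΩ.inter (hDm k)))]
  · refine setLIntegral_congr_fun (measurableSet_target_inter_preimage (a k)
      (hB.inter (hΩ.inter (hDm k)))) fun y hy ↦ h _ y hy.1 hy.2.2.1
  · exact (hd (a k)).mono_measure (Measure.restrict_mono inter_subset_left le_rfl)
  · refine (hρ.aemeasurable.restrict).congr ?_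
    filter_upwards [ae_restrict_mem (hB.inter (hΩ.inter (hDm k)))] with x hx
    rw [indicator_of_mem hx.2.1]

/-- The volume measure does not depend on the charts. -/
lemma riemannianVolume_restrict_source
    (h : ∀ (c c' : P) (A : Set P), MeasurableSet A → A ⊆ (chartAt E c).source →
      A ⊆ (chartAt E c').source → chartVolume g c A = chartVolume g c' A) (c : P) :
    (riemannianVolume g).restrict (chartAt E c).source = chartVolume g c := by
  obtain ⟨a, D, hDm, hDs, hDU, hDd, hD⟩ := exists_riemannianVolume_eq E P
  have hs : MeasurableSet (chartAt E c).source := (chartAt E c).open_source.measurableSet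
  ext B hB
  rw [← chartVolume_restrict_source, Measure.restrict_apply hB, Measure.restrict_apply hB, hD,
    Measure.sum_apply _ (hB.inter hs)]
  have e : B ∩ (chartAt E c).source = ⋃ k, (B ∩ (chartAt E c).source) ∩ D k := by
    rw [← inter_iUnion, hDU, inter_univ]
  conv_rhs => rw [e]
  rw [measure_iUnion (fun i j hij ↦ (hDd hij).mono inter_subset_right inter_subset_right)
    (fun k ↦ (hB.inter hs).inter (hDm k))]
  congr 1
  funext k
  rw [Measure.restrict_apply (hB.inter hs)]
  exact h _ _ _ ((hB.inter hs).inter (hDm k)) (inter_subset_right.trans (hDs k))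
    (inter_subset_left.trans inter_subset_right)

end ChartVolume

/-! ### The volume of the leaf -/

section MetricVolume

variable {E : Type*} [NormedAddCommGroup E] [InnerProductSpace ℝ E] [FiniteDimensional ℝ E]
  {P : Type*} [TopologicalSpace P] [ChartedSpace E P] [IsManifold 𝓘(ℝ, E) ∞ P]
  [RiemannianBundle (fun x : P ↦ TangentSpace 𝓘(ℝ, E) x)]
  [IsContMDiffRiemannianBundle 𝓘(ℝ, E) ∞ E (fun x : P ↦ TangentSpace 𝓘(ℝ, E) x)]
  {c c' : P} {y : E}

lemma chartDensity_metric (c : P) (y : E) : chartDensity (metric (E := E) (P := P)) c y =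
    ENNReal.ofReal (√(gramMatrix (chartForm c y)).det) := rfl

lemma gramMatrix_chartForm_det_pos (hy : y ∈ (extChartAt 𝓘(ℝ, E) c).target) :
    0 < (gramMatrix (chartForm c y)).det :=
  (posDef_gramMatrix (fun a b ↦ pullbackForm_comm _ _ a b) (chartForm_pos hy)).det_pos

lemma continuousOn_sqrt_det (c : P) : ContinuousOn
    (fun y ↦ √(gramMatrix (chartForm c y)).det) (extChartAt 𝓘(ℝ, E) c).target := by
  intro y hy
  have h : ContinuousAt (chartForm c) y := (contDiffAt_chartForm hy).continuousAt
  have : ContinuousAt (fun y ↦ (gramMatrix (chartForm c y)).det) y := by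
    simp only [Matrix.det_apply, gramMatrix, Matrix.of_apply]
    fun_prop
  exact this.sqrt.continuousWithinAt

variable [MeasurableSpace E] [BorelSpace E] [MeasurableSpace P] [BorelSpace P]

lemma aemeasurable_chartDensity_metric (c : P) :
    AEMeasurable (chartDensity (metric (E := E) (P := P)) c)
      (volume.restrict (extChartAt 𝓘(ℝ, E) c).target) :=
  ((continuousOn_sqrt_det c).aemeasurable (isOpen_extChartAt_target c).measurableSet).ennreal_ofReal

/-- The chart measures of two charts agree on the common domain, by the change of variables
formula. -/
lemma chartVolume_metric_eq {A : Set P} (hA : MeasurableSet A)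
    (hc : A ⊆ (chartAt E c).source) (hc' : A ⊆ (chartAt E c').source) :
    chartVolume (metric (E := E) (P := P)) c A = chartVolume (metric (E := E) (P := P)) c' A := by
  rw [← extChartAt_source 𝓘(ℝ, E)] at hc hc'
  rw [chartVolume_apply hA, chartVolume_apply hA]
  set s := (extChartAt 𝓘(ℝ, E) c).target ∩ (extChartAt 𝓘(ℝ, E) c).symm ⁻¹' A with hs
  have himg : (extChartAt 𝓘(ℝ, E) c').target ∩ (extChartAt 𝓘(ℝ, E) c').symm ⁻¹' A =
      transition c c' '' s := by
    ext z
    constructor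
    · rintro ⟨h1, h2⟩
      refine ⟨extChartAt 𝓘(ℝ, E) c ((extChartAt 𝓘(ℝ, E) c').symm z),
        ⟨(extChartAt 𝓘(ℝ, E) c).map_source (hc h2), ?_⟩, ?_⟩
      · rw [mem_preimage, (extChartAt 𝓘(ℝ, E) c).left_inv (hc h2)]; exact h2
      · rw [transition, Function.comp, (extChartAt 𝓘(ℝ, E) c).left_inv (hc h2),
          (extChartAt 𝓘(ℝ, E) c').right_inv h1]
    · rintro ⟨y, ⟨h1, h2⟩, rfl⟩
      refine ⟨(extChartAt 𝓘(ℝ, E) c').map_source (hc' h2), ?_⟩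
      rw [mem_preimage, transition, Function.comp, (extChartAt 𝓘(ℝ, E) c').left_inv (hc' h2)]
      exact h2
  rw [himg, lintegral_image_eq_lintegral_abs_det_fderiv_mul volume
    (measurableSet_target_inter_preimage c hA)
    (f' := fun y ↦ fderiv ℝ (transition c c') y)]
  · refine setLIntegral_congr_fun (measurableSet_target_inter_preimage c hA) fun y hy ↦ ?_
    have h1 := gramMatrix_transition (X := (id : P → P)) hy.1 (hc' hy.2) mdifferentiableAt_id
    have h2 : (gramMatrix (chartForm c y)).det = (fderiv ℝ (transition c c') y).det ^ 2 *
        (gramMatrix (chartForm c' (transition c c' y))).det := by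
      have := congrArg Matrix.det h1
      rw [Matrix.det_mul, Matrix.det_mul, Matrix.det_transpose, det_stdMatrix] at this
      refine Eq.trans this ?_
      rw [sq, mul_right_comm]
      rfl
    simp only [chartDensity_metric]
    rw [h2, Real.sqrt_mul (sq_nonneg _), Real.sqrt_sq_eq_abs, ENNReal.ofReal_mul (abs_nonneg _)]
  · intro y hy
    exact ((contDiffAt_transition hy.1 (hc' hy.2)).differentiableAt
      (by simp)).hasFDerivAt.hasFDerivWithinAt
  · intro y hy z hz hyz
    have h1 := (extChartAt 𝓘(ℝ, E) c').injOn (hc' hy.2) (hc' hz.2) hyz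
    exact (extChartAt 𝓘(ℝ, E) c).symm.injOn hy.1 hz.1 h1

variable [SecondCountableTopology P] [Nonempty P]

lemma riemannianVolume_metric_restrict_source (c : P) :
    (riemannianVolume (metric (E := E) (P := P))).restrict (chartAt E c).source =
      chartVolume (metric (E := E) (P := P)) c :=
  riemannianVolume_restrict_source (fun _ _ _ hA h h' ↦ chartVolume_metric_eq hA h h') c

/-- Integration over a chart domain in coordinates. -/
lemma integral_chart {φ : P → ℝ} (hφ : AEStronglyMeasurable φ
      ((riemannianVolume (metric (E := E) (P := P))).restrict (chartAt E c).source)) :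
    ∫ x in (chartAt E c).source, φ x ∂riemannianVolume (metric (E := E) (P := P)) =
      ∫ y in (extChartAt 𝓘(ℝ, E) c).target, √(gramMatrix (chartForm c y)).det *
        inChart c φ y := by
  rw [riemannianVolume_metric_restrict_source] at hφ ⊢
  rw [chartVolume] at hφ ⊢
  have h0 := (aemeasurable_chart_symm (E := E) c).mono_ac
    (withDensity_absolutelyContinuous _ (chartDensity (metric (E := E) (P := P)) c))
  have h1 := integral_map h0 hφ
  refine h1.trans ?_
  have h2 := integral_withDensity_eq_integral_toReal_smul₀ (aemeasurable_chartDensity_metric c)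
    (Eventually.of_forall fun y ↦ ENNReal.ofReal_lt_top)
    (fun y ↦ φ ((extChartAt 𝓘(ℝ, E) c).symm y))
  refine h2.trans ?_
  refine integral_congr_ae (Eventually.of_forall fun y ↦ ?_)
  simp only [chartDensity_metric, smul_eq_mul, ENNReal.toReal_ofReal (Real.sqrt_nonneg _)]

end MetricVolume

/-! ### The volume of the graph -/

section ChartAe

variable {E : Type*} [NormedAddCommGroup E] [InnerProductSpace ℝ E] [FiniteDimensional ℝ E]
  {P : Type*} [TopologicalSpace P] [ChartedSpace E P] [IsManifold 𝓘(ℝ, E) ∞ P]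
  [RiemannianBundle (fun x : P ↦ TangentSpace 𝓘(ℝ, E) x)]
  [IsContMDiffRiemannianBundle 𝓘(ℝ, E) ∞ E (fun x : P ↦ TangentSpace 𝓘(ℝ, E) x)]
  [MeasurableSpace E] [BorelSpace E] [MeasurableSpace P] [BorelSpace P]
  [SecondCountableTopology P] [Nonempty P]
  {c : P}

/-- A property which holds almost everywhere in a chart for Lebesgue measure holds almost everywhere
on the chart domain for the Riemannian volume. -/
lemma ae_of_ae_inChart {p : P → Prop} (h : ∀ᵐ y ∂volume.restrict (extChartAt 𝓘(ℝ, E) c).target,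
      p ((extChartAt 𝓘(ℝ, E) c).symm y)) :
    ∀ᵐ x ∂(riemannianVolume (metric (E := E) (P := P))).restrict (chartAt E c).source, p x := by
  obtain ⟨N, hN, hNm, hN0⟩ := exists_measurable_superset_of_null (mem_ae_iff.1 h)
  have hs : MeasurableSet (extChartAt 𝓘(ℝ, E) c).source :=
    (isOpen_extChartAt_source c).measurableSet
  set B : Set P := (extChartAt 𝓘(ℝ, E) c).source ∩ extChartAt 𝓘(ℝ, E) c ⁻¹' N with hB
  have hBm : MeasurableSet B := by
    have h1 : Measurable ((extChartAt 𝓘(ℝ, E) c).source.domRestrict (extChartAt 𝓘(ℝ, E) c)) :=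
      (continuousOn_extChartAt c).domRestrict.measurable
    convert hs.subtype_image (h1 hNm) using 1
    ext y
    exact ⟨fun h ↦ ⟨⟨y, h.1⟩, h.2, rfl⟩, fun ⟨x, hx, hxy⟩ ↦ hxy ▸ ⟨x.2, hx⟩⟩
  have hB0 : (riemannianVolume (metric (E := E) (P := P))) B = 0 := by
    have e : B = B ∩ (chartAt E c).source := by
      rw [← extChartAt_source 𝓘(ℝ, E)]
      exact (inter_eq_left.2 inter_subset_left).symm
    rw [e, ← Measure.restrict_apply hBm, riemannianVolume_metric_restrict_source,
      chartVolume_apply hBm]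
    refine setLIntegral_measure_zero _ _ (measure_mono_null ?_
      ((Measure.restrict_apply hNm).symm.trans hN0))
    rintro y ⟨hy, hy1, hy2⟩
    rw [mem_preimage, (extChartAt 𝓘(ℝ, E) c).right_inv hy] at hy2
    exact ⟨hy2, hy⟩
  rw [ae_restrict_iff' (chartAt E c).open_source.measurableSet]
  refine measure_mono_null (fun x hx ↦ ?_) hB0
  simp only [mem_compl_iff, mem_ofPred_eq, Classical.not_imp] at hx
  rw [← extChartAt_source 𝓘(ℝ, E)] at hx
  refine ⟨hx.1, hN ?_⟩
  simp only [mem_compl_iff, mem_ofPred_eq]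
  rw [(extChartAt 𝓘(ℝ, E) c).left_inv hx.1]
  exact hx.2

lemma aestronglyMeasurable_of_inChart {φ : P → ℝ}
    (h : AEStronglyMeasurable (inChart c φ) (volume.restrict (extChartAt 𝓘(ℝ, E) c).target)) :
    AEStronglyMeasurable φ
      ((riemannianVolume (metric (E := E) (P := P))).restrict (chartAt E c).source) := by
  obtain ⟨k, hk, hφk⟩ := h
  have h1 : AEMeasurable (k ∘ extChartAt 𝓘(ℝ, E) c)
      ((riemannianVolume (metric (E := E) (P := P))).restrict (chartAt E c).source) := by
    refine hk.measurable.comp_aemeasurable ?_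
    rw [← extChartAt_source 𝓘(ℝ, E)]
    exact (continuousOn_extChartAt c).aemeasurable (isOpen_extChartAt_source c).measurableSet
  refine h1.aestronglyMeasurable.congr ?_
  refine ae_of_ae_inChart (p := fun x ↦ (k ∘ extChartAt 𝓘(ℝ, E) c) x = φ x) ?_
  filter_upwards [hφk, ae_restrict_mem (isOpen_extChartAt_target c).measurableSet] with y hy hyt
  rw [Function.comp, (extChartAt 𝓘(ℝ, E) c).right_inv hyt]
  exact hy.symm

lemma integrableOn_chart {φ : P → ℝ}
    (h : IntegrableOn (fun y ↦ √(gramMatrix (chartForm c y)).det * inChart c φ y)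
      (extChartAt 𝓘(ℝ, E) c).target) :
    IntegrableOn φ (chartAt E c).source (riemannianVolume (metric (E := E) (P := P))) := by
  have hT := (isOpen_extChartAt_target (I := 𝓘(ℝ, E)) c).measurableSet
  have h1 : AEStronglyMeasurable (inChart c φ)
      (volume.restrict (extChartAt 𝓘(ℝ, E) c).target) := by
    have h2 : AEMeasurable (fun y ↦ √(gramMatrix (chartForm c y)).det)
      (volume.restrict (extChartAt 𝓘(ℝ, E) c).target) :=
      (continuousOn_sqrt_det c).aemeasurable hT
    refine ((h2.inv.aestronglyMeasurable).mul h.aestronglyMeasurable).congr ?_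
    filter_upwards [ae_restrict_mem hT] with y hy
    have := Real.sqrt_pos.2 (gramMatrix_chartForm_det_pos hy)
    simp only [Pi.mul_apply, Pi.inv_apply]
    field_simp
  have h2 := aestronglyMeasurable_of_inChart h1
  have h0 := (aemeasurable_chart_symm (E := E) c).mono_ac
    (withDensity_absolutelyContinuous _ (chartDensity (metric (E := E) (P := P)) c))
  rw [IntegrableOn]
  rw [riemannianVolume_metric_restrict_source, chartVolume] at h2 ⊢
  refine (integrable_map_measure h2 h0).2 ?_
  refine (integrable_withDensity_iff_integrable_smul₀' (aemeasurable_chartDensity_metric c)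
    (Eventually.of_forall fun y ↦ ENNReal.ofReal_lt_top)).2 ?_
  refine h.congr (Eventually.of_forall fun y ↦ ?_)
  simp only [chartDensity_metric, smul_eq_mul, ENNReal.toReal_ofReal (Real.sqrt_nonneg _)]
  rfl

lemma ae_of_forall_ae_chart {p : P → Prop} {μ : Measure P}
    (h : ∀ c : P, ∀ᵐ x ∂μ.restrict (chartAt E c).source, p x) : ∀ᵐ x ∂μ, p x := by
  obtain ⟨a, ha⟩ := exists_chart_cover (E := E) (P := P)
  have := (ae_restrict_iUnion_iff (μ := μ) (fun k ↦ (chartAt E (a k)).source) p).2 fun k ↦ h (a k)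
  rwa [ha, Measure.restrict_univ] at this
end ChartAe

section Hypersurface

variable {E : Type*} [NormedAddCommGroup E] [InnerProductSpace ℝ E] [FiniteDimensional ℝ E]
  {F : Type*} [NormedAddCommGroup F] [InnerProductSpace ℝ F] [FiniteDimensional ℝ F]
  {P : Type*} [TopologicalSpace P] [ChartedSpace E P] [IsManifold 𝓘(ℝ, E) ∞ P]
  {M : Type*} [TopologicalSpace M] [ChartedSpace F M] [IsManifold 𝓘(ℝ, F) ∞ M]
  [RiemannianBundle (fun p : M ↦ TangentSpace 𝓘(ℝ, F) p)]
  [RiemannianBundle (fun x : P ↦ TangentSpace 𝓘(ℝ, E) x)]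
  [IsContMDiffRiemannianBundle 𝓘(ℝ, F) ∞ F (fun p : M ↦ TangentSpace 𝓘(ℝ, F) p)]
  [IsContMDiffRiemannianBundle 𝓘(ℝ, E) ∞ E (fun x : P ↦ TangentSpace 𝓘(ℝ, E) x)]
  {Y : ∀ p : M, TangentSpace 𝓘(ℝ, F) p}
  {ϑ : Diffeomorph (𝓘(ℝ, E).prod 𝓘(ℝ, ℝ)) 𝓘(ℝ, F) (P × ℝ) M ∞}
  {c : P} {y : E} {u : P → ℝ}

/-- The function `W = √(e^{2ψ} + |∇u|²)` on `P`. -/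
def graphSlope (Y : ∀ p : M, TangentSpace 𝓘(ℝ, F) p) (ϑ : P × ℝ → M) (u : P → ℝ) (x : P) : ℝ :=
  √(Real.exp (2 * potential Y (ϑ (x, 0))) + ‖grad (E := E) u x‖ ^ 2)

lemma graphSlope_pos (x : P) : 0 < graphSlope (E := E) Y ϑ u x :=
  Real.sqrt_pos.2 (by positivity)

lemma contMDiff_leafPotential (h : IsFlowFromLeaf Y ϑ) :
    ContMDiff 𝓘(ℝ, E) 𝓘(ℝ, ℝ) ∞ (fun x ↦ potential Y (ϑ (x, 0))) := by
  intro x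
  have h1 : ContMDiffAt 𝓘(ℝ, E) 𝓘(ℝ, ℝ) ∞ (chartPotential Y ϑ x ∘ extChartAt 𝓘(ℝ, E) x) x :=
    (contDiffAt_chartPotential h (mem_extChartAt_target x)).contMDiffAt.comp x
      (contMDiffAt_chart (mem_extChartAt_source x))
  refine h1.congr_of_eventuallyEq ?_
  filter_upwards [(isOpen_extChartAt_source (I := 𝓘(ℝ, E)) x).eventually_mem
    (mem_extChartAt_source x)] with z hz
  simp only [Function.comp, chartPotential, (extChartAt 𝓘(ℝ, E) x).left_inv hz]

lemma graphSlope_inChart (hy : y ∈ (extChartAt 𝓘(ℝ, E) c).target)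
    (hu : MDifferentiableAt 𝓘(ℝ, E) 𝓘(ℝ, ℝ) u ((extChartAt 𝓘(ℝ, E) c).symm y)) :
    graphSlope (E := E) Y ϑ u ((extChartAt 𝓘(ℝ, E) c).symm y) =
      slope (chartForm c) (chartPotential Y ϑ c) (inChart c u) y := slope_inChart hy hu

lemma continuousAt_norm_grad_sq {x : P} (hu : ∀ᶠ z in 𝓝 x, ContMDiffAt 𝓘(ℝ, E) 𝓘(ℝ, ℝ) ∞ u z) :
    ContinuousAt (fun x ↦ ‖grad (E := E) u x‖ ^ 2) x := by
  have hx := mem_extChartAt_target (I := 𝓘(ℝ, E)) x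
  have hux : ContMDiffAt 𝓘(ℝ, E) 𝓘(ℝ, ℝ) ∞ u
      ((extChartAt 𝓘(ℝ, E) x).symm (extChartAt 𝓘(ℝ, E) x x)) := by
    rw [extChartAt_to_inv]; exact hu.self_of_nhds
  have hud : ContDiffAt ℝ ∞ (inChart x u) (extChartAt 𝓘(ℝ, E) x x) :=
    contDiffAt_inChart le_rfl hx hux
  have h1 : ContinuousAt (fun y ↦ fderiv ℝ (inChart x u) y
      (gradVec (chartForm x) (inChart x u) y)) (extChartAt 𝓘(ℝ, E) x x) :=
    (((hud.fderiv_right (m := 1) (by norm_cast)).clm_apply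
      (contDiffAt_gradVec ((contDiffAt_chartForm hx).of_le (by norm_cast))
        (hud.of_le (by norm_cast)) (chartForm_pos hx)))).continuousAt
  have h2 := ContinuousAt.comp (x := x) h1 (continuousAt_extChartAt (I := 𝓘(ℝ, E)) x)
  refine h2.congr ?_
  filter_upwards [(isOpen_extChartAt_source (I := 𝓘(ℝ, E)) x).eventually_mem
    (mem_extChartAt_source x), hu] with z hz huz
  have hz' : (extChartAt 𝓘(ℝ, E) x).symm (extChartAt 𝓘(ℝ, E) x z) = z :=
    (extChartAt 𝓘(ℝ, E) x).left_inv hz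
  have h3 := norm_grad_sq (u := u) ((extChartAt 𝓘(ℝ, E) x).map_source hz)
    (by rw [hz']; exact huz.mdifferentiableAt (by simp))
  rw [hz'] at h3
  exact h3.symm

lemma continuousAt_graphSlope (h : IsFlowFromLeaf Y ϑ) {x : P}
    (hu : ∀ᶠ z in 𝓝 x, ContMDiffAt 𝓘(ℝ, E) 𝓘(ℝ, ℝ) ∞ u z) :
    ContinuousAt (graphSlope (E := E) Y ϑ u) x :=
  (((contMDiff_leafPotential h).continuous.continuousAt.const_mul 2).rexp.add
    (continuousAt_norm_grad_sq hu)).sqrt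

variable [MeasurableSpace E] [BorelSpace E] [MeasurableSpace P] [BorelSpace P]
  [SecondCountableTopology P] [Nonempty P]

lemma measurable_graphDensity (h : IsFlowFromLeaf Y ϑ) {Ω : Set P} (hΩ : IsOpen Ω)
    (hu : ContMDiffOn 𝓘(ℝ, E) 𝓘(ℝ, ℝ) ∞ u Ω) : Measurable (Ω.indicator fun x ↦
      ENNReal.ofReal (Real.exp (-potential Y (ϑ (x, 0))) * graphSlope (E := E) Y ϑ u x)) := by
  classical
  rw [← piecewise_eq_indicator]
  refine ContinuousOn.measurable_piecewise (fun x hx ↦ ?_) continuousOn_const hΩ.measurableSet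
  have hW : ContinuousAt (graphSlope (E := E) Y ϑ u) x :=
    continuousAt_graphSlope h ((hΩ.eventually_mem hx).mono fun x hx ↦
      hu.contMDiffAt (hΩ.mem_nhds hx))
  have hψ : Continuous fun x ↦ potential Y (ϑ (x, 0)) :=
    (contMDiff_leafPotential (E := E) h).continuous
  exact (ENNReal.continuous_ofReal.continuousAt.comp
    (hψ.continuousAt.neg.rexp.mul hW)).continuousWithinAt

/-- The volume element of the graph is `e^{-ψ} W` times that of `P`. -/
lemma riemannianVolume_graph (hY : IsKilling Y) (h : IsFlowFromLeaf Y ϑ) {Ω : Set P}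
    (hΩ : IsOpen Ω) (hu : ContMDiffOn 𝓘(ℝ, E) 𝓘(ℝ, ℝ) ∞ u Ω) :
    (riemannianVolume (inducedMetric (E := E) (F := F) (graphMap ϑ u))).restrict Ω =
      (riemannianVolume (metric (E := E) (P := P))).withDensity (Ω.indicator fun x ↦
        ENNReal.ofReal (Real.exp (-potential Y (ϑ (x, 0))) * graphSlope (E := E) Y ϑ u x)) := by
  have huA : ∀ x ∈ Ω, ContMDiffAt 𝓘(ℝ, E) 𝓘(ℝ, ℝ) ∞ u x := fun x hx ↦
    hu.contMDiffAt (hΩ.mem_nhds hx)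
  refine riemannianVolume_restrict_withDensity hΩ.measurableSet
    (measurable_graphDensity h hΩ hu) aemeasurable_chartDensity_metric fun c y hy hyΩ ↦ ?_
  have hud : ContDiffAt ℝ ∞ (inChart c u) y := contDiffAt_inChart le_rfl hy (huA _ hyΩ)
  have hum := (huA _ hyΩ).mdifferentiableAt (by simp)
  have hdet := gramMatrix_chartForm_det_pos hy
  rw [chartDensity, chartGram_inducedMetric hy (mdifferentiableAt_graphMap hum),
    gramMatrix_graph hY h hy (hud.differentiableAt (by simp)),
    det_add_smul_vecMulVec hdet.ne'.isUnit, chartDensity_metric, graphSlope_inChart hy hum,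
    ← ENNReal.ofReal_mul (Real.sqrt_nonneg _), Real.sqrt_mul hdet.le, slope]
  congr 2
  have h1 : dotProduct (coords (fderiv ℝ (inChart c u) y))
      ((gramMatrix (chartForm c y))⁻¹.mulVec (coords (fderiv ℝ (inChart c u) y))) =
      fderiv ℝ (inChart c u) y (gradVec (chartForm c) (inChart c u) y) := by
    rw [clm_apply_eq, gradVec, vcoords_inverse (fun a b ↦ pullbackForm_comm _ _ a b)
      (chartForm_pos hy)]
  have h2 : Real.exp (-chartPotential Y ϑ c y) =
      √(Real.exp (-(2 * chartPotential Y ϑ c y))) := by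
    rw [Real.sqrt_eq_rpow, ← Real.exp_mul]; congr 1; ring
  change _ = Real.exp (-chartPotential Y ϑ c y) * _
  rw [h2, ← Real.sqrt_mul (Real.exp_pos _).le, mul_add, ← Real.exp_add]
  simp only [neg_add_cancel, Real.exp_zero]
  rw [← h1]
end Hypersurface

/-! ### Integration by parts for locally Lipschitz functions -/

section LocalParts

variable {E : Type*} [NormedAddCommGroup E] [InnerProductSpace ℝ E] [FiniteDimensional ℝ E]
  [MeasurableSpace E] [BorelSpace E]

/-- Integration by parts for a Lipschitz function against a compactly supported vector field. -/
lemma integral_lineDeriv_add_eq_zero {g : E → ℝ} {C : ℝ≥0} (hg : LipschitzWith C g) {V : E → E}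
    (hV : ContDiff ℝ 1 V) (hVc : HasCompactSupport V) :
    Integrable (fun y ↦ ∑ i, (lineDeriv ℝ g y (stdOrthonormalBasis ℝ E i) *
      inner ℝ (stdOrthonormalBasis ℝ E i) (V y) + g y * inner ℝ (stdOrthonormalBasis ℝ E i)
        (fderiv ℝ V y (stdOrthonormalBasis ℝ E i)))) ∧
    ∫ y, ∑ i, (lineDeriv ℝ g y (stdOrthonormalBasis ℝ E i) *
      inner ℝ (stdOrthonormalBasis ℝ E i) (V y) + g y * inner ℝ (stdOrthonormalBasis ℝ E i)
        (fderiv ℝ V y (stdOrthonormalBasis ℝ E i))) = 0 := by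
  set e := stdOrthonormalBasis ℝ E with he
  have hVi : ∀ i, ContDiff ℝ 1 (fun y ↦ inner ℝ (e i) (V y)) := fun i ↦ contDiff_const.inner ℝ hV
  have hVic : ∀ i, HasCompactSupport (fun y ↦ inner ℝ (e i) (V y)) := fun i ↦
    hVc.comp_left (g := fun v ↦ inner ℝ (e i) v) (inner_zero_right _)
  have hd : ∀ i y, fderiv ℝ (fun y ↦ inner ℝ (e i) (V y)) y (e i) =
      inner ℝ (e i) (fderiv ℝ V y (e i)) := by
    intro i y
    have h1 := ((innerSL ℝ (e i)).hasFDerivAt (x := V y)).comp y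
      (hV.differentiable (by norm_num) y).hasFDerivAt
    exact congrArg (fun T : E →L[ℝ] ℝ ↦ T (e i)) h1.fderiv
  have hI1 : ∀ i, Integrable (fun y ↦ lineDeriv ℝ g y (e i) * inner ℝ (e i) (V y)) := fun i ↦
    (hg.locallyIntegrable_lineDeriv (μ := volume) (e i)).integrable_smul_right_of_hasCompactSupport
      (hVi i).continuous (hVic i)
  have hI2 : ∀ i, Integrable (fun y ↦ g y * inner ℝ (e i) (fderiv ℝ V y (e i))) := by
    intro i
    simp only [← hd]
    refine Continuous.integrable_of_hasCompactSupport (hg.continuous.mul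
      (((hVi i).continuous_fderiv (by norm_num)).clm_apply continuous_const)) ?_
    exact ((hVic i).fderiv_apply ℝ (e i)).mul_left
  have hI : ∀ i ∈ Finset.univ, Integrable (fun y ↦ lineDeriv ℝ g y (e i) * inner ℝ (e i) (V y) +
      g y * inner ℝ (e i) (fderiv ℝ V y (e i))) := fun i _ ↦ (hI1 i).add (hI2 i)
  refine ⟨integrable_finsetSum _ hI, ?_⟩
  rw [integral_finsetSum _ hI]
  refine Finset.sum_eq_zero fun i _ ↦ ?_
  obtain ⟨D, hD⟩ := ContDiff.lipschitzWith_of_hasCompactSupport (hVic i) (hVi i) (by norm_num)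
  rw [integral_add (hI1 i) (hI2 i), LipschitzWith.integral_lineDeriv_mul_eq hg hD (hVic i),
    ← integral_add _ (hI2 i)]
  · refine (integral_congr_ae (Eventually.of_forall fun y ↦ ?_)).trans (integral_zero _ _)
    rw [((hVi i).differentiable (by norm_num) y).lineDeriv_eq_fderiv, map_neg, hd]
    ring
  · refine (hI2 i).neg.congr (Eventually.of_forall fun y ↦ ?_)
    simp only [Pi.neg_apply]
    rw [((hVi i).differentiable (by norm_num) y).lineDeriv_eq_fderiv, map_neg, hd]
    ring

/-- The divergence theorem on an open set for `f V`, where `f` is locally Lipschitz and vanishes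
off a compact subset. -/
lemma setIntegral_div_eq_zero {U K : Set E} (hU : IsOpen U) (hK : IsCompact K) (hKU : K ⊆ U)
    {f : E → ℝ} (hf : LocallyLipschitzOn U f) (hfK : ∀ y ∈ U, y ∉ K → f y = 0) {V : E → E}
    (hV : ∀ y ∈ U, ContDiffAt ℝ 1 V y) :
    IntegrableOn (fun y ↦ fderiv ℝ f y (V y) + f y * ∑ i, inner ℝ (stdOrthonormalBasis ℝ E i)
        (fderiv ℝ V y (stdOrthonormalBasis ℝ E i))) U ∧
    ∫ y in U, (fderiv ℝ f y (V y) + f y * ∑ i, inner ℝ (stdOrthonormalBasis ℝ E i)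
        (fderiv ℝ V y (stdOrthonormalBasis ℝ E i))) = 0 := by
  set e := stdOrthonormalBasis ℝ E with he
  -- `f` is replaced by a global Lipschitz function `g` which agrees with it on the compact set `N`,
  -- and `V` by `χ V` for a cutoff `χ` supported in the smaller set `L` and equal to one near `K`
  obtain ⟨L, hL, hKL, hLU⟩ := exists_compact_between hK hU hKU
  obtain ⟨N, hN, hLN, hNU⟩ := exists_compact_between hL hU hLU
  obtain ⟨χ, hχ1, hχ0, -⟩ := exists_contMDiffMap_one_nhds_of_subset_interior (n := 1) 𝓘(ℝ, E)
    hK.isClosed hKL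
  have hχd : ContDiff ℝ 1 χ := χ.contMDiff.contDiff
  obtain ⟨C, hC⟩ := (hf.mono hNU).exists_lipschitzOnWith_of_compact hN
  obtain ⟨g, hg, hfg⟩ := hC.extend_real
  have hV'd : ContDiff ℝ 1 (fun y ↦ χ y • V y) := by
    rw [contDiff_iff_contDiffAt]
    intro y
    by_cases hy : y ∈ U
    · exact hχd.contDiffAt.smul (hV y hy)
    · have : (fun y ↦ χ y • V y) =ᶠ[𝓝 y] fun _ ↦ 0 := by
        filter_upwards [hL.isClosed.isOpen_compl.mem_nhds fun h ↦ hy (hLU h)] with z hz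
        rw [hχ0 z hz, zero_smul]
      exact contDiffAt_const.congr_of_eventuallyEq this
  have hV'0 : ∀ y, y ∉ L → (fun y ↦ χ y • V y) =ᶠ[𝓝 y] 0 := by
    intro y hy
    filter_upwards [hL.isClosed.isOpen_compl.mem_nhds hy] with z hz
    rw [hχ0 z hz, zero_smul]; rfl
  have hV'c : HasCompactSupport (fun y ↦ χ y • V y) :=
    HasCompactSupport.intro hL fun y hy ↦ by rw [hχ0 y hy, zero_smul]
  obtain ⟨hint, hzero⟩ := integral_lineDeriv_add_eq_zero hg hV'd hV'c
  have hmain : ∀ᵐ y, y ∈ U → ∑ i, (lineDeriv ℝ g y (e i) * inner ℝ (e i) (χ y • V y) +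
      g y * inner ℝ (e i) (fderiv ℝ (fun y ↦ χ y • V y) y (e i))) =
      fderiv ℝ f y (V y) + f y * ∑ i, inner ℝ (e i) (fderiv ℝ V y (e i)) := by
    filter_upwards [hg.ae_differentiableAt] with y hgy hyU
    have hfg' : y ∈ interior N → f =ᶠ[𝓝 y] g := fun h ↦
      eventually_of_mem (mem_interior_iff_mem_nhds.1 h) hfg
    by_cases hyK : y ∈ K
    · have hyN : y ∈ interior N := hLN (interior_subset (hKL hyK))
      have hVy : (fun y ↦ χ y • V y) =ᶠ[𝓝 y] V := by
        filter_upwards [hχ1.filter_mono (nhds_le_nhdsSet hyK)] with z hz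
        rw [hz, one_smul]
      have hVy' : χ y • V y = V y := hVy.self_of_nhds
      rw [hVy.fderiv_eq, (hfg' hyN).fderiv_eq, (hfg' hyN).self_of_nhds, hVy',
        Finset.sum_add_distrib, Finset.mul_sum]
      congr 1
      conv_rhs => rw [← sum_vcoords (V y), map_sum]
      refine Finset.sum_congr rfl fun i _ ↦ ?_
      rw [hgy.lineDeriv_eq_fderiv, map_smul, vcoords, smul_eq_mul, mul_comm]
    · have hf0 : f =ᶠ[𝓝 y] 0 := by
        filter_upwards [(hU.sdiff hK.isClosed).mem_nhds ⟨hyU, hyK⟩] with z hz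
        exact hfK z hz.1 hz.2
      rw [hf0.fderiv_eq, hf0.self_of_nhds]
      have hr : ∀ a : ℝ, fderiv ℝ (0 : E → ℝ) y (V y) + (0 : E → ℝ) y * a = 0 := by
        intro a
        rw [show (0 : E → ℝ) = fun _ ↦ 0 from rfl, fderiv_fun_const]
        simp
      rw [hr]
      refine Finset.sum_eq_zero fun i _ ↦ ?_
      by_cases hyL : y ∈ L
      · have hg0 : g =ᶠ[𝓝 y] 0 := (hfg' (hLN hyL)).symm.trans hf0
        rw [hgy.lineDeriv_eq_fderiv, hg0.fderiv_eq, hg0.self_of_nhds,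
          show (0 : E → ℝ) = fun _ ↦ 0 from rfl, fderiv_fun_const]
        simp
      · rw [(hV'0 y hyL).fderiv_eq, show χ y • V y = 0 from (hV'0 y hyL).self_of_nhds,
          show (0 : E → E) = fun _ ↦ 0 from rfl, fderiv_fun_const]
        simp
  have hmain' := (ae_restrict_iff' (μ := volume) hU.measurableSet).2 hmain
  refine ⟨hint.integrableOn.congr hmain', ?_⟩
  rw [← integral_congr_ae hmain', setIntegral_eq_integral_of_forall_compl_eq_zero, hzero]
  intro y hy
  have hyL : y ∉ L := fun h ↦ hy (hLU h)
  refine Finset.sum_eq_zero fun i _ ↦ ?_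
  rw [(hV'0 y hyL).fderiv_eq, show χ y • V y = 0 from (hV'0 y hyL).self_of_nhds,
    show (0 : E → E) = fun _ ↦ 0 from rfl, fderiv_fun_const]
  simp
end LocalParts

/-! ### The weak mean curvature equation -/

section Parts

variable {E : Type*} [NormedAddCommGroup E] [InnerProductSpace ℝ E] [FiniteDimensional ℝ E]
  {F : Type*} [NormedAddCommGroup F] [InnerProductSpace ℝ F] [FiniteDimensional ℝ F]
  {P : Type*} [TopologicalSpace P] [ChartedSpace E P] [IsManifold 𝓘(ℝ, E) ∞ P]
  {M : Type*} [TopologicalSpace M] [ChartedSpace F M] [IsManifold 𝓘(ℝ, F) ∞ M]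
  [RiemannianBundle (fun p : M ↦ TangentSpace 𝓘(ℝ, F) p)]
  [RiemannianBundle (fun x : P ↦ TangentSpace 𝓘(ℝ, E) x)]
  [IsContMDiffRiemannianBundle 𝓘(ℝ, F) ∞ F (fun p : M ↦ TangentSpace 𝓘(ℝ, F) p)]
  [IsContMDiffRiemannianBundle 𝓘(ℝ, E) ∞ E (fun x : P ↦ TangentSpace 𝓘(ℝ, E) x)]
  {Y : ∀ p : M, TangentSpace 𝓘(ℝ, F) p}
  {ϑ : Diffeomorph (𝓘(ℝ, E).prod 𝓘(ℝ, ℝ)) 𝓘(ℝ, F) (P × ℝ) M ∞}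
  {c : P} {y : E} {u φ : P → ℝ}

/-- A function on `P` that is locally Lipschitz in every chart. -/
def LocallyLipschitzInCharts (E : Type*) [NormedAddCommGroup E] [InnerProductSpace ℝ E]
    {P : Type*} [TopologicalSpace P] [ChartedSpace E P] (φ : P → ℝ) : Prop :=
  ∀ c : P, LocallyLipschitzOn (extChartAt 𝓘(ℝ, E) c).target (inChart (E := E) c φ)

/-- The integrand `(⟨∇φ, ∇u⟩ / W + n φ H_{Dψ}) e^{-(D+1)ψ}`, which is the divergence of
`φ e^{-(D+1)ψ} ∇u / W`. -/
def divIntegrand (Y : ∀ p : M, TangentSpace 𝓘(ℝ, F) p) (ϑ : P × ℝ → M) (u : P → ℝ) (D : ℝ)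
    (φ : P → ℝ) (x : P) : ℝ :=
  (metric x (grad (E := E) φ x) (grad (E := E) u x) / graphSlope (E := E) Y ϑ u x +
    φ x * (Module.finrank ℝ E * weightedMeanCurvature (E := E) (F := F)
      (fun p ↦ D * potential Y p) (graphMap ϑ u) (upwardNormal (E := E) Y ϑ u) x)) *
    Real.exp (-((D + 1) * potential Y (ϑ (x, 0))))

lemma mdifferentiableAt_of_inChart (hy : y ∈ (extChartAt 𝓘(ℝ, E) c).target)
    (hφ : DifferentiableAt ℝ (inChart c φ) y) :
    MDifferentiableAt 𝓘(ℝ, E) 𝓘(ℝ, ℝ) φ ((extChartAt 𝓘(ℝ, E) c).symm y) := by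
  set x := (extChartAt 𝓘(ℝ, E) c).symm y with hx
  have hxs : x ∈ (extChartAt 𝓘(ℝ, E) c).source := (extChartAt 𝓘(ℝ, E) c).map_target hy
  have hyx : extChartAt 𝓘(ℝ, E) c x = y := (extChartAt 𝓘(ℝ, E) c).right_inv hy
  have h1 : MDifferentiableAt 𝓘(ℝ, E) 𝓘(ℝ, ℝ) (inChart c φ) (extChartAt 𝓘(ℝ, E) c x) := by
    rw [hyx]; exact hφ.mdifferentiableAt
  have h2 : MDifferentiableAt 𝓘(ℝ, E) 𝓘(ℝ, ℝ) (inChart c φ ∘ extChartAt 𝓘(ℝ, E) c) x :=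
    h1.comp x ((contMDiffAt_chart hxs).mdifferentiableAt (by simp))
  refine h2.congr_of_eventuallyEq ?_
  filter_upwards [(isOpen_extChartAt_source (I := 𝓘(ℝ, E)) c).eventually_mem hxs] with z hz
  simp only [Function.comp, inChart, (extChartAt 𝓘(ℝ, E) c).left_inv hz]

lemma differentiableAt_inChart (hy : y ∈ (extChartAt 𝓘(ℝ, E) c).target)
    (hφ : MDifferentiableAt 𝓘(ℝ, E) 𝓘(ℝ, ℝ) φ ((extChartAt 𝓘(ℝ, E) c).symm y)) :
    DifferentiableAt ℝ (inChart c φ) y :=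
  (hφ.comp y ((contMDiffAt_chart_symm hy).mdifferentiableAt (by simp))).differentiableAt

/-- In a chart, `divIntegrand` times the volume density is the coordinate divergence of `φ` times
the flux. This holds without a differentiability hypothesis on `φ`, as both derivatives of `φ`
take the value zero where it is not differentiable. -/
lemma divIntegrand_inChart (hY : IsKilling Y) (h : IsFlowFromLeaf Y ϑ) (D : ℝ)
    (hn : Module.finrank ℝ E ≠ 0) (hy : y ∈ (extChartAt 𝓘(ℝ, E) c).target)
    (hu : ContMDiffAt 𝓘(ℝ, E) 𝓘(ℝ, ℝ) ∞ u ((extChartAt 𝓘(ℝ, E) c).symm y)) :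
    √(gramMatrix (chartForm c y)).det *
        divIntegrand (E := E) Y ϑ u D φ ((extChartAt 𝓘(ℝ, E) c).symm y) =
      fderiv ℝ (inChart c φ) y (flux (chartForm c) (chartPotential Y ϑ c) (inChart c u) D y) +
      inChart c φ y * ∑ i, inner ℝ (stdOrthonormalBasis ℝ E i) (fderiv ℝ (flux (chartForm c)
        (chartPotential Y ϑ c) (inChart c u) D) y (stdOrthonormalBasis ℝ E i)) := by
  have hum := hu.mdifferentiableAt (by simp)
  have h1 : metric ((extChartAt 𝓘(ℝ, E) c).symm y) (grad (E := E) φ _) (grad (E := E) u _) =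
      fderiv ℝ (inChart c φ) y (gradVec (E := E) (chartForm c) (inChart c u) y) := by
    refine (inner_grad φ _ _).trans ?_
    by_cases hφ : MDifferentiableAt 𝓘(ℝ, E) 𝓘(ℝ, ℝ) φ ((extChartAt 𝓘(ℝ, E) c).symm y)
    · rw [fderiv_inChart hy hφ, grad_eq_gradVec hy hum]
    · rw [fderiv_zero_of_not_differentiableAt fun h ↦ hφ (mdifferentiableAt_of_inChart hy h),
        mfderiv_zero_of_not_mdifferentiableAt hφ]
      rfl
  rw [weightedMeanCurvature_eq_div hY h D hn hy hu, divIntegrand, h1,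
    graphSlope_inChart hy hum, flux, map_smul, weightDensity, smul_eq_mul]
  change _ = _ + φ _ * _
  ring

lemma divIntegrand_eq_zero {K : Set P} (hK : IsClosed K) (hφK : ∀ x, x ∉ K → φ x = 0) (D : ℝ)
    {x : P} (hx : x ∉ K) : divIntegrand (E := E) Y ϑ u D φ x = 0 := by
  have h1 : φ =ᶠ[𝓝 x] fun _ ↦ 0 := by
    filter_upwards [hK.isOpen_compl.mem_nhds hx] with z hz using hφK z hz
  have h2 : metric x (grad (E := E) φ x) (grad (E := E) u x) = 0 := by
    refine (inner_grad φ _ _).trans ?_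
    have h3 : mfderiv 𝓘(ℝ, E) 𝓘(ℝ, ℝ) φ x = 0 :=
      h1.mfderiv_eq.trans mfderiv_const
    rw [h3]; rfl
  rw [divIntegrand, h2, hφK x hx]
  simp

variable [MeasurableSpace E] [BorelSpace E] [T2Space P] [MeasurableSpace P] [BorelSpace P]
  [SecondCountableTopology P] [Nonempty P]

/-- The divergence theorem for test functions supported in a chart domain. -/
lemma integral_divIntegrand_of_subset_source (hY : IsKilling Y) (h : IsFlowFromLeaf Y ϑ) (D : ℝ)
    (hn : Module.finrank ℝ E ≠ 0) {Ω K : Set P} (hΩ : IsOpen Ω)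
    (hu : ContMDiffOn 𝓘(ℝ, E) 𝓘(ℝ, ℝ) ∞ u Ω)
    (hφ : LocallyLipschitzOn (extChartAt 𝓘(ℝ, E) c).target (inChart c φ)) (hK : IsCompact K)
    (hKΩ : K ⊆ Ω) (hKc : K ⊆ (chartAt E c).source) (hφK : ∀ x, x ∉ K → φ x = 0) :
    Integrable (divIntegrand (E := E) Y ϑ u D φ) (riemannianVolume (metric (E := E) (P := P))) ∧
    ∫ x, divIntegrand (E := E) Y ϑ u D φ x ∂riemannianVolume (metric (E := E) (P := P)) = 0 := by
  have huA : ∀ x ∈ Ω, ContMDiffAt 𝓘(ℝ, E) 𝓘(ℝ, ℝ) ∞ u x := fun x hx ↦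
    hu.contMDiffAt (hΩ.mem_nhds hx)
  have hKc' : K ⊆ (extChartAt 𝓘(ℝ, E) c).source := by rwa [extChartAt_source]
  have hT := isOpen_extChartAt_target (I := 𝓘(ℝ, E)) c
  set U : Set E := (extChartAt 𝓘(ℝ, E) c).target ∩ (extChartAt 𝓘(ℝ, E) c).symm ⁻¹' Ω with hU
  have hUo : IsOpen U := (continuousOn_extChartAt_symm c).isOpen_inter_preimage hT hΩ
  set K' : Set E := extChartAt 𝓘(ℝ, E) c '' K with hK'
  have hK'c : IsCompact K' := hK.image_of_continuousOn ((continuousOn_extChartAt c).mono hKc')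
  have hK'U : K' ⊆ U := by
    rintro _ ⟨x, hx, rfl⟩
    refine ⟨(extChartAt 𝓘(ℝ, E) c).map_source (hKc' hx), ?_⟩
    rw [mem_preimage, (extChartAt 𝓘(ℝ, E) c).left_inv (hKc' hx)]
    exact hKΩ hx
  have hz : ∀ y ∈ (extChartAt 𝓘(ℝ, E) c).target, y ∉ K' →
      (extChartAt 𝓘(ℝ, E) c).symm y ∉ K := by
    intro y hy hyK hyK'
    exact hyK ⟨_, hyK', (extChartAt 𝓘(ℝ, E) c).right_inv hy⟩
  obtain ⟨hI, h0⟩ := setIntegral_div_eq_zero hUo hK'c hK'U (hφ.mono inter_subset_left)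
    (fun y hy hyK ↦ hφK _ (hz y hy.1 hyK))
    (V := flux (chartForm c) (chartPotential Y ϑ c) (inChart c u) D) (fun y hy ↦
      contDiffAt_flux ((contDiffAt_chartForm hy.1).of_le (by norm_cast))
        (fun a b ↦ pullbackForm_comm _ _ a b) (chartForm_pos hy.1)
        ((contDiffAt_inChart le_rfl hy.1 (huA _ hy.2)).of_le (by norm_cast))
        ((contDiffAt_chartPotential h hy.1).of_le (by norm_cast)))
  have heq : ∀ y ∈ U, _ = _ := fun y hy ↦ divIntegrand_inChart (φ := φ) hY h D hn hy.1 (huA _ hy.2)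
  have hoff : ∀ y ∈ (extChartAt 𝓘(ℝ, E) c).target, y ∉ U → √(gramMatrix (chartForm c y)).det *
      inChart c (divIntegrand (E := E) Y ϑ u D φ) y = 0 := by
    intro y hy hyU
    have := divIntegrand_eq_zero (E := E) (Y := Y) (ϑ := ϑ) (u := u) hK.isClosed hφK D
      (hz y hy fun h ↦ hyU (hK'U h))
    simp only [inChart]
    rw [this, mul_zero]
  have hI' : IntegrableOn (fun y ↦ √(gramMatrix (chartForm c y)).det *
      inChart c (divIntegrand (E := E) Y ϑ u D φ) y) (extChartAt 𝓘(ℝ, E) c).target := by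
    refine IntegrableOn.of_forall_sdiff_eq_zero (s := U) ?_ hT.measurableSet
      fun y hy ↦ hoff y hy.1 hy.2
    exact (integrableOn_congr_fun heq hUo.measurableSet).2 hI
  have hIs := integrableOn_chart hI'
  have hns : ∀ x, x ∉ (chartAt E c).source → divIntegrand (E := E) Y ϑ u D φ x = 0 := fun x hx ↦
    divIntegrand_eq_zero hK.isClosed hφK D fun h ↦ hx (hKc h)
  refine ⟨(integrableOn_iff_integrable_of_support_subset fun x hx ↦ ?_).1 hIs, ?_⟩
  · by_contra hxs
    exact hx (hns x hxs)
  · rw [← setIntegral_eq_integral_of_forall_compl_eq_zero hns,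
      integral_chart hIs.aestronglyMeasurable,
      setIntegral_eq_of_subset_of_forall_sdiff_eq_zero hT.measurableSet inter_subset_left
        (fun y hy ↦ hoff y hy.1 hy.2)]
    exact (setIntegral_congr_fun hUo.measurableSet heq).trans h0

end Parts

section LocallyLipschitz

lemma locallyLipschitzOn_comp {α β : Type*} [PseudoEMetricSpace α] [PseudoEMetricSpace β]
    {γ : Type*} [PseudoEMetricSpace γ] {f : α → β} {s : Set α} {G : β → γ} {t : Set β}
    (hf : LocallyLipschitzOn s f) (hG : LocallyLipschitzOn t G) (hst : MapsTo f s t) :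
    LocallyLipschitzOn s (G ∘ f) := by
  intro x hx
  obtain ⟨K, a, ha, hK⟩ := hf hx
  obtain ⟨L, b, hb, hL⟩ := hG (hst hx)
  have h1 : Tendsto f (𝓝[s] x) (𝓝[t] f x) :=
    tendsto_nhdsWithin_iff.2 ⟨hf.continuousOn x hx,
    eventually_mem_nhdsWithin.mono fun z hz ↦ hst hz⟩
  exact ⟨L * K, a ∩ f ⁻¹' b, inter_mem ha (h1 hb), hL.comp (hK.mono inter_subset_left)
    fun z hz ↦ hz.2⟩

lemma locallyLipschitzOn_of_contDiffAt {E F : Type*} [NormedAddCommGroup E] [NormedSpace ℝ E]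
    [NormedAddCommGroup F] [NormedSpace ℝ F] {f : E → F} {s : Set E}
    (hf : ∀ x ∈ s, ContDiffAt ℝ 1 f x) : LocallyLipschitzOn s f := by
  intro x hx
  obtain ⟨K, t, ht, hK⟩ := (hf x hx).exists_lipschitzOnWith
  exact ⟨K, t, mem_nhdsWithin_of_mem_nhds ht, hK⟩

lemma locallyLipschitzOn_mul {α : Type*} [PseudoEMetricSpace α] {f g : α → ℝ} {s : Set α}
    (hf : LocallyLipschitzOn s f) (hg : LocallyLipschitzOn s g) :
    LocallyLipschitzOn s (fun x ↦ f x * g x) := by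
  have h1 : LocallyLipschitzOn s (fun x ↦ (f x, g x)) := by
    intro x hx
    obtain ⟨K, a, ha, hK⟩ := hf hx
    obtain ⟨L, b, hb, hL⟩ := hg hx
    exact ⟨max K L, a ∩ b, inter_mem ha hb, (hK.mono inter_subset_left).prodMk
      (hL.mono inter_subset_right)⟩
  have h2 : LocallyLipschitzOn univ (fun z : ℝ × ℝ ↦ z.1 * z.2) :=
    locallyLipschitzOn_of_contDiffAt fun x _ ↦ contDiffAt_fst.mul contDiffAt_snd
  exact locallyLipschitzOn_comp h1 h2 (mapsTo_univ _ _)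

lemma locallyLipschitzOn_ae_differentiableAt {E : Type*} [NormedAddCommGroup E]
    [NormedSpace ℝ E] [FiniteDimensional ℝ E] [MeasurableSpace E] [BorelSpace E] {μ : Measure E}
    [μ.IsAddHaarMeasure] {f : E → ℝ} {s : Set E} (hs : IsOpen s) (hf : LocallyLipschitzOn s f) :
    ∀ᵐ y ∂μ.restrict s, DifferentiableAt ℝ f y := by
  rw [ae_restrict_iff' hs.measurableSet]
  change μ {y | ¬ (y ∈ s → DifferentiableAt ℝ f y)} = 0
  refine measure_null_of_locally_null _ fun x hx ↦ ?_
  have hxs : x ∈ s := (Classical.not_imp.1 hx).1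
  obtain ⟨K, t, ht, hK⟩ := hf hxs
  obtain ⟨o, hot, ho, hxo⟩ := mem_nhds_iff.1 (hs.nhdsWithin_eq hxs ▸ ht)
  refine ⟨_, inter_mem_nhdsWithin _ (ho.mem_nhds hxo), measure_mono_null ?_
    (ae_iff.1 ((hK.mono hot).ae_differentiableWithinAt_of_mem (μ := μ)))⟩
  rintro y ⟨hy1, hy2⟩
  simp only [mem_ofPred_eq, Classical.not_imp] at hy1 ⊢
  exact ⟨hy2, fun h ↦ hy1.2 (h.differentiableAt (ho.mem_nhds hy2))⟩

end LocallyLipschitz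

section Parts

variable {E : Type*} [NormedAddCommGroup E] [InnerProductSpace ℝ E] [FiniteDimensional ℝ E]
  [MeasurableSpace E] [BorelSpace E]
  {F : Type*} [NormedAddCommGroup F] [InnerProductSpace ℝ F] [FiniteDimensional ℝ F]
  {P : Type*} [TopologicalSpace P] [ChartedSpace E P] [IsManifold 𝓘(ℝ, E) ∞ P]
  {M : Type*} [TopologicalSpace M] [ChartedSpace F M] [IsManifold 𝓘(ℝ, F) ∞ M]
  [RiemannianBundle (fun p : M ↦ TangentSpace 𝓘(ℝ, F) p)]
  [RiemannianBundle (fun x : P ↦ TangentSpace 𝓘(ℝ, E) x)]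
  [IsContMDiffRiemannianBundle 𝓘(ℝ, F) ∞ F (fun p : M ↦ TangentSpace 𝓘(ℝ, F) p)]
  [IsContMDiffRiemannianBundle 𝓘(ℝ, E) ∞ E (fun x : P ↦ TangentSpace 𝓘(ℝ, E) x)]
  {Y : ∀ p : M, TangentSpace 𝓘(ℝ, F) p}
  {ϑ : Diffeomorph (𝓘(ℝ, E).prod 𝓘(ℝ, ℝ)) 𝓘(ℝ, F) (P × ℝ) M ∞}
  {c : P} {y : E} {u φ : P → ℝ}
  [T2Space P] [MeasurableSpace P] [BorelSpace P] [SecondCountableTopology P] [Nonempty P]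

/-- Rademacher's theorem on a Riemannian manifold. -/
lemma LocallyLipschitzInCharts.ae_mdifferentiableAt (hφ : LocallyLipschitzInCharts E φ) :
    ∀ᵐ x ∂riemannianVolume (metric (E := E) (P := P)), MDifferentiableAt 𝓘(ℝ, E) 𝓘(ℝ, ℝ) φ x := by
  refine ae_of_forall_ae_chart (E := E) fun c ↦ ae_of_ae_inChart ?_
  have hT := isOpen_extChartAt_target (I := 𝓘(ℝ, E)) c
  filter_upwards [locallyLipschitzOn_ae_differentiableAt (μ := volume) hT (hφ c),
    ae_restrict_mem hT.measurableSet] with y hy hyT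
  exact mdifferentiableAt_of_inChart hyT hy

lemma divIntegrand_sum {ι : Type*} (s : Finset ι) {φ : ι → P → ℝ} (D : ℝ) {x : P}
    (hφ : ∀ i ∈ s, MDifferentiableAt 𝓘(ℝ, E) 𝓘(ℝ, ℝ) (φ i) x) :
    divIntegrand (E := E) Y ϑ u D (fun z ↦ ∑ i ∈ s, φ i z) x =
      ∑ i ∈ s, divIntegrand (E := E) Y ϑ u D (φ i) x := by
  have h1 : metric x (grad (E := E) (fun z ↦ ∑ i ∈ s, φ i z) x) (grad (E := E) u x) =
      ∑ i ∈ s, metric x (grad (E := E) (φ i) x) (grad (E := E) u x) := by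
    obtain ⟨T, hT⟩ : ∃ T : ι → E →L[ℝ] ℝ, ∀ i, T i = mfderiv 𝓘(ℝ, E) 𝓘(ℝ, ℝ) (φ i) x :=
      ⟨_, fun i ↦ rfl⟩
    have h2 : HasMFDerivAt 𝓘(ℝ, E) 𝓘(ℝ, ℝ) (∑ i ∈ s, φ i) x
        (∑ i ∈ s, T i : E →L[ℝ] ℝ) := by
      have h4 : ∀ i ∈ s, HasMFDerivAt 𝓘(ℝ, E) 𝓘(ℝ, ℝ) (φ i) x (T i) := fun i hi ↦ by
        rw [hT]; exact (hφ i hi).hasMFDerivAt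
      clear hφ hT
      classical
      induction s using Finset.induction_on with
      | empty => exact hasMFDerivAt_const (I := 𝓘(ℝ, E)) (I' := 𝓘(ℝ, ℝ)) (0 : ℝ) x
      | insert i s hi ih =>
        rw [Finset.sum_insert hi, Finset.sum_insert hi]
        exact (h4 i (Finset.mem_insert_self i s)).add
          (ih fun j hj ↦ h4 j (Finset.mem_insert_of_mem hj))
    have h3 : (fun z ↦ ∑ i ∈ s, φ i z) = ∑ i ∈ s, φ i := by ext z; simp
    rw [h3]
    refine (inner_grad _ _ _).trans ?_
    refine (congrArg (fun T : E →L[ℝ] ℝ ↦ T (grad (E := E) u x)) h2.mfderiv).trans ?_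
    refine (_root_.sum_apply _ _ _).trans (Finset.sum_congr rfl fun i _ ↦ ?_)
    refine Eq.trans ?_ (inner_grad _ _ _).symm
    exact congrArg (fun T : E →L[ℝ] ℝ ↦ T (grad (E := E) u x)) (hT i)
  simp only [divIntegrand, h1, Finset.sum_mul, Finset.sum_div, ← Finset.sum_add_distrib]

/-- The weak form of the mean curvature equation `div (e^{-(D+1)ψ} ∇u / W) = n H_{Dψ} e^{-(D+1)ψ}`:
a partition of unity reduces it to the divergence theorem in a chart. -/
lemma integral_divIntegrand (hY : IsKilling Y) (h : IsFlowFromLeaf Y ϑ) (D : ℝ)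
    (hn : Module.finrank ℝ E ≠ 0) {Ω K : Set P} (hΩ : IsOpen Ω)
    (hu : ContMDiffOn 𝓘(ℝ, E) 𝓘(ℝ, ℝ) ∞ u Ω) (hφ : LocallyLipschitzInCharts E φ)
    (hK : IsCompact K) (hKΩ : K ⊆ Ω) (hφK : ∀ x, x ∉ K → φ x = 0) :
    Integrable (divIntegrand (E := E) Y ϑ u D φ) (riemannianVolume (metric (E := E) (P := P))) ∧
    ∫ x, divIntegrand (E := E) Y ϑ u D φ x ∂riemannianVolume (metric (E := E) (P := P)) = 0 := by
  have : LocallyCompactSpace P := ChartedSpace.locallyCompactSpace E P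
  have : SigmaCompactSpace P := inferInstance
  obtain ⟨ρ, hρ⟩ := SmoothPartitionOfUnity.exists_isSubordinate_chartAt_source 𝓘(ℝ, E) P
  have hfin := ρ.locallyFinite.finite_nonempty_inter_compact hK
  set s := hfin.toFinset with hs
  have hsum : (fun z ↦ ∑ i ∈ s, ρ i z * φ z) = φ := by
    funext x
    by_cases hx : x ∈ K
    · rw [← Finset.sum_mul]
      have h1 := ρ.sum_eq_one (mem_univ x)
      rw [finsum_eq_sum_of_support_subset (s := s)] at h1
      · rw [h1, one_mul]
      · intro i hi
        simp only [hs, Finite.coe_toFinset]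
        exact ⟨x, hi, hx⟩
    · simp [hφK x hx]
  have hi : ∀ i, _ := fun i ↦ integral_divIntegrand_of_subset_source (c := i) (u := u)
    (φ := fun z ↦ ρ i z * φ z) (K := K ∩ tsupport (ρ i)) hY h D hn hΩ hu
    (locallyLipschitzOn_mul (locallyLipschitzOn_of_contDiffAt fun y hy ↦
      contDiffAt_inChart (u := ρ i) (n := 1) (by norm_cast) hy
        ((ρ i).contMDiff.contMDiffAt.of_le (by norm_cast))) (hφ i))
    (hK.inter_right (isClosed_tsupport _)) (inter_subset_left.trans hKΩ)
    (inter_subset_right.trans (hρ i)) (fun x hx ↦ by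
      by_cases hxK : x ∈ K
      · have hx2 : x ∉ tsupport (ρ i) := fun h ↦ hx ⟨hxK, h⟩
        simp only [image_eq_zero_of_notMem_tsupport hx2, zero_mul]
      · simp only [hφK x hxK, mul_zero])
  have hae : (fun x ↦ ∑ i ∈ s, divIntegrand (E := E) Y ϑ u D (fun z ↦ ρ i z * φ z) x)
      =ᵐ[riemannianVolume (metric (E := E) (P := P))] divIntegrand (E := E) Y ϑ u D φ := by
    filter_upwards [hφ.ae_mdifferentiableAt] with x hx
    have hd : ∀ i ∈ s, MDifferentiableAt 𝓘(ℝ, E) 𝓘(ℝ, ℝ) (fun z ↦ ρ i z * φ z) x := fun i _ ↦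
      ((ρ i).contMDiff.mdifferentiable (by simp) x).mul hx
    rw [← divIntegrand_sum s D hd, hsum]
  have hI := integrable_finsetSum s fun i _ ↦ (hi i).1
  refine ⟨hI.congr hae, ?_⟩
  rw [← integral_congr_ae hae, integral_finsetSum s fun i _ ↦ (hi i).1]
  exact Finset.sum_eq_zero fun i _ ↦ (hi i).2

end Parts

/-! ### Compactness of closed balls -/

section HopfRinow

/-- In a complete, locally compact length space the closed balls of finite radius are compact. The
extended distance may be infinite. -/
lemma isCompact_closedEBall_of_length {X : Type*} [EMetricSpace X] [CompleteSpace X]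
    [LocallyCompactSpace X]
    (hX : ∀ (x y : X) (a b : ℝ≥0), 0 < b → edist x y < a + b → ∃ z, edist x z ≤ a ∧ edist z y < b)
    (x : X) (r : ℝ≥0) : IsCompact (Metric.closedEBall x r) := by
  have hmono : ∀ {r r' : ℝ≥0}, r ≤ r' → IsCompact (Metric.closedEBall x r') →
      IsCompact (Metric.closedEBall x r) := fun h hc ↦
    hc.of_isClosed_subset Metric.isClosed_closedEBall
      (Metric.closedEBall_subset_closedEBall (by exact_mod_cast h))
  -- the set of radii with compact balls is open, since a compact ball has a compact neighbourhood
  have hopen : ∀ r : ℝ≥0, IsCompact (Metric.closedEBall x r) →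
      ∃ ε : ℝ≥0, 0 < ε ∧ IsCompact (Metric.closedEBall x (r + ε : ℝ≥0)) := by
    intro r hr
    obtain ⟨L, hL, hrL⟩ := exists_compact_superset hr
    obtain ⟨ε, hε, hεL⟩ := hr.exists_thickening_subset_open isOpen_interior hrL
    have hε' : 0 < ε.toNNReal := Real.toNNReal_pos.2 hε
    refine ⟨ε.toNNReal / 2, half_pos hε', hL.of_isClosed_subset Metric.isClosed_closedEBall
      fun y hy ↦ interior_subset (hεL ?_)⟩
    rw [Metric.mem_closedEBall'] at hy
    obtain ⟨z, hz, hzy⟩ := hX x y r ε.toNNReal hε' (hy.trans_lt (by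
      exact_mod_cast add_lt_add_right (half_lt_self hε') r))
    rw [Metric.mem_thickening_iff_exists_edist_lt]
    exact ⟨z, Metric.mem_closedEBall'.2 hz, edist_comm y z ▸ hzy⟩
  -- it is closed: a ball is totally bounded if all smaller concentric balls are compact
  have hclosed : ∀ r : ℝ≥0, 0 < r → (∀ r' < r, IsCompact (Metric.closedEBall x r')) →
      IsCompact (Metric.closedEBall x r) := by
    intro r hr h
    refine isCompact_iff_totallyBounded_isComplete.2 ⟨?_, Metric.isClosed_closedEBall.isComplete⟩
    refine EMetric.totallyBounded_iff.2 fun ε hε ↦ ?_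
    obtain ⟨e, he0, he⟩ : ∃ e : ℝ≥0, 0 < e ∧ (e : ℝ≥0∞) + e < ε := by
      obtain ⟨e, he0, he⟩ := ENNReal.lt_iff_exists_nnreal_btwn.1 hε
      have he0' : 0 < e := by exact_mod_cast he0
      exact ⟨e / 2, half_pos he0', by rw [← ENNReal.coe_add, add_halves]; exact he⟩
    have hlt : r - e / 2 < r := tsub_lt_self hr (half_pos he0)
    have hle : r < r - e / 2 + e :=
      (le_tsub_add (b := r) (a := e / 2)).trans_lt (by gcongr; exact half_lt_self he0)
    obtain ⟨t, ht, hcov⟩ := EMetric.totallyBounded_iff.1 (h _ hlt).totallyBounded e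
      (by exact_mod_cast he0)
    refine ⟨t, ht, fun y hy ↦ ?_⟩
    rw [Metric.mem_closedEBall'] at hy
    obtain ⟨z, hz, hzy⟩ := hX x y (r - e / 2) e he0 (hy.trans_lt (by exact_mod_cast hle))
    · have hz' := hcov (Metric.mem_closedEBall'.2 hz)
      simp only [mem_iUnion, Metric.mem_eball, exists_prop] at hz' ⊢
      obtain ⟨w, hw, hzw⟩ := hz'
      refine ⟨w, hw, (edist_triangle y z w).trans_lt (lt_trans ?_ he)⟩
      exact ENNReal.add_lt_add (edist_comm z y ▸ hzy) hzw
  by_contra hcon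
  set B : Set ℝ≥0 := {r | ¬ IsCompact (Metric.closedEBall x r)} with hB
  have hne : B.Nonempty := ⟨r, hcon⟩
  have hlt : ∀ r' < sInf B, IsCompact (Metric.closedEBall x r') := fun r' hr' ↦ by
    by_contra h
    exact notMem_of_lt_csInf hr' (OrderBot.bddBelow B) h
  have hs : IsCompact (Metric.closedEBall x (sInf B : ℝ≥0)) := by
    rcases (bot_le (a := sInf B)).eq_or_lt with h0 | h0
    · rw [← h0]; simp
    · exact hclosed _ h0 hlt
  obtain ⟨ε, hε, hc⟩ := hopen _ hs
  obtain ⟨r', hr', hr'lt⟩ := exists_lt_of_csInf_lt hne (lt_add_of_pos_right (sInf B) hε)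
  exact hr' (hmono hr'lt.le hc)

/-- The length space property: the point `z` is found on a nearly shortest curve from `x` to `y`. -/
lemma exists_edist_le_edist_lt (E : Type*) [NormedAddCommGroup E] [InnerProductSpace ℝ E]
    {P : Type*} [EMetricSpace P] [ChartedSpace E P] [IsManifold 𝓘(ℝ, E) ∞ P]
    [RiemannianBundle (fun x : P ↦ TangentSpace 𝓘(ℝ, E) x)] [IsRiemannianManifold 𝓘(ℝ, E) P]
    (x y : P) (a b : ℝ≥0) (hb : 0 < b) (h : edist x y < a + b) :
    ∃ z, edist x z ≤ a ∧ edist z y < b := by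
  by_cases hxy : edist x y ≤ a
  · exact ⟨y, hxy, by simpa using hb⟩
  rw [IsRiemannianManifold.out (I := 𝓘(ℝ, E)) x y] at h
  obtain ⟨γ, h0, h1, hγ, hlen⟩ := exists_lt_of_riemannianEDist_lt h
  have hcont : ContinuousOn (fun t ↦ edist x (γ t)) (Icc 0 1) :=
    continuous_edist.comp_continuousOn (continuousOn_const.prodMk hγ.continuousOn)
  obtain ⟨t, ht, hta⟩ := intermediate_value_Icc zero_le_one hcont
    (show (a : ℝ≥0∞) ∈ Icc (edist x (γ 0)) (edist x (γ 1)) by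
      rw [h0, h1, edist_self]; exact ⟨bot_le, (not_le.1 hxy).le⟩)
  simp only at hta
  refine ⟨γ t, hta.le, ?_⟩
  have hA : edist x (γ t) ≤ pathELength 𝓘(ℝ, E) γ 0 t := by
    rw [IsRiemannianManifold.out (I := 𝓘(ℝ, E)) x (γ t)]
    exact riemannianEDist_le_pathELength (hγ.mono (Icc_subset_Icc_right ht.2)) h0 rfl ht.1
  have hB : edist (γ t) y ≤ pathELength 𝓘(ℝ, E) γ t 1 := by
    rw [IsRiemannianManifold.out (I := 𝓘(ℝ, E)) (γ t) y]
    exact riemannianEDist_le_pathELength (hγ.mono (Icc_subset_Icc_left ht.1)) rfl h1 ht.2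
  rw [hta] at hA
  refine hB.trans_lt ?_
  rw [← pathELength_add ht.1 ht.2] at hlen
  have := (add_le_add_left hA _).trans_lt hlen
  exact lt_of_add_lt_add_left this

/-- The Hopf–Rinow theorem, in the form that closed balls are compact. -/
lemma isCompact_closedEBall (E : Type*) [NormedAddCommGroup E] [InnerProductSpace ℝ E]
    [FiniteDimensional ℝ E]
    {P : Type*} [EMetricSpace P] [ChartedSpace E P] [IsManifold 𝓘(ℝ, E) ∞ P]
    [RiemannianBundle (fun x : P ↦ TangentSpace 𝓘(ℝ, E) x)] [IsRiemannianManifold 𝓘(ℝ, E) P]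
    [CompleteSpace P] (x : P) (r : ℝ≥0) :
    IsCompact (Metric.closedEBall x r) :=
  haveI : LocallyCompactSpace P := ChartedSpace.locallyCompactSpace E P
  isCompact_closedEBall_of_length (exists_edist_le_edist_lt E) x r

variable {E : Type*} [NormedAddCommGroup E] [InnerProductSpace ℝ E] [FiniteDimensional ℝ E]
  {P : Type*} [EMetricSpace P] [ChartedSpace E P] [IsManifold 𝓘(ℝ, E) ∞ P]
  [RiemannianBundle (fun x : P ↦ TangentSpace 𝓘(ℝ, E) x)]
  [IsContMDiffRiemannianBundle 𝓘(ℝ, E) ∞ E (fun x : P ↦ TangentSpace 𝓘(ℝ, E) x)]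
  [IsRiemannianManifold 𝓘(ℝ, E) P]

/-- The distance between the end points of a coordinate segment is at most its length. -/
lemma edist_chart_symm_le {c : P} {y y' : E} {C : ℝ}
    (hseg : segment ℝ y y' ⊆ (extChartAt 𝓘(ℝ, E) c).target)
    (hC : ∀ z ∈ segment ℝ y y', chartForm c z (y' - y) (y' - y) ≤ C ^ 2) (hC0 : 0 ≤ C) :
    edist ((extChartAt 𝓘(ℝ, E) c).symm y) ((extChartAt 𝓘(ℝ, E) c).symm y') ≤
      ENNReal.ofReal C := by
  have hl : ∀ t ∈ Icc (0 : ℝ) 1, AffineMap.lineMap y y' t ∈ segment ℝ y y' := fun t ht ↦ by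
    rw [segment_eq_image_lineMap]; exact mem_image_of_mem _ ht
  have hld : ∀ t : ℝ, HasFDerivAt (fun t : ℝ ↦ AffineMap.lineMap y y' t)
      (ContinuousLinearMap.toSpanSingleton ℝ (y' - y)) t := fun t ↦ by
    have := (AffineMap.hasDerivAt_lineMap (a := y) (b := y') (x := t)).hasFDerivAt
    exact this
  have hls : ContDiff ℝ 1 (fun t : ℝ ↦ AffineMap.lineMap y y' t) := by
    simp only [AffineMap.lineMap_apply_module]
    fun_prop
  have hγ : ∀ t ∈ Icc (0 : ℝ) 1, ContMDiffAt 𝓘(ℝ, ℝ) 𝓘(ℝ, E) 1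
      ((extChartAt 𝓘(ℝ, E) c).symm ∘ fun t : ℝ ↦ AffineMap.lineMap y y' t) t := fun t ht ↦
    ((contMDiffAt_chart_symm (hseg (hl t ht))).of_le (by norm_cast)).comp t
      hls.contMDiff.contMDiffAt
  rw [IsRiemannianManifold.out (I := 𝓘(ℝ, E))]
  refine (riemannianEDist_le_pathELength (a := 0) (b := 1)
    (γ := (extChartAt 𝓘(ℝ, E) c).symm ∘ fun t : ℝ ↦ AffineMap.lineMap y y' t)
    (fun t ht ↦ (hγ t ht).contMDiffWithinAt) (by simp) (by simp) zero_le_one).trans ?_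
  rw [pathELength_eq_lintegral_mfderiv_Icc]
  calc _ ≤ ∫⁻ _ in Icc (0 : ℝ) 1, ENNReal.ofReal C := by
        refine setLIntegral_mono_ae' measurableSet_Icc (Eventually.of_forall fun t ht ↦ ?_)
        rw [mfderiv_comp (I' := 𝓘(ℝ, E)) t
          ((contMDiffAt_chart_symm (hseg (hl t ht))).mdifferentiableAt (by simp))
          (hld t).differentiableAt.mdifferentiableAt]
        have h1 : mfderiv 𝓘(ℝ, ℝ) 𝓘(ℝ, E) (fun t : ℝ ↦ AffineMap.lineMap y y' t) t 1 = y' - y := by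
          rw [mfderiv_eq_fderiv, (hld t).fderiv]
          exact one_smul ℝ (y' - y)
        have h2 : ‖(mfderiv 𝓘(ℝ, E) 𝓘(ℝ, E) (extChartAt 𝓘(ℝ, E) c).symm
            (AffineMap.lineMap y y' t) (y' - y) :
            TangentSpace 𝓘(ℝ, E) ((extChartAt 𝓘(ℝ, E) c).symm (AffineMap.lineMap y y' t)))‖ ≤ C :=
          (sq_le_sq₀ (norm_nonneg _) hC0).1 ((chartForm_self c _ _).symm.trans_le (hC _ (hl t ht)))
        have h3 := ENNReal.ofReal_le_ofReal h2
        rw [ofReal_norm, ← h1] at h3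
        exact h3
    _ = ENNReal.ofReal C := by simp
end HopfRinow

/-! ### Cutoff functions -/

section Lipschitz

variable {E : Type*} [NormedAddCommGroup E] [InnerProductSpace ℝ E] [FiniteDimensional ℝ E]
  {P : Type*} [EMetricSpace P] [ChartedSpace E P] [IsManifold 𝓘(ℝ, E) ∞ P]
  [RiemannianBundle (fun x : P ↦ TangentSpace 𝓘(ℝ, E) x)]
  [IsContMDiffRiemannianBundle 𝓘(ℝ, E) ∞ E (fun x : P ↦ TangentSpace 𝓘(ℝ, E) x)]
  [IsRiemannianManifold 𝓘(ℝ, E) P] {η : P → ℝ} {K : ℝ≥0}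

/-- Inverse charts are locally Lipschitz for the Riemannian distance. -/
lemma locallyLipschitzOn_chart_symm (c : P) :
    LocallyLipschitzOn (extChartAt 𝓘(ℝ, E) c).target (extChartAt 𝓘(ℝ, E) c).symm := by
  intro y hy
  have hT := isOpen_extChartAt_target (I := 𝓘(ℝ, E)) c
  obtain ⟨σ, hσ⟩ : ∃ σ : E → E →L[ℝ] E →L[ℝ] ℝ, σ = chartForm c := ⟨_, rfl⟩
  have h0 : ContinuousAt σ y := hσ ▸ (contDiffAt_chartForm hy).continuousAt
  set m : ℝ := ‖σ y‖ + 1 with hm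
  have hm0 : 0 ≤ m := by positivity
  have h1 : ∀ᶠ z in 𝓝 y, ‖σ z‖ < m := by
    have h2 : ContinuousAt (fun z ↦ ‖σ z‖) y :=
      (continuous_norm (E := E →L[ℝ] E →L[ℝ] ℝ)).continuousAt.comp h0
    exact h2.eventually_lt continuousAt_const (by rw [hm]; linarith)
  obtain ⟨r, hr, hball⟩ := Metric.eventually_nhds_iff_ball.1
    (h1.and
      (hT.eventually_mem hy))
  refine ⟨Real.toNNReal √m, Metric.ball y r, mem_nhdsWithin_of_mem_nhds (Metric.ball_mem_nhds y hr),
    fun a ha b hb ↦ ?_⟩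
  have hseg : segment ℝ a b ⊆ Metric.ball y r := (convex_ball y r).segment_subset ha hb
  refine (edist_chart_symm_le (C := √m * ‖b - a‖) (fun z hz ↦ (hball z (hseg hz)).2)
    (fun z hz ↦ ?_) (by positivity)).trans ?_
  · rw [mul_pow, Real.sq_sqrt hm0]
    rw [← hσ]
    calc σ z (b - a) (b - a) ≤ ‖σ z‖ * ‖b - a‖ * ‖b - a‖ :=
          (le_abs_self _).trans ((σ z).le_opNorm₂ _ _)
      _ ≤ m * ‖b - a‖ * ‖b - a‖ := by
          have := (hball z (hseg hz)).1.le
          gcongr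
      _ = _ := by ring
  · rw [ENNReal.ofReal_mul (Real.sqrt_nonneg _), edist_comm, edist_eq_enorm_sub, ofReal_norm]
    rfl

lemma locallyLipschitzInCharts_of_lipschitzWith (hη : LipschitzWith K η) :
    LocallyLipschitzInCharts E η := fun c ↦
  locallyLipschitzOn_comp (locallyLipschitzOn_chart_symm c)
    (hη.locallyLipschitz.locallyLipschitzOn (s := univ)) (mapsTo_univ _ _)

lemma locallyLipschitzInCharts_mul_contMDiff {w : P → ℝ} (hη : LocallyLipschitzInCharts E η)
    (hw : ContMDiff 𝓘(ℝ, E) 𝓘(ℝ, ℝ) 1 w) : LocallyLipschitzInCharts E (fun x ↦ η x * w x) :=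
  fun c ↦ locallyLipschitzOn_mul (hη c) (locallyLipschitzOn_of_contDiffAt fun y hy ↦
    contDiffAt_inChart (u := w) (n := 1) (by norm_cast) hy hw.contMDiffAt)

/-- The Lipschitz constant for the Riemannian distance bounds the differential with respect to the
metric, with the same constant. -/
lemma abs_fderiv_inChart_le (hη : LipschitzWith K η) {c : P} {y : E}
    (hy : y ∈ (extChartAt 𝓘(ℝ, E) c).target) (hd : DifferentiableAt ℝ (inChart c η) y) (a : E) :
    |fderiv ℝ (inChart c η) y a| ≤ K * √(chartForm c y a a) := by
  refine le_of_forall_pos_le_add fun ε hε ↦ ?_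
  obtain ⟨e, he, hKe⟩ : ∃ e : ℝ, 0 < e ∧ K * e ≤ ε :=
    ⟨ε / (K + 1), by positivity, by
      rw [mul_div_assoc', div_le_iff₀ (by positivity)]; nlinarith [K.2]⟩
  set s := √(chartForm c y a a) with hs
  have hs0 : 0 ≤ s := Real.sqrt_nonneg _
  have hT := isOpen_extChartAt_target (I := 𝓘(ℝ, E)) c
  have h1 : ContinuousAt (fun z ↦ chartForm c z a a) y :=
    ((contDiffAt_chartForm hy).continuousAt.clm_apply continuousAt_const).clm_apply
      continuousAt_const
  have hlt : chartForm c y a a < (s + e) ^ 2 := by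
    have := Real.sq_sqrt (chartForm_nonneg c y a)
    rw [← hs] at this
    nlinarith
  obtain ⟨r, hr, hball⟩ := Metric.eventually_nhds_iff_ball.1
    ((h1.eventually_lt continuousAt_const hlt).and (hT.eventually_mem hy))
  have hl : HasDerivAt (fun t : ℝ ↦ y + t • a) a 0 := by
    simpa using ((hasDerivAt_id (0 : ℝ)).smul_const a).const_add y
  have hd' : HasFDerivAt (inChart c η) (fderiv ℝ (inChart c η) y) (y + (0 : ℝ) • a) := by
    simpa using hd.hasFDerivAt
  have hcomp := hd'.comp_hasDerivAt (0 : ℝ) hl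
  have hev : ∀ᶠ t : ℝ in 𝓝 0, ‖(inChart c η ∘ fun t : ℝ ↦ y + t • a) t -
      (inChart c η ∘ fun t : ℝ ↦ y + t • a) 0‖ ≤ K * (s + e) * ‖t - 0‖ := by
    have hc : ∀ᶠ t : ℝ in 𝓝 0, y + t • a ∈ Metric.ball y r := by
      refine hl.continuousAt.eventually_mem ?_
      simpa using Metric.ball_mem_nhds y hr
    filter_upwards [hc] with t ht
    have hseg : segment ℝ y (y + t • a) ⊆ Metric.ball y r :=
      (convex_ball y r).segment_subset (Metric.mem_ball_self hr) ht
    have h2 := edist_chart_symm_le (C := (s + e) * |t|) (fun z hz ↦ (hball z (hseg hz)).2)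
      (fun z hz ↦ by
        rw [add_sub_cancel_left, map_smul, map_smul, _root_.smul_apply, smul_eq_mul, smul_eq_mul,
          mul_pow, sq_abs]
        have := (hball z (hseg hz)).1.le
        nlinarith [sq_nonneg t]) (by positivity)
    have h3 := (hη _ _).trans (mul_le_mul_right h2 (K : ℝ≥0∞))
    rw [edist_comm, edist_dist, Real.dist_eq, ← ENNReal.ofReal_coe_nnreal,
      ← ENNReal.ofReal_mul K.coe_nonneg, ENNReal.ofReal_le_ofReal_iff (by positivity)] at h3
    simp only [Function.comp, zero_smul, add_zero, sub_zero, Real.norm_eq_abs, mul_assoc]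
    exact h3
  have h4 := hcomp.le_of_lip' (by positivity) hev
  rw [Real.norm_eq_abs] at h4
  nlinarith

/-- The gradient of a `K`-Lipschitz function has norm at most `K`. -/
lemma abs_metric_grad_le (hη : LipschitzWith K η) {x : P}
    (hd : MDifferentiableAt 𝓘(ℝ, E) 𝓘(ℝ, ℝ) η x) (v : TangentSpace 𝓘(ℝ, E) x) :
    |metric x (grad (E := E) η x) v| ≤ K * ‖v‖ := by
  obtain ⟨c, y, hy, rfl⟩ : ∃ (c : P) (y : E), y ∈ (extChartAt 𝓘(ℝ, E) c).target ∧
      (extChartAt 𝓘(ℝ, E) c).symm y = x :=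
    ⟨x, _, mem_extChartAt_target x, extChartAt_to_inv x⟩
  obtain ⟨a, rfl⟩ : ∃ a : E, mfderiv 𝓘(ℝ, E) 𝓘(ℝ, E) (extChartAt 𝓘(ℝ, E) c).symm y a = v :=
    (mfderiv_chart_symm_bijective hy).2 v
  have h1 := abs_fderiv_inChart_le hη hy (differentiableAt_inChart hy hd) a
  rw [chartForm_self, Real.sqrt_sq (norm_nonneg _), fderiv_inChart hy hd] at h1
  exact (congrArg abs (inner_grad η _ _)).trans_le h1

/-- The gradient of a nonnegative function vanishes at its zeros. -/
lemma metric_grad_eq_zero {x : P} (h0 : ∀ z, 0 ≤ η z) (hx : η x = 0)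
    (hd : MDifferentiableAt 𝓘(ℝ, E) 𝓘(ℝ, ℝ) η x) (v : TangentSpace 𝓘(ℝ, E) x) :
    metric x (grad (E := E) η x) v = 0 := by
  obtain ⟨c, y, hy, rfl⟩ : ∃ (c : P) (y : E), y ∈ (extChartAt 𝓘(ℝ, E) c).target ∧
      (extChartAt 𝓘(ℝ, E) c).symm y = x :=
    ⟨x, _, mem_extChartAt_target x, extChartAt_to_inv x⟩
  obtain ⟨a, rfl⟩ : ∃ a : E, mfderiv 𝓘(ℝ, E) 𝓘(ℝ, E) (extChartAt 𝓘(ℝ, E) c).symm y a = v :=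
    (mfderiv_chart_symm_bijective hy).2 v
  have h1 : IsLocalMin (inChart c η) y := Eventually.of_forall fun z ↦ by
    simp only [inChart, hx]; exact h0 _
  refine (inner_grad η _ _).trans ((fderiv_inChart hy hd a).symm.trans ?_)
  rw [h1.fderiv_eq_zero]; rfl

end Lipschitz

section Cutoff

/-- A distance cutoff. -/
lemma exists_cutoff {X : Type*} [PseudoEMetricSpace X] (x₀ : X) {r s : ℝ≥0} (hrs : r < s) :
    ∃ η : X → ℝ, LipschitzWith (s - r)⁻¹ η ∧ (∀ x, 0 ≤ η x) ∧ (∀ x, η x ≤ 1) ∧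
      (∀ x, edist x x₀ < r → η x = 1) ∧ ∀ x, ¬ edist x x₀ < s → η x = 0 := by
  have hrs' : (0 : ℝ) < s - r := sub_pos.2 (by exact_mod_cast hrs)
  -- the distance is truncated at `s` because it may be infinite
  set d : X → ℝ := fun x ↦ (min (edist x x₀) s).toReal with hd
  have hfin : ∀ x, min (edist x x₀) s ≠ ⊤ := fun x ↦
    ((min_le_right _ _).trans_lt ENNReal.coe_lt_top).ne
  have hds : ∀ x, d x ≤ s := fun x ↦ by
    simpa using ENNReal.toReal_mono ENNReal.coe_ne_top (min_le_right (edist x x₀) (s : ℝ≥0∞))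
  have hdL : ∀ x x', edist x x' ≠ ⊤ → d x ≤ d x' + (edist x x').toReal := by
    intro x x' h
    rw [hd, ← ENNReal.toReal_add (hfin _) h]
    refine ENNReal.toReal_mono (ENNReal.add_ne_top.2 ⟨hfin _, h⟩) ?_
    rw [min_add]
    refine le_min ((min_le_left _ _).trans ?_) ((min_le_right _ _).trans le_self_add)
    rw [add_comm]; exact edist_triangle _ _ _
  have hd1 : LipschitzWith 1 d := by
    intro x x'
    rw [ENNReal.coe_one, one_mul]
    by_cases h : edist x x' = ⊤
    · rw [h]; exact le_top
    · rw [edist_dist, Real.dist_eq, ← ENNReal.ofReal_toReal h]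
      refine ENNReal.ofReal_le_ofReal (abs_sub_le_iff.2 ⟨?_, ?_⟩)
      · linarith [hdL x x' h]
      · have := hdL x' x (by rwa [edist_comm])
        rw [edist_comm] at this
        linarith
  refine ⟨fun x ↦ min 1 ((s - d x) / (s - r)), ?_, fun x ↦ ?_, fun x ↦ min_le_left _ _,
    fun x hx ↦ ?_, fun x hx ↦ ?_⟩
  · refine LipschitzWith.const_min ?_ 1
    have h1 : LipschitzWith (s - r)⁻¹ (fun t : ℝ ↦ (s - t) / (s - r : ℝ)) := by
      refine LipschitzWith.of_dist_le_mul fun t t' ↦ le_of_eq ?_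
      rw [Real.dist_eq, Real.dist_eq, ← sub_div, abs_div, abs_of_pos hrs', NNReal.coe_inv,
        NNReal.coe_sub hrs.le, sub_sub_sub_cancel_left, abs_sub_comm, div_eq_inv_mul]
    simpa using! h1.comp hd1
  · exact le_min zero_le_one (div_nonneg (sub_nonneg.2 (hds x)) hrs'.le)
  · refine min_eq_left ((one_le_div hrs').2 ?_)
    have : d x ≤ r := by
      simpa using ENNReal.toReal_mono ENNReal.coe_ne_top ((min_le_left _ (s : ℝ≥0∞)).trans hx.le)
    linarith
  · have : d x = s := by simp [hd, min_eq_right (not_lt.1 hx)]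
    simp [this]

/-- A `C¹` truncation of the identity near zero. -/
lemma exists_truncation {ε : ℝ} (hε : 0 < ε) : ∃ G g : ℝ → ℝ, Continuous g ∧
    (∀ t, HasDerivAt G (g t) t) ∧ (∀ t, 0 ≤ g t) ∧ (∀ t, 2 * ε ≤ |t| → g t = 1) ∧
    (∀ t, |t| ≤ ε → G t = 0) ∧ ∀ t, |G t| ≤ |t| := by
  -- `g` is zero on `[-ε, ε]`, one outside `[-2ε, 2ε]` and linear in between
  set g : ℝ → ℝ := fun s ↦ min 1 (max 0 ((|s| - ε) / ε)) with hg
  have hgc : Continuous g := by rw [hg]; fun_prop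
  have hg0 : ∀ t, 0 ≤ g t := fun t ↦ le_min zero_le_one (le_max_left _ _)
  refine ⟨fun t ↦ ∫ s in (0 : ℝ)..t, g s, g, hgc, fun t ↦ ?_, hg0, fun t ht ↦ ?_, fun t ht ↦ ?_,
    fun t ↦ ?_⟩
  · exact intervalIntegral.integral_hasDerivAt_right (hgc.intervalIntegrable _ _)
      (hgc.stronglyMeasurableAtFilter _ _) hgc.continuousAt
  · refine min_eq_left (le_max_of_le_right ((one_le_div hε).2 (by linarith)))
  · refine (intervalIntegral.integral_congr (g := fun _ ↦ (0 : ℝ)) fun s hs ↦ ?_).trans (by simp)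
    have hs' : |s| ≤ ε := by
      rw [mem_uIcc] at hs
      rw [abs_le] at ht ⊢
      constructor <;> rcases hs with hs | hs <;> linarith
    simp only [hg]
    rw [max_eq_left (div_nonpos_of_nonpos_of_nonneg (by linarith) hε.le)]
    simp
  · have := intervalIntegral.norm_integral_le_of_norm_le_const (a := 0) (b := t) (f := g) (C := 1)
      fun s _ ↦ by
        rw [Real.norm_eq_abs, abs_of_nonneg (hg0 s)]; exact min_le_left _ _
    simpa using this

end Cutoff

/-! ### The energy estimate -/

section GradientRules

variable {E : Type*} [NormedAddCommGroup E] [InnerProductSpace ℝ E] [FiniteDimensional ℝ E]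
  {P : Type*} [TopologicalSpace P] [ChartedSpace E P]
  [RiemannianBundle (fun x : P ↦ TangentSpace 𝓘(ℝ, E) x)]
  {u p q : P → ℝ} {x : P}

lemma grad_congr (h : p =ᶠ[𝓝 x] q) : grad (E := E) p x = grad (E := E) q x := by
  refine ext_inner_right ℝ fun v ↦ (inner_grad p x v).trans (Eq.trans ?_ (inner_grad q x v).symm)
  exact congrArg (fun T : E →L[ℝ] ℝ ↦ T v) h.mfderiv_eq

lemma metric_grad_mul (hp : MDifferentiableAt 𝓘(ℝ, E) 𝓘(ℝ, ℝ) p x)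
    (hq : MDifferentiableAt 𝓘(ℝ, E) 𝓘(ℝ, ℝ) q x) (v : TangentSpace 𝓘(ℝ, E) x) :
    metric x (grad (E := E) (fun z ↦ p z * q z) x) v =
      p x * metric x (grad (E := E) q x) v + q x * metric x (grad (E := E) p x) v := by
  obtain ⟨S, hS, hSv⟩ : ∃ S : E →L[ℝ] ℝ, HasMFDerivAt 𝓘(ℝ, E) 𝓘(ℝ, ℝ) p x S ∧
      S v = metric x (grad (E := E) p x) v := ⟨_, hp.hasMFDerivAt, (inner_grad p x v).symm⟩
  obtain ⟨T, hT, hTv⟩ : ∃ T : E →L[ℝ] ℝ, HasMFDerivAt 𝓘(ℝ, E) 𝓘(ℝ, ℝ) q x T ∧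
      T v = metric x (grad (E := E) q x) v := ⟨_, hq.hasMFDerivAt, (inner_grad q x v).symm⟩
  have h1 : HasMFDerivAt 𝓘(ℝ, E) 𝓘(ℝ, ℝ) (fun z ↦ p z * q z) x
      (p x • T + q x • S : E →L[ℝ] ℝ) := hS.mul hT
  rw [← hSv, ← hTv]
  refine (inner_grad _ x v).trans ?_
  exact congrArg (fun T : E →L[ℝ] ℝ ↦ T v) h1.mfderiv

lemma metric_grad_comp {G : ℝ → ℝ} {g : ℝ} (hG : HasDerivAt G g (u x))
    (hu : MDifferentiableAt 𝓘(ℝ, E) 𝓘(ℝ, ℝ) u x) (v : TangentSpace 𝓘(ℝ, E) x) :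
    metric x (grad (E := E) (G ∘ u) x) v = g * metric x (grad (E := E) u x) v := by
  obtain ⟨S, hS, hSv⟩ : ∃ S : E →L[ℝ] ℝ, HasMFDerivAt 𝓘(ℝ, E) 𝓘(ℝ, ℝ) u x S ∧
      S v = metric x (grad (E := E) u x) v := ⟨_, hu.hasMFDerivAt, (inner_grad u x v).symm⟩
  have h1 : HasMFDerivAt 𝓘(ℝ, E) 𝓘(ℝ, ℝ) (G ∘ u) x
      ((ContinuousLinearMap.toSpanSingleton ℝ g).comp S) :=
    HasMFDerivAt.comp x hG.hasFDerivAt.hasMFDerivAt hS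
  rw [← hSv]
  refine (inner_grad _ x v).trans ?_
  refine (congrArg (fun T : E →L[ℝ] ℝ ↦ T v) h1.mfderiv).trans ?_
  exact mul_comm (S v) g

end GradientRules

section Energy

variable {E : Type*} [NormedAddCommGroup E] [InnerProductSpace ℝ E] [FiniteDimensional ℝ E]
  {F : Type*} [NormedAddCommGroup F] [InnerProductSpace ℝ F] [FiniteDimensional ℝ F]
  {P : Type*} [EMetricSpace P] [ChartedSpace E P] [IsManifold 𝓘(ℝ, E) ∞ P]
  {M : Type*} [TopologicalSpace M] [ChartedSpace F M] [IsManifold 𝓘(ℝ, F) ∞ M]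
  [RiemannianBundle (fun p : M ↦ TangentSpace 𝓘(ℝ, F) p)]
  [RiemannianBundle (fun x : P ↦ TangentSpace 𝓘(ℝ, E) x)]
  [IsContMDiffRiemannianBundle 𝓘(ℝ, F) ∞ F (fun p : M ↦ TangentSpace 𝓘(ℝ, F) p)]
  [IsContMDiffRiemannianBundle 𝓘(ℝ, E) ∞ E (fun x : P ↦ TangentSpace 𝓘(ℝ, E) x)]
  [IsRiemannianManifold 𝓘(ℝ, E) P]
  {Y : ∀ p : M, TangentSpace 𝓘(ℝ, F) p}
  {ϑ : Diffeomorph (𝓘(ℝ, E).prod 𝓘(ℝ, ℝ)) 𝓘(ℝ, F) (P × ℝ) M ∞}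
  {u : P → ℝ} {Ω : Set P} {A : ℝ}

lemma norm_grad_le_graphSlope (x : P) : ‖grad (E := E) u x‖ ≤ graphSlope (E := E) Y ϑ u x :=
  Real.le_sqrt_of_sq_le (by linarith [Real.exp_pos (2 * potential Y (ϑ (x, 0)))])

/-- The truncation of `u` is `C¹` on all of `P` when extended by zero: near points outside `Ω` it
vanishes, because `u` tends to zero at the boundary of `Ω`. -/
lemma contMDiff_truncation (hΩ : IsOpen Ω) (hu : ContMDiffOn 𝓘(ℝ, E) 𝓘(ℝ, ℝ) ∞ u Ω)
    (hu0 : Continuous (Ω.indicator u)) {G g : ℝ → ℝ} {ε : ℝ} (hε : 0 < ε) (hgc : Continuous g)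
    (hG : ∀ t, HasDerivAt G (g t) t) (hG0 : ∀ t, |t| ≤ ε → G t = 0) :
    ContMDiff 𝓘(ℝ, E) 𝓘(ℝ, ℝ) 1 (G ∘ Ω.indicator u) := by
  have hG1 : ContDiff ℝ 1 G := by
    rw [contDiff_one_iff_deriv]
    exact ⟨fun t ↦ (hG t).differentiableAt, by rwa [funext fun t ↦ (hG t).deriv]⟩
  intro x
  by_cases hx : x ∈ Ω
  · have h1 : ContMDiffAt 𝓘(ℝ, E) 𝓘(ℝ, ℝ) 1 (G ∘ u) x :=
      hG1.contMDiff.contMDiffAt.comp x ((hu.contMDiffAt (hΩ.mem_nhds hx)).of_le (by norm_cast))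
    refine h1.congr_of_eventuallyEq ?_
    filter_upwards [hΩ.mem_nhds hx] with z hz
    simp only [Function.comp, indicator_of_mem hz]
  · have h1 : ContMDiffAt 𝓘(ℝ, E) 𝓘(ℝ, ℝ) 1 (fun _ : P ↦ (0 : ℝ)) x := contMDiffAt_const
    refine h1.congr_of_eventuallyEq ?_
    filter_upwards [hu0.abs.continuousAt.eventually_lt (continuousAt_const (y := ε))
      (by simpa [indicator_of_notMem hx] using hε)] with z hz
    exact hG0 _ hz.le

/-- The pointwise form of the energy estimate: the test function `φ = η G(u)` turns the divergence
into `η g(u) |∇u|² / W` plus terms bounded in terms of `A`. -/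
lemma le_divIntegrand_add (hΩ : IsOpen Ω) (hu : ContMDiffOn 𝓘(ℝ, E) 𝓘(ℝ, ℝ) ∞ u Ω) {D : ℝ}
    {x : P} (hx : x ∈ Ω) (hA1 : |u x| ≤ A * Real.exp (potential Y (ϑ (x, 0))))
    (hA2 : |weightedMeanCurvature (E := E) (F := F)
      (fun p ↦ D * potential Y p) (graphMap ϑ u) (upwardNormal (E := E) Y ϑ u) x| ≤ A)
    {G g : ℝ → ℝ} (hG : HasDerivAt G (g (u x)) (u x)) (hGu : |G (u x)| ≤ |u x|)
    {η : P → ℝ} {L : ℝ≥0} (hη : LipschitzWith L η) (hη0 : 0 ≤ η x) (hη1 : η x ≤ 1)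
    (hηd : MDifferentiableAt 𝓘(ℝ, E) 𝓘(ℝ, ℝ) η x) :
    η x * (g (u x) * (‖grad (E := E) u x‖ ^ 2 / graphSlope (E := E) Y ϑ u x *
        Real.exp (-((D + 1) * potential Y (ϑ (x, 0)))))) ≤
      divIntegrand (E := E) Y ϑ u D (fun z ↦ η z * (G ∘ Ω.indicator u) z) x +
        A * (Module.finrank ℝ E * A + L) * Real.exp (-(D * potential Y (ϑ (x, 0)))) := by
  have hum : MDifferentiableAt 𝓘(ℝ, E) 𝓘(ℝ, ℝ) u x :=
    (hu.contMDiffAt (hΩ.mem_nhds hx)).mdifferentiableAt (by simp)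
  have hev : G ∘ Ω.indicator u =ᶠ[𝓝 x] G ∘ u := by
    filter_upwards [hΩ.mem_nhds hx] with z hz
    simp only [Function.comp, indicator_of_mem hz]
  have hwd : MDifferentiableAt 𝓘(ℝ, E) 𝓘(ℝ, ℝ) (G ∘ u) x :=
    hG.differentiableAt.mdifferentiableAt.comp x hum
  have h1 := metric_grad_mul hηd (hwd.congr_of_eventuallyEq hev) (grad (E := E) u x)
  rw [grad_congr hev, metric_grad_comp hG hum, hev.self_of_nhds] at h1
  have h2 : metric x (grad (E := E) u x) (grad (E := E) u x) = ‖grad (E := E) u x‖ ^ 2 :=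
    real_inner_self_eq_norm_sq _
  rw [h2] at h1
  have h3 := abs_metric_grad_le hη hηd (grad (E := E) u x)
  have hW := graphSlope_pos (E := E) (Y := Y) (ϑ := ϑ) (u := u) x
  have hNW := norm_grad_le_graphSlope (E := E) (Y := Y) (ϑ := ϑ) (u := u) x
  have hwx : (G ∘ Ω.indicator u) x = G (u x) := hev.self_of_nhds
  rw [divIntegrand, hwx, h1]
  simp only [Function.comp]
  set N := ‖grad (E := E) u x‖
  set W := graphSlope (E := E) Y ϑ u x
  set m := metric x (grad (E := E) η x) (grad (E := E) u x)
  set H := weightedMeanCurvature (E := E) (F := F)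
      (fun p ↦ D * potential Y p) (graphMap ϑ u) (upwardNormal (E := E) Y ϑ u) x
  set w := G (u x)
  set ψ := potential Y (ϑ (x, 0))
  set n : ℝ := (Module.finrank ℝ E : ℝ)
  have hn0 : 0 ≤ n := Nat.cast_nonneg _
  have hexp : Real.exp (-(D * ψ)) = Real.exp ψ * Real.exp (-((D + 1) * ψ)) := by
    rw [← Real.exp_add]; congr 1; ring
  have hw : |w| ≤ A * Real.exp ψ := hGu.trans hA1
  have hA0 : 0 ≤ A := (abs_nonneg _).trans hA2
  have hm : |m / W| ≤ L := by
    rw [abs_div, abs_of_pos hW, div_le_iff₀ hW]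
    exact h3.trans (mul_le_mul_of_nonneg_left hNW L.coe_nonneg)
  have hsum : |w * (m / W) + η x * w * (n * H)| ≤ A * Real.exp ψ * (n * A + L) := by
    calc |w * (m / W) + η x * w * (n * H)| ≤ |w| * |m / W| + |η x| * |w| * (n * |H|) := by
          refine (abs_add_le _ _).trans (le_of_eq ?_)
          rw [abs_mul, abs_mul, abs_mul, abs_mul, abs_of_nonneg hn0]
      _ ≤ A * Real.exp ψ * L + 1 * (A * Real.exp ψ) * (n * A) := by
          rw [abs_of_nonneg hη0]
          gcongr
      _ = _ := by ring
  have he := Real.exp_pos (-((D + 1) * ψ))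
  have h5 := mul_le_mul_of_nonneg_right (neg_abs_le _ |>.trans' (neg_le_neg hsum)) he.le
  have h6 : ((η x * (g (u x) * N ^ 2) + w * m) / W + η x * w * (n * H)) =
    η x * (g (u x) * (N ^ 2 / W)) + (w * (m / W) + η x * w * (n * H)) := by ring
  rw [h6, hexp]
  linarith

end Energy

section ZeroSet

/-- The derivative vanishes almost everywhere on the zero set. -/
lemma ae_fderiv_eq_zero_of_eq_zero {E : Type*} [NormedAddCommGroup E] [NormedSpace ℝ E]
    [FiniteDimensional ℝ E] [Nontrivial E] [MeasurableSpace E] [BorelSpace E] {μ : Measure E}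
    [μ.IsAddHaarMeasure] {f : E → ℝ} {U : Set E} (hU : IsOpen U)
    (hf : ∀ y ∈ U, DifferentiableAt ℝ f y) :
    ∀ᵐ y ∂μ, y ∈ U → f y = 0 → fderiv ℝ f y = 0 := by
  obtain ⟨v, hv⟩ := exists_ne (0 : E)
  set s : Set E := U ∩ f ⁻¹' {0} with hs
  have hsm : MeasurableSet s := by
    have h1 : ContinuousOn f U := fun y hy ↦ (hf y hy).continuousAt.continuousWithinAt
    have h2 : s = U \ (U ∩ f ⁻¹' {0}ᶜ) := by ext y; simp [hs]
    rw [h2]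
    exact hU.measurableSet.diff (h1.isOpen_inter_preimage hU isOpen_compl_singleton).measurableSet
  -- the map `f v` is constant on the zero set, hence approximated there by the zero linear map
  have hlin : ApproximatesLinearOn (fun y ↦ f y • v) (0 : E →L[ℝ] E) s 0 := by
    intro a ha b hb
    have ha' : f a = 0 := ha.2
    have hb' : f b = 0 := hb.2
    simp [ha', hb']
  have h1 := hlin.norm_fderiv_sub_le (μ := μ) hsm (fun y ↦ (fderiv ℝ f y).smulRight v)
    fun y hy ↦ ((hf y hy.1).hasFDerivAt.smul_const v).hasFDerivWithinAt
  rw [ae_restrict_iff' hsm] at h1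
  filter_upwards [h1] with y hy hyU hy0
  have h2 := hy ⟨hyU, hy0⟩
  rw [sub_zero, nonpos_iff_eq_zero, nnnorm_eq_zero] at h2
  ext a
  have h3 := congrArg (fun T : E →L[ℝ] E ↦ T a) h2
  simpa [hv] using h3

variable {E : Type*} [NormedAddCommGroup E] [InnerProductSpace ℝ E] [FiniteDimensional ℝ E]
  [MeasurableSpace E] [BorelSpace E]
  {P : Type*} [TopologicalSpace P] [ChartedSpace E P] [IsManifold 𝓘(ℝ, E) ∞ P]
  [RiemannianBundle (fun x : P ↦ TangentSpace 𝓘(ℝ, E) x)]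
  [IsContMDiffRiemannianBundle 𝓘(ℝ, E) ∞ E (fun x : P ↦ TangentSpace 𝓘(ℝ, E) x)]
  [MeasurableSpace P] [BorelSpace P] [SecondCountableTopology P] [Nonempty P]
  {u : P → ℝ} {Ω : Set P}

/-- The gradient of `u` vanishes almost everywhere on the zero set of `u`. -/
lemma ae_grad_eq_zero_of_eq_zero (hn : Module.finrank ℝ E ≠ 0) (hΩ : IsOpen Ω)
    (hu : ContMDiffOn 𝓘(ℝ, E) 𝓘(ℝ, ℝ) ∞ u Ω) :
    ∀ᵐ x ∂riemannianVolume (metric (E := E) (P := P)), x ∈ Ω → u x = 0 →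
      ‖grad (E := E) u x‖ ^ 2 = 0 := by
  have : Nontrivial E := Module.nontrivial_of_finrank_pos (R := ℝ) (Nat.pos_of_ne_zero hn)
  refine ae_of_forall_ae_chart (E := E) fun c ↦ ae_of_ae_inChart ?_
  have hT := isOpen_extChartAt_target (I := 𝓘(ℝ, E)) c
  have hum : ∀ y, (extChartAt 𝓘(ℝ, E) c).symm y ∈ Ω → MDifferentiableAt 𝓘(ℝ, E) 𝓘(ℝ, ℝ) u
      ((extChartAt 𝓘(ℝ, E) c).symm y) := fun y hy ↦
    (hu.contMDiffAt (hΩ.mem_nhds hy)).mdifferentiableAt (by simp)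
  have h1 := ae_fderiv_eq_zero_of_eq_zero (μ := volume) (f := inChart c u)
    ((continuousOn_extChartAt_symm c).isOpen_inter_preimage hT hΩ)
    fun y hy ↦ differentiableAt_inChart hy.1 (hum y hy.2)
  filter_upwards [ae_restrict_of_ae h1, ae_restrict_mem hT.measurableSet] with y hy hyT hyΩ hy0
  rw [norm_grad_sq hyT (hum y hyΩ), hy ⟨hyT, hyΩ⟩ hy0]
  rfl

end ZeroSet

section Energy

variable {E : Type*} [NormedAddCommGroup E] [InnerProductSpace ℝ E] [FiniteDimensional ℝ E]
  {F : Type*} [NormedAddCommGroup F] [InnerProductSpace ℝ F] [FiniteDimensional ℝ F]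
  {P : Type*} [EMetricSpace P] [ChartedSpace E P] [IsManifold 𝓘(ℝ, E) ∞ P]
  {M : Type*} [TopologicalSpace M] [ChartedSpace F M] [IsManifold 𝓘(ℝ, F) ∞ M]
  [RiemannianBundle (fun p : M ↦ TangentSpace 𝓘(ℝ, F) p)]
  [RiemannianBundle (fun x : P ↦ TangentSpace 𝓘(ℝ, E) x)]
  [IsContMDiffRiemannianBundle 𝓘(ℝ, F) ∞ F (fun p : M ↦ TangentSpace 𝓘(ℝ, F) p)]
  [IsContMDiffRiemannianBundle 𝓘(ℝ, E) ∞ E (fun x : P ↦ TangentSpace 𝓘(ℝ, E) x)]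
  {Y : ∀ p : M, TangentSpace 𝓘(ℝ, F) p}
  {ϑ : Diffeomorph (𝓘(ℝ, E).prod 𝓘(ℝ, ℝ)) 𝓘(ℝ, F) (P × ℝ) M ∞}
  {u : P → ℝ} {Ω : Set P} {A D : ℝ}

/-- The density `e^{-(D+1)ψ} |∇u|² / W`. -/
def energyDensity (Y : ∀ p : M, TangentSpace 𝓘(ℝ, F) p) (ϑ : P × ℝ → M) (u : P → ℝ) (D : ℝ)
    (x : P) : ℝ :=
  ‖grad (E := E) u x‖ ^ 2 / graphSlope (E := E) Y ϑ u x *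
    Real.exp (-((D + 1) * potential Y (ϑ (x, 0))))

lemma energyDensity_nonneg (x : P) : 0 ≤ energyDensity (E := E) Y ϑ u D x :=
  mul_nonneg (div_nonneg (sq_nonneg _) (graphSlope_pos x).le) (Real.exp_pos _).le

variable [MeasurableSpace E] [BorelSpace E] [IsRiemannianManifold 𝓘(ℝ, E) P] [CompleteSpace P]
  [MeasurableSpace P] [BorelSpace P] [SecondCountableTopology P] [Nonempty P]

/-- The energy estimate away from the zero set of `u`. -/
lemma setLIntegral_energyDensity_truncated_le (hY : IsKilling Y) (h : IsFlowFromLeaf Y ϑ)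
    (hn : Module.finrank ℝ E ≠ 0) (hΩ : IsOpen Ω) (hu : ContMDiffOn 𝓘(ℝ, E) 𝓘(ℝ, ℝ) ∞ u Ω)
    (hu0 : Continuous (Ω.indicator u))
    (hA0 : 0 ≤ A) (hA1 : ∀ x ∈ Ω, |u x| ≤ A * Real.exp (potential Y (ϑ (x, 0))))
    (hA2 : ∀ x ∈ Ω, |weightedMeanCurvature (E := E) (F := F)
      (fun p ↦ D * potential Y p) (graphMap ϑ u) (upwardNormal (E := E) Y ϑ u) x| ≤ A)
    {x₀ : P} {r s : ℝ≥0} (hrs : r < s)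
    (hV : weightedVolume (F := E) (fun x : P ↦ D * potential Y (ϑ (x, 0)))
      (Metric.eball x₀ s ∩ Ω) ≠ ⊤) {ε : ℝ} (hε : 0 < ε) :
    ∫⁻ x in Metric.eball x₀ r ∩ {x | 2 * ε ≤ |Ω.indicator u x|},
        ENNReal.ofReal (energyDensity (E := E) Y ϑ u D x) ∂riemannianVolume
          (metric (E := E) (P := P)) ≤
      ENNReal.ofReal (A * (Module.finrank ℝ E * A + ((s - r)⁻¹ : ℝ≥0))) *
        weightedVolume (F := E) (fun x : P ↦ D * potential Y (ϑ (x, 0)))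
          (Metric.eball x₀ s ∩ Ω) := by
  set μ := riemannianVolume (metric (E := E) (P := P)) with hμ
  set S := Metric.eball x₀ (s : ℝ≥0∞) ∩ Ω with hS
  have hSm : MeasurableSet S := (Metric.isOpen_eball.inter hΩ).measurableSet
  set k : ℝ := A * (Module.finrank ℝ E * A + ((s - r)⁻¹ : ℝ≥0)) with hk
  have hk0 : 0 ≤ k := by positivity
  obtain ⟨η, hηL, hη0, hη1, hηr, hηs⟩ := exists_cutoff x₀ hrs
  obtain ⟨G, g, hgc, hG, hg0, hg1, hG0, hGle⟩ := exists_truncation hε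
  set φ : P → ℝ := fun z ↦ η z * (G ∘ Ω.indicator u) z with hφ
  have hφL : LocallyLipschitzInCharts E φ := locallyLipschitzInCharts_mul_contMDiff
    (locallyLipschitzInCharts_of_lipschitzWith hηL) (contMDiff_truncation hΩ hu hu0 hε hgc hG hG0)
  -- the test function vanishes off `K`, which is compact and contained in `Ω`
  set K : Set P := Metric.closedEBall x₀ s ∩ {x | ε ≤ |Ω.indicator u x|} with hK
  have hKc : IsCompact K := (isCompact_closedEBall E x₀ s).inter_right
    (isClosed_le continuous_const hu0.abs)
  have hKΩ : K ⊆ Ω := by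
    intro x hx
    by_contra hxΩ
    have := hx.2
    simp only [mem_ofPred_eq, indicator_of_notMem hxΩ, abs_zero] at this
    linarith
  have hφK : ∀ x, x ∉ K → φ x = 0 := by
    intro x hx
    by_cases hxs : edist x x₀ < s
    · have : |Ω.indicator u x| < ε := by
        by_contra hcon
        exact hx ⟨hxs.le, not_lt.1 hcon⟩
      simp only [hφ, Function.comp, hG0 _ this.le, mul_zero]
    · simp only [hφ, hηs x hxs, zero_mul]
  obtain ⟨hI, hI0⟩ := integral_divIntegrand hY h D hn hΩ hu hφL hKc hKΩ hφK
  -- the dominating function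
  set w : P → ℝ := fun x ↦ Real.exp (-(D * potential Y (ϑ (x, 0)))) with hw
  have hwc : Continuous w :=
    ((contMDiff_leafPotential (E := E) h).continuous.const_mul D).neg.rexp
  have hwI : IntegrableOn w S μ := by
    refine ⟨hwc.aestronglyMeasurable, ?_⟩
    rw [hasFiniteIntegral_iff_ofReal (Eventually.of_forall fun x ↦ (Real.exp_pos _).le)]
    exact lt_top_iff_ne_top.2 hV
  set β : P → ℝ := S.indicator fun x ↦ k * w x with hβ
  have hβI : Integrable β μ := (integrable_indicator_iff hSm).2 (hwI.const_mul k)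
  have hβ0 : ∀ x, 0 ≤ β x := fun x ↦ indicator_nonneg
    (fun x _ ↦ mul_nonneg hk0 (Real.exp_pos _).le) x
  set a : P → ℝ := Ω.indicator fun x ↦ η x * (g (u x) * energyDensity (E := E) Y ϑ u D x) with ha
  have ha0 : ∀ x, 0 ≤ a x := fun x ↦ indicator_nonneg
    (fun x _ ↦ mul_nonneg (hη0 x) (mul_nonneg (hg0 _) (energyDensity_nonneg x))) x
  have hle : ∀ᵐ x ∂μ, a x ≤ divIntegrand (E := E) Y ϑ u D φ x + β x := by
    filter_upwards [(locallyLipschitzInCharts_of_lipschitzWith (E := E)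
      hηL).ae_mdifferentiableAt] with x hx
    by_cases hxΩ : x ∈ Ω
    · by_cases hxs : edist x x₀ < s
      · have h1 := le_divIntegrand_add hΩ hu hxΩ (hA1 x hxΩ) (hA2 x hxΩ) (hG (u x)) (hGle (u x)) hηL
          (hη0 x) (hη1 x) hx
        simp only [ha, hβ, indicator_of_mem hxΩ]
        rw [indicator_of_mem (show x ∈ S from ⟨hxs, hxΩ⟩)]
        exact h1
      · -- the cutoff attains its minimum at `x`, so both it and its gradient vanish there
        have hη0x := hηs x hxs
        have h1 := metric_grad_mul hx
          ((contMDiff_truncation hΩ hu hu0 hε hgc hG hG0).mdifferentiable one_ne_zero x)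
          (grad (E := E) u x)
        rw [metric_grad_eq_zero hη0 hη0x hx, hη0x, zero_mul, mul_zero, add_zero] at h1
        have h2 : divIntegrand (E := E) Y ϑ u D φ x = 0 := by
          rw [divIntegrand, h1]
          simp only [hφ, hη0x, zero_mul, zero_div, add_zero]
        rw [h2, zero_add]
        refine le_trans (le_of_eq ?_) (hβ0 x)
        simp only [ha, indicator_of_mem hxΩ, hη0x, zero_mul]
    · have h1 : divIntegrand (E := E) Y ϑ u D φ x = 0 :=
        divIntegrand_eq_zero hKc.isClosed hφK D fun h ↦ hxΩ (hKΩ h)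
      rw [h1, ha, indicator_of_notMem hxΩ, zero_add]
      exact hβ0 x
  calc _ ≤ ∫⁻ x, ENNReal.ofReal (a x) ∂μ := by
        have hB : MeasurableSet (Metric.eball x₀ (r : ℝ≥0∞) ∩ {x | 2 * ε ≤ |Ω.indicator u x|}) :=
          Metric.isOpen_eball.measurableSet.inter
            (isClosed_le continuous_const hu0.abs).measurableSet
        refine le_trans (le_of_eq (setLIntegral_congr_fun hB fun x hx ↦ ?_))
          (setLIntegral_le_lintegral _ _)
        have hxΩ : x ∈ Ω := by
          by_contra hxΩ
          have := hx.2
          simp only [mem_ofPred_eq, indicator_of_notMem hxΩ, abs_zero] at this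
          linarith
        have h2 : 2 * ε ≤ |u x| := by simpa only [mem_ofPred_eq, indicator_of_mem hxΩ] using hx.2
        simp only [ha, indicator_of_mem hxΩ, hηr x hx.1, hg1 _ h2, one_mul]
    _ ≤ ∫⁻ x, ENNReal.ofReal (divIntegrand (E := E) Y ϑ u D φ x + β x) ∂μ :=
        lintegral_mono_ae (hle.mono fun x hx ↦ ENNReal.ofReal_le_ofReal hx)
    _ = ENNReal.ofReal (∫ x, β x ∂μ) := by
        refine (ofReal_integral_eq_lintegral_ofReal (hI.add hβI)
          (hle.mono fun x hx ↦ (ha0 x).trans hx)).symm.trans ?_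
        rw [integral_add' hI hβI, hI0, zero_add]
    _ = ∫⁻ x, ENNReal.ofReal (β x) ∂μ :=
        ofReal_integral_eq_lintegral_ofReal hβI (Eventually.of_forall hβ0)
    _ = _ := by
        rw [weightedVolume, ← lintegral_const_mul' _ _ ENNReal.ofReal_ne_top,
          ← lintegral_indicator hSm]
        refine lintegral_congr fun x ↦ ?_
        by_cases hx : x ∈ S
        · simp only [hβ, indicator_of_mem hx, ENNReal.ofReal_mul hk0]; rfl
        · simp only [hβ, indicator_of_notMem hx, ENNReal.ofReal_zero]

end Energy

/-! ### The volume estimate -/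

section VolumeEstimate

variable {E : Type*} [NormedAddCommGroup E] [InnerProductSpace ℝ E] [FiniteDimensional ℝ E]
  [MeasurableSpace E] [BorelSpace E]
  {F : Type*} [NormedAddCommGroup F] [InnerProductSpace ℝ F] [FiniteDimensional ℝ F]
  {P : Type*} [EMetricSpace P] [ChartedSpace E P] [IsManifold 𝓘(ℝ, E) ∞ P]
  [RiemannianBundle (fun x : P ↦ TangentSpace 𝓘(ℝ, E) x)]
  [IsContMDiffRiemannianBundle 𝓘(ℝ, E) ∞ E (fun x : P ↦ TangentSpace 𝓘(ℝ, E) x)]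
  [IsRiemannianManifold 𝓘(ℝ, E) P]
  [MeasurableSpace P] [BorelSpace P] [SecondCountableTopology P] [Nonempty P]
  {u : P → ℝ} {Ω : Set P} {A D : ℝ}

section Energy
variable {M : Type*} [TopologicalSpace M] [ChartedSpace F M] [IsManifold 𝓘(ℝ, F) ∞ M]
  [RiemannianBundle (fun p : M ↦ TangentSpace 𝓘(ℝ, F) p)]
  [IsContMDiffRiemannianBundle 𝓘(ℝ, F) ∞ F (fun p : M ↦ TangentSpace 𝓘(ℝ, F) p)]
  [CompleteSpace P]
  {Y : ∀ p : M, TangentSpace 𝓘(ℝ, F) p}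
  {ϑ : Diffeomorph (𝓘(ℝ, E).prod 𝓘(ℝ, ℝ)) 𝓘(ℝ, F) (P × ℝ) M ∞}

/-- The energy estimate: the zero set of `u` does not contribute, since the gradient vanishes
almost everywhere on it. -/
lemma setLIntegral_energyDensity_le (hY : IsKilling Y) (h : IsFlowFromLeaf Y ϑ)
    (hn : Module.finrank ℝ E ≠ 0) (hΩ : IsOpen Ω) (hu : ContMDiffOn 𝓘(ℝ, E) 𝓘(ℝ, ℝ) ∞ u Ω)
    (hu0 : Continuous (Ω.indicator u))
    (hA0 : 0 ≤ A) (hA1 : ∀ x ∈ Ω, |u x| ≤ A * Real.exp (potential Y (ϑ (x, 0))))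
    (hA2 : ∀ x ∈ Ω, |weightedMeanCurvature (E := E) (F := F)
      (fun p ↦ D * potential Y p) (graphMap ϑ u) (upwardNormal (E := E) Y ϑ u) x| ≤ A)
    {x₀ : P} {r s : ℝ≥0} (hrs : r < s)
    (hV : weightedVolume (F := E) (fun x : P ↦ D * potential Y (ϑ (x, 0)))
      (Metric.eball x₀ s ∩ Ω) ≠ ⊤) :
    ∫⁻ x in Metric.eball x₀ r ∩ Ω,
        ENNReal.ofReal (energyDensity (E := E) Y ϑ u D x) ∂riemannianVolume
          (metric (E := E) (P := P)) ≤
      ENNReal.ofReal (A * (Module.finrank ℝ E * A + ((s - r)⁻¹ : ℝ≥0))) *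
        weightedVolume (F := E) (fun x : P ↦ D * potential Y (ϑ (x, 0)))
          (Metric.eball x₀ s ∩ Ω) := by
  -- `{u ≠ 0}` is the increasing union of the sets `{2 / (k + 1) ≤ |u|}`
  set B : ℕ → Set P := fun k ↦ Metric.eball x₀ (r : ℝ≥0∞) ∩
    {x | 2 * (1 / ((k : ℝ) + 1)) ≤ |Ω.indicator u x|} with hB
  set Z : Set P := Ω ∩ {x | Ω.indicator u x = 0} with hZ
  have hZm : MeasurableSet Z := hΩ.measurableSet.inter
    (isClosed_eq hu0 continuous_const).measurableSet
  have hcov : Metric.eball x₀ (r : ℝ≥0∞) ∩ Ω ⊆ (⋃ k, B k) ∪ Z := by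
    rintro x ⟨hx, hxΩ⟩
    by_cases h0 : Ω.indicator u x = 0
    · exact Or.inr ⟨hxΩ, h0⟩
    · obtain ⟨k, hk⟩ := exists_nat_one_div_lt (half_pos (abs_pos.2 h0))
      exact Or.inl (mem_iUnion.2 ⟨k, hx, by rw [mem_ofPred_eq]; linarith⟩)
  have hdir : Directed (· ⊆ ·) B := by
    refine directed_of_isDirected_le fun i j hij x hx ↦ ⟨hx.1, ?_⟩
    refine le_trans (b := 2 * (1 / ((i : ℝ) + 1))) ?_ hx.2
    have : 1 / ((j : ℝ) + 1) ≤ 1 / ((i : ℝ) + 1) :=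
      one_div_le_one_div_of_le (by positivity) (by gcongr)
    linarith
  have hZ0 : ∫⁻ x in Z, ENNReal.ofReal (energyDensity (E := E) Y ϑ u D x) ∂riemannianVolume
      (metric (E := E) (P := P)) = 0 := by
    refine (lintegral_congr_ae (g := fun _ ↦ 0) ((ae_restrict_iff' hZm).2 ?_)).trans lintegral_zero
    filter_upwards [ae_grad_eq_zero_of_eq_zero hn hΩ hu] with x hx hxZ
    have h0 : u x = 0 := by simpa only [mem_ofPred_eq, indicator_of_mem hxZ.1] using hxZ.2
    rw [energyDensity, hx hxZ.1 h0, zero_div, zero_mul, ENNReal.ofReal_zero]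
  refine (lintegral_mono_set hcov).trans ((lintegral_union_le _ _ _).trans ?_)
  rw [hZ0, add_zero, setLIntegral_iUnion_of_directed _ hdir]
  exact iSup_le fun k ↦ setLIntegral_energyDensity_truncated_le hY h hn hΩ hu hu0 hA0 hA1 hA2 hrs
    hV (by positivity)

end Energy

variable {M : Type*} [EMetricSpace M] [CompleteSpace M] [ChartedSpace F M]
  [IsManifold 𝓘(ℝ, F) ∞ M]
  [RiemannianBundle (fun p : M ↦ TangentSpace 𝓘(ℝ, F) p)]
  [IsContMDiffRiemannianBundle 𝓘(ℝ, F) ∞ F (fun p : M ↦ TangentSpace 𝓘(ℝ, F) p)]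
  [IsRiemannianManifold 𝓘(ℝ, F) M]
  {Y : ∀ p : M, TangentSpace 𝓘(ℝ, F) p}
  {ϑ : Diffeomorph (𝓘(ℝ, E).prod 𝓘(ℝ, ℝ)) 𝓘(ℝ, F) (P × ℝ) M ∞}

/-- The pointwise bound `e^{-ψ} W e^{-Dψ} ≤ e^{-Dψ} + e^{-(D+1)ψ} |∇u|² / W` for the weighted area
element, which follows from `W ≤ e^ψ + |∇u|² / W`. -/
lemma exp_mul_graphSlope_le (x : P) :
    Real.exp (-potential Y (ϑ (x, 0))) * graphSlope (E := E) Y ϑ u x *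
        Real.exp (-(D * potential Y (ϑ (x, 0)))) ≤
      Real.exp (-(D * potential Y (ϑ (x, 0)))) + energyDensity (E := E) Y ϑ u D x := by
  have hW := graphSlope_pos (E := E) (Y := Y) (ϑ := ϑ) (u := u) x
  have hsq : graphSlope (E := E) Y ϑ u x ^ 2 =
      Real.exp (2 * potential Y (ϑ (x, 0))) + ‖grad (E := E) u x‖ ^ 2 :=
    Real.sq_sqrt (by positivity)
  rw [energyDensity]
  set N := ‖grad (E := E) u x‖
  set W := graphSlope (E := E) Y ϑ u x
  set ψ := potential Y (ϑ (x, 0))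
  have h2 : Real.exp (2 * ψ) = Real.exp ψ ^ 2 := by rw [← Real.exp_nat_mul]; norm_num
  have hle : Real.exp ψ ≤ W := by
    refine le_of_sq_le_sq ?_ hW.le
    rw [hsq, h2]; nlinarith [sq_nonneg N]
  have hW2 : W ≤ Real.exp ψ + N ^ 2 / W := by
    rw [← sub_le_iff_le_add', le_div_iff₀ hW]
    nlinarith [Real.exp_pos ψ]
  have h3 : Real.exp (-((D + 1) * ψ)) = Real.exp (-ψ) * Real.exp (-(D * ψ)) := by
    rw [← Real.exp_add]; congr 1; ring
  have h4 : Real.exp (-(D * ψ)) = Real.exp ψ * Real.exp (-((D + 1) * ψ)) := by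
    rw [← Real.exp_add]; congr 1; ring
  have h5 := mul_le_mul_of_nonneg_right hW2 (Real.exp_pos (-((D + 1) * ψ))).le
  calc _ = W * Real.exp (-((D + 1) * ψ)) := by rw [h3]; ring
    _ ≤ _ := h5
    _ = _ := by rw [h4]; ring

/-- The volume of an intrinsic ball of the graph is bounded by the volume of its projection plus the
energy of `u` there. -/
lemma hypersurfaceVolume_le (hY : IsKilling Y) (h : IsFlowFromLeaf Y ϑ)
    (hΩ : IsOpen Ω) (hu : ContMDiffOn 𝓘(ℝ, E) 𝓘(ℝ, ℝ) ∞ u Ω) (x₀ : P) (R : ℝ) :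
    hypersurfaceVolume (E := E) (F := F) (fun p ↦ D * potential Y p) (graphMap ϑ u) Ω
        (intrinsicBall (F := F) (graphMap ϑ u '' Ω) (graphMap ϑ u x₀) R) ≤
      weightedVolume (F := E) (fun x : P ↦ D * potential Y (ϑ (x, 0)))
          (Metric.eball x₀ (ENNReal.ofReal R) ∩ Ω) +
        ∫⁻ x in Metric.eball x₀ (ENNReal.ofReal R) ∩ Ω,
          ENNReal.ofReal (energyDensity (E := E) Y ϑ u D x) ∂riemannianVolume
            (metric (E := E) (P := P)) := by
  set B := Metric.eball x₀ (ENNReal.ofReal R) ∩ Ω with hB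
  have hBm : MeasurableSet B := (Metric.isOpen_eball.inter hΩ).measurableSet
  have hsub : Ω ∩ graphMap ϑ u ⁻¹' (intrinsicBall (F := F) (graphMap ϑ u '' Ω) (graphMap ϑ u x₀) R)
      ⊆ B := by
    rintro x ⟨-, hx⟩
    have h1 := image_intrinsicBall_subset hY h Ω u x₀ R (mem_image_of_mem _ hx)
    have hπ : (ϑ.symm (graphMap ϑ u x)).1 = x :=
      congrArg (fun p : P × ℝ ↦ p.1) (ϑ.symm_apply_apply (x, u x))
    rwa [hπ] at h1
  have hwc : Continuous fun x : P ↦ Real.exp (-(D * potential Y (ϑ (x, 0)))) :=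
    ((contMDiff_leafPotential (E := E) h).continuous.const_mul D).neg.rexp
  have hwm : Measurable fun x : P ↦ ENNReal.ofReal (Real.exp (-(D * potential Y (ϑ (x, 0))))) :=
    hwc.measurable.ennreal_ofReal
  rw [hypersurfaceVolume, weightedVolume]
  refine (lintegral_mono_set hsub).trans ?_
  simp only [graphMap, potential_flow hY h]
  rw [← lintegral_add_left hwm]
  have hr : (riemannianVolume (inducedMetric (E := E) (F := F) (graphMap ϑ u))).restrict B =
      ((riemannianVolume (inducedMetric (E := E) (F := F) (graphMap ϑ u))).restrict
        Ω).restrict B := by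
    rw [Measure.restrict_restrict hBm, inter_eq_left.2 inter_subset_right]
  rw [hr, riemannianVolume_graph hY h hΩ hu,
    setLIntegral_withDensity_eq_setLIntegral_mul _ (measurable_graphDensity h hΩ hu) hwm hBm]
  refine setLIntegral_mono_ae' hBm (Eventually.of_forall fun x hx ↦ ?_)
  rw [Pi.mul_apply, indicator_of_mem hx.2, ← ENNReal.ofReal_add (Real.exp_pos _).le
    (energyDensity_nonneg x), ← ENNReal.ofReal_mul (by
      have := graphSlope_pos (E := E) (Y := Y) (ϑ := ϑ) (u := u) x; positivity)]
  exact ENNReal.ofReal_le_ofReal (exp_mul_graphSlope_le x)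

/-- The volume estimate for intrinsic balls of a Killing graph with boundary values zero. -/
theorem hypersurfaceVolume_intrinsicBall_le (hY : IsKilling Y) (h : IsFlowFromLeaf Y ϑ)
    (hn : Module.finrank ℝ E ≠ 0) (hΩ : IsOpen Ω) (hu : ContMDiffOn 𝓘(ℝ, E) 𝓘(ℝ, ℝ) ∞ u Ω)
    (hu0 : Continuous (Ω.indicator u))
    (hA0 : 0 ≤ A) (hA1 : ∀ x ∈ Ω, |u x| ≤ A * Real.exp (potential Y (ϑ (x, 0))))
    (hA2 : ∀ x ∈ Ω, |weightedMeanCurvature (E := E) (F := F)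
      (fun p ↦ D * potential Y p) (graphMap ϑ u) (upwardNormal (E := E) Y ϑ u) x| ≤ A)
    (x₀ : P) {δ R : ℝ} (hδ : 0 < δ) (hR : 0 < R) :
    hypersurfaceVolume (E := E) (F := F) (fun p ↦ D * potential Y p) (graphMap ϑ u) Ω
        (intrinsicBall (F := F) (graphMap ϑ u '' Ω) (graphMap ϑ u x₀) R) ≤
      ENNReal.ofReal ((1 + Module.finrank ℝ E * A ^ 2 + A) * (1 + 1 / (δ * R))) *
        weightedVolume (F := E) (fun x : P ↦ D * potential Y (ϑ (x, 0)))
          (Metric.eball x₀ (ENNReal.ofReal ((1 + δ) * R)) ∩ Ω) := by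
  have : CompleteSpace P := completeSpace_leaf h
  set V := weightedVolume (F := E) (fun x : P ↦ D * potential Y (ϑ (x, 0)))
          (Metric.eball x₀ (ENNReal.ofReal ((1 + δ) * R)) ∩ Ω) with hV
  have hδR : 0 < δ * R := mul_pos hδ hR
  have hlt : R < (1 + δ) * R := by linarith
  have hC : 0 < (1 + Module.finrank ℝ E * A ^ 2 + A) * (1 + 1 / (δ * R)) := by positivity
  -- the volume on the right-hand side may be infinite, and then there is nothing to prove
  by_cases hVt : V = ⊤
  · rw [hVt, ENNReal.mul_top (ENNReal.ofReal_pos.2 hC).ne']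
    exact le_top
  have hVmono : weightedVolume (F := E) (fun x : P ↦ D * potential Y (ϑ (x, 0)))
      (Metric.eball x₀ (ENNReal.ofReal R) ∩ Ω) ≤ V :=
    lintegral_mono_set (inter_subset_inter_left _
      (Metric.eball_subset_eball (ENNReal.ofReal_le_ofReal hlt.le)))
  have hE := setLIntegral_energyDensity_le (x₀ := x₀) (r := R.toNNReal)
    (s := ((1 + δ) * R).toNNReal) hY h hn hΩ hu hu0 hA0 hA1 hA2
    ((Real.toNNReal_lt_toNNReal_iff (hR.trans hlt)).2 hlt) hVt
  have hk : (((((1 + δ) * R).toNNReal - R.toNNReal)⁻¹ : ℝ≥0) : ℝ) = 1 / (δ * R) := by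
    rw [NNReal.coe_inv, NNReal.coe_sub (Real.toNNReal_le_toNNReal hlt.le),
      Real.coe_toNNReal _ (hR.trans hlt).le, Real.coe_toNNReal _ hR.le, one_div]
    congr 1; ring
  rw [hk] at hE
  refine (hypersurfaceVolume_le hY h hΩ hu x₀ R).trans ((add_le_add hVmono hE).trans ?_)
  change V + _ * V ≤ _ * V
  have ht : 0 ≤ 1 / (δ * R) := by positivity
  calc V + ENNReal.ofReal (A * (Module.finrank ℝ E * A + 1 / (δ * R))) * V
      = ENNReal.ofReal (1 + A * (Module.finrank ℝ E * A + 1 / (δ * R))) * V := by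
        rw [ENNReal.ofReal_add zero_le_one (by positivity), ENNReal.ofReal_one, add_mul, one_mul]
    _ ≤ _ := by
        gcongr
        have : 0 ≤ (Module.finrank ℝ E : ℝ) * A ^ 2 * (1 / (δ * R)) := by positivity
        nlinarith
end VolumeEstimate

/-- Pointwise bounds from a bound on a sum of suprema. -/
lemma bound_of_iSup {X : Type*} {Ω : Set X} {f g : X → ℝ} {A : ℝ≥0}
    (h : (⨆ x ∈ Ω, ENNReal.ofReal |f x|) + (⨆ x ∈ Ω, ENNReal.ofReal |g x|) ≤ A) :
    (∀ x ∈ Ω, |f x| ≤ A) ∧ ∀ x ∈ Ω, |g x| ≤ A := by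
  have key : ∀ k : X → ℝ, (⨆ x ∈ Ω, ENNReal.ofReal |k x|) ≤ A → ∀ x ∈ Ω, |k x| ≤ A := by
    intro k hk x hx
    have h1 := (le_iSup₂ (f := fun x (_ : x ∈ Ω) ↦ ENNReal.ofReal |k x|) x hx).trans hk
    rwa [← ENNReal.ofReal_coe_nnreal, ENNReal.ofReal_le_ofReal_iff A.coe_nonneg] at h1
  exact ⟨key f (le_self_add.trans h), key g (le_add_self.trans h)⟩

end KillingGraph

end

theorem mainTheorem6 (n : ℕ) (hn : 1 ≤ n) (A : ℝ≥0) :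
    ∃ C : ℝ, 0 < C ∧
      ∀ (E : Type*) [NormedAddCommGroup E] [InnerProductSpace ℝ E] [FiniteDimensional ℝ E]
        [MeasurableSpace E] [BorelSpace E] (_ : Module.finrank ℝ E = n)
        (F : Type*) [NormedAddCommGroup F] [InnerProductSpace ℝ F] [FiniteDimensional ℝ F]
        (_ : Module.finrank ℝ F = n + 1)
        (M : Type*) [EMetricSpace M] [CompleteSpace M] [ChartedSpace F M]
        [IsManifold 𝓘(ℝ, F) ∞ M]
        [RiemannianBundle (fun p : M ↦ TangentSpace 𝓘(ℝ, F) p)]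
        [IsContMDiffRiemannianBundle 𝓘(ℝ, F) ∞ F (fun p : M ↦ TangentSpace 𝓘(ℝ, F) p)]
        [IsRiemannianManifold 𝓘(ℝ, F) M]
        (P : Type*) [EMetricSpace P] [SecondCountableTopology P] [MeasurableSpace P] [BorelSpace P]
        [ChartedSpace E P] [IsManifold 𝓘(ℝ, E) ∞ P]
        [RiemannianBundle (fun x : P ↦ TangentSpace 𝓘(ℝ, E) x)]
        [IsContMDiffRiemannianBundle 𝓘(ℝ, E) ∞ E (fun x : P ↦ TangentSpace 𝓘(ℝ, E) x)]
        [IsRiemannianManifold 𝓘(ℝ, E) P]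
        (Y : ∀ p : M, TangentSpace 𝓘(ℝ, F) p)
        (_ : KillingGraph.IsKilling Y)
        (ϑ : Diffeomorph (𝓘(ℝ, E).prod 𝓘(ℝ, ℝ)) 𝓘(ℝ, F) (P × ℝ) M ∞)
        (_ : KillingGraph.IsFlowFromLeaf Y ϑ)
        (Ω : Set P) (_ : IsOpen Ω) (u : P → ℝ)
        (_ : ContMDiffOn 𝓘(ℝ, E) 𝓘(ℝ, ℝ) ∞ u Ω)
        (x₀ : P) (_ : x₀ ∈ Ω),
        (∀ R : ℝ, 0 < R →
          (fun y : M ↦ (ϑ.symm y).1) ''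
              KillingGraph.intrinsicBall (F := F) (KillingGraph.graphMap ϑ u '' Ω)
                (KillingGraph.graphMap ϑ u x₀) R
            ⊆ Metric.eball x₀ (ENNReal.ofReal R) ∩ Ω) ∧
        ∀ D : ℝ, ContinuousOn u (closure Ω) → (∀ x ∈ frontier Ω, u x = 0) →
          (⨆ x ∈ Ω, ENNReal.ofReal
              |u x * Real.exp (-KillingGraph.potential Y (ϑ (x, 0)))|) +
            (⨆ x ∈ Ω, ENNReal.ofReal
              |KillingGraph.weightedMeanCurvature (E := E) (F := F)
                (fun p ↦ D * KillingGraph.potential Y p)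
                (KillingGraph.graphMap ϑ u) (KillingGraph.upwardNormal (E := E) (F := F) Y ϑ u) x|) ≤ A →
          ∀ δ R : ℝ, 0 < δ → 0 < R →
            KillingGraph.hypersurfaceVolume (E := E) (F := F)
                (fun p ↦ D * KillingGraph.potential Y p)
                (KillingGraph.graphMap ϑ u) Ω
                (KillingGraph.intrinsicBall (F := F) (KillingGraph.graphMap ϑ u '' Ω)
                  (KillingGraph.graphMap ϑ u x₀) R)
              ≤ ENNReal.ofReal (C * (1 + 1 / (δ * R))) *
                KillingGraph.weightedVolume (F := E)
                  (fun x : P ↦ D * KillingGraph.potential Y (ϑ (x, 0)))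
                  (Metric.eball x₀ (ENNReal.ofReal ((1 + δ) * R)) ∩ Ω) := by
  refine ⟨1 + n * (A : ℝ) ^ 2 + A, by positivity, ?_⟩
  intro E _ _ _ _ _ hE F _ _ _ hF M _ _ _ _ _ _ _ P _ _ _ _ _ _ _ _ _ Y hY ϑ h Ω hΩ u hu x₀ hx₀
  have : Nonempty P := ⟨x₀⟩
  refine ⟨fun R _ ↦ KillingGraph.image_intrinsicBall_subset hY h Ω u x₀ R, ?_⟩
  intro D huc hu0 hsup δ R hδ hR
  obtain ⟨h1, h2⟩ := KillingGraph.bound_of_iSup hsup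
  subst hE
  refine KillingGraph.hypersurfaceVolume_intrinsicBall_le hY h (by omega) hΩ hu
    (continuous_indicator hu0 huc) A.coe_nonneg (fun x hx ↦ ?_) h2 x₀ hδ hR
  have h3 := h1 x hx
  rwa [abs_mul, Real.abs_exp, Real.exp_neg, ← div_eq_mul_inv, div_le_iff₀ (Real.exp_pos _)] at h3
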